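/- Let $k$ be a field and $m\ge 3$ an integer. Let $C=C(m)$ be the $k$-algebra with generators $n,p,q,r,s,t,u,v,w$, $x_i$ $(1\le i\le m-2)$, $y_i$ $(1\le i\le m-3)$, $z_i$ $(1\le i\le m-4)$ and with the relations $$np=nq=nr,\quad ps=pt,\quad qt=qu,\quad rs=ru,\quad sv=sw,\quad tw=tx_1,\quad uv=ux_1,$$ $$sv=sy_1,\quad tw=ty_1,\quad ux_1=uy_1,\quad sz_1=tz_1=uz_1=0,\quad vx_2=wx_2=0,$$ $$x_ix_{i+1}=0,\quad y_ix_{i+1}+z_iy_{i+1}=0,\quad z_iz_{i+1}=0,$$ where a relation is imposed exactly when all the generators written in it exist (so $y_1$ occurs for $m\ge4$, $z_1$ for $m\ge 5$, $x_2$ for $m\ge4$, and so on). $C$ is graded by word length; $C_+=\bigoplus_{i\ge1}C_i$; $k=C/C_+$ is the trivial left module; $\mathrm{Ext}_C^{ij}(k,k)$ has cohomological degree $i$ and internal degree $j$; $E(A)=\bigoplus\mathrm{Ext}_A^{ij}(k,k)$ is the Yoneda algebra of a graded algebra $A$. Let $P^\bullet$ be the following sequence of graded free left $C$-modules $P^m\to\cdots\to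 P^1\to P^0=C\to k$. The map $P^0\to k$ is the augmentation. $P^1$ has a basis vector of degree $1$ for each generator, which $\lambda_1$ sends to that generator. For $2\le j\le m$, $P^j$ has the basis vectors listed here, of degree $j$ except where stated otherwise, and $\lambda_j:P^j\to P^{j-1}$ is as listed; $[g]$ denotes the basis vector of $P^{j-1}$ named $g$, with the names of the generators if $j-1=1$. * $[n]$, if $j\le m-1$ or $j\le 3$. For $j=2$ there is also $[n']$, with $[n]\mapsto n[p]-n[q]$ and $[n']\mapsto n[p]-n[r]$; for $j\ge3$, $[n]\mapsto n[p]+n[q]-n[r]$. * $[p],[q],[r]$, if $j\le m-2$ or $j=2$: $[p]\mapsto -p[s]+p[t]$, $[q]\mapsto -q[t]+q[u]$, $[r]\mapsto -r[s]+r[u]$. * $[s],[t],[u]$, if $j\le m-3$: $[g]\mapsto g[z_1]$. * $[z_i]$, $1\le i\le m-j-3$: $[z_i]\mapsto z_i[z_{i+1}]$. * $[a_1],[a_2],[a_3]$, if $3\le j\le m-1$: $[a_1]\mapsto p[b_1]-p[b_4]+p[b_5]$, $[a_2]\mapsto q[b_2]-q[b_5]+q[b_6]$, $[a_3]\mapsto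 r[b_3]-r[b_4]+r[b_6]$. * $[b_1],[b_2],[b_3]$, if $j\le m-1$: $[b_1]\mapsto s[v]-s[w]$, $[b_2]\mapsto t[w]-t[x_1]$, $[b_3]\mapsto u[v]-u[x_1]$; and $[b_4],[b_5],[b_6]$, if $j\le m-2$: $[b_4]\mapsto s[v]-s[y_1]$, $[b_5]\mapsto t[w]-t[y_1]$, $[b_6]\mapsto u[x_1]-u[y_1]$. * $[v],[w]$, if $j\le m-2$: $[v]\mapsto v[x_2]$, $[w]\mapsto w[x_2]$. * $[x_i]$, $1\le i\le m-j-1$: $[x_i]\mapsto x_i[x_{i+1}]$; and $[y_i]$, $1\le i\le m-j-2$: $[y_i]\mapsto y_i[x_{i+1}]+z_i[y_{i+1}]$. * if $j=m$, one basis vector $[\mathrm{top}]$ of degree $m+1$: $[\mathrm{top}]\mapsto np[b_1]+np[b_2]-np[b_3]$. (So $P^m=C[-m-1]$ for $m\ge4$, and $P^3=C[-3]\oplus C[-4]$ for $m=3$.) **Theorem.** For every $m\ge3$: 1. $P^\bullet$, extended by $0$ to the left of $P^m$, is a minimal graded projective (indeed free) resolution of the left $C$-module $k$. 2. The left global dimension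 of $C$ is $m$. 3. $C$ is a quadratic algebra, and $\mathrm{Ext}_C^{ij}(k,k)=0$ for all $i<j\le m$, i.e. $C$ is $m$-Koszul. 4. $\mathrm{Ext}_C^{m,m+1}(k,k)\ne0$, and $C$ is not Koszul, i.e. the algebra $E(C)$ is not generated by $\mathrm{Ext}_C^{1,1}(k,k)$. 5. The algebra $E(C)$ is generated by $\mathrm{Ext}_C^{1,1}(k,k)$ and $\mathrm{Ext}_C^{m,m+1}(k,k)$. 6. If $m\ge4$, then $C$ is $\delta$-Koszul with $\delta(i)=i$ for $i<m$ and $\delta(i)=i+1$ for $i\ge m$. Here a graded algebra $A$ is $\delta$-Koszul, for a function $\delta:\mathbb N\to\mathbb N$, if $\mathrm{Ext}_A^{ij}(k,k)=0$ unless $j=\delta(i)$ and $E(A)$ is finitely generated as an algebra. Moreover, over every field $k$ there is no integer $N$ such that, for every quadratic $k$-algebra $A$ that is $\delta$-Koszul for some function $\delta$, the algebra $E(A)$ is generated in cohomological degrees $0,\dots,N$. This answers the question of Green and Marcos. -/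

import Mathlib

universe u

namespace QuadExt

/-! ### Bigraded Ext of a connected graded algebra, through the normalized bar construction -/

section Ext

variable {k A : Type*} [Field k] [Ring A] [Algebra k A]
variable (𝒜 : ℕ → Submodule k A) [GradedAlgebra 𝒜]

/-- The augmentation ideal `A₊ = ⨁_{i ≥ 1} A_i`, the kernel of the projection onto `A_0`. -/
def Aplus : Submodule k A := LinearMap.ker (GradedAlgebra.proj 𝒜 0)

theorem Aplus_mul_mem {a b : A} (ha : a ∈ Aplus 𝒜) : a * b ∈ Aplus 𝒜 := by
  have h : GradedRing.projZeroRingHom 𝒜 a = 0 := by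
    simpa [Aplus, GradedAlgebra.proj_apply, GradedRing.projZeroRingHom_apply] using ha
  have h2 : GradedRing.projZeroRingHom 𝒜 (a * b) = 0 := by rw [map_mul, h, zero_mul]
  simpa [Aplus, GradedAlgebra.proj_apply, GradedRing.projZeroRingHom_apply] using h2

/-- The multiplication of `A₊`. -/
def plusMul (a b : Aplus 𝒜) : Aplus 𝒜 := ⟨(a : A) * (b : A), Aplus_mul_mem 𝒜 a.2⟩

/-- All functions `A₊ⁿ → k`. The `n`-cochains are the multilinear ones among them. -/
abbrev BarFun (n : ℕ) : Type _ := (Fin n → Aplus 𝒜) → k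

/-- The differential of `Hom_A(Bar_•(A), k) = Hom_k(A₊^{⊗ •}, k)`:
`(d f)(a_0, …, a_n) = ∑_{j < n} (-1)^{j+1} f(a_0, …, a_j a_{j+1}, …, a_n)`.
The two outer terms of the bar differential vanish because `A₊` acts on `k` as zero. -/
def barD (n : ℕ) : BarFun 𝒜 n →ₗ[k] BarFun 𝒜 (n + 1) where
  toFun f x := ∑ j : Fin n, (-1 : k) ^ ((j : ℕ) + 1) *
    f (Fin.contractNth j.castSucc (plusMul 𝒜) x)
  map_add' f g := by
    funext x
    simp [mul_add, Finset.sum_add_distrib]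
  map_smul' c f := by
    funext x
    simp only [Pi.smul_apply, smul_eq_mul, RingHom.id_apply, Finset.mul_sum]
    exact Finset.sum_congr rfl fun j _ => by ring

/-- Cochains of cohomological degree `n` and internal degree `j`: multilinear functions
`A₊ⁿ → k` that vanish on `A_{d_1} × ⋯ × A_{d_n}` unless `d_1 + ⋯ + d_n = j`. -/
def cochains (n j : ℕ) : Submodule k (BarFun 𝒜 n) where
  carrier := {f | (∃ F : MultilinearMap k (fun _ : Fin n => Aplus 𝒜) k, ∀ x, F x = f x) ∧
    ∀ (d : Fin n → ℕ) (x : Fin n → Aplus 𝒜),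
      (∀ l, (x l : A) ∈ 𝒜 (d l)) → ∑ l, d l ≠ j → f x = 0}
  add_mem' := by
    rintro f g ⟨⟨F, hF⟩, hf⟩ ⟨⟨G, hG⟩, hg⟩
    exact ⟨⟨F + G, fun x => by simp [hF, hG]⟩, fun d x hx hd => by
      simp [hf d x hx hd, hg d x hx hd]⟩
  zero_mem' := ⟨⟨0, fun x => by simp⟩, fun _ _ _ _ => rfl⟩
  smul_mem' := by
    rintro c f ⟨⟨F, hF⟩, hf⟩
    exact ⟨⟨c • F, fun x => by simp [hF]⟩, fun d x hx hd => by simp [hf d x hx hd]⟩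

/-- Cocycles of bidegree `(n, j)`. -/
def cocycles (n j : ℕ) : Submodule k (BarFun 𝒜 n) :=
  cochains 𝒜 n j ⊓ LinearMap.ker (barD 𝒜 n)

/-- Coboundaries of bidegree `(n, j)`. -/
def coboundaries : ∀ n : ℕ, ℕ → Submodule k (BarFun 𝒜 n)
  | 0, _ => ⊥
  | n + 1, j => (cochains 𝒜 n j).map (barD 𝒜 n)

/-- `Ext_A^{n,j}(k, k)`. -/
abbrev Ext (n j : ℕ) : Type _ :=
  cocycles 𝒜 n j ⧸ (coboundaries 𝒜 n j).submoduleOf (cocycles 𝒜 n j)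

/-- The product of cochains that induces the product of the Yoneda algebra
`E(A) = ⨁ Ext_A^{n,j}(k, k)`. -/
def cup {a b : ℕ} (f : BarFun 𝒜 a) (g : BarFun 𝒜 b) : BarFun 𝒜 (a + b) :=
  fun x => f (fun l => x (Fin.castAdd b l)) * g (fun l => x (Fin.natAdd a l))

/-- `ExtAdjoin 𝒜 G n f` says that the cochain `f` of cohomological degree `n` is, up to
coboundaries, a linear combination of products of elements of `G`. For a set `G` of cocycles
and a cocycle `f` it means that the class of `f` lies in the subalgebra of `E(A)` generated by
the classes of `G`. -/
inductive ExtAdjoin (G : ∀ n : ℕ, Set (BarFun 𝒜 n)) : ∀ n : ℕ, BarFun 𝒜 n → Prop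
  | one : ExtAdjoin G 0 (fun _ => 1)
  | mul {a b : ℕ} {f : BarFun 𝒜 a} {g : BarFun 𝒜 b} :
      f ∈ G a → ExtAdjoin G b g → ExtAdjoin G (a + b) (cup 𝒜 f g)
  | add {n : ℕ} {f g : BarFun 𝒜 n} :
      ExtAdjoin G n f → ExtAdjoin G n g → ExtAdjoin G n (f + g)
  | smul {n : ℕ} (c : k) {f : BarFun 𝒜 n} : ExtAdjoin G n f → ExtAdjoin G n (c • f)
  | bdry {n j : ℕ} {h : BarFun 𝒜 n} : h ∈ cochains 𝒜 n j → ExtAdjoin G (n + 1) (barD 𝒜 n h)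

/-- The classes of `G` generate the algebra `E(A)`. -/
def GeneratesExt (G : ∀ n : ℕ, Set (BarFun 𝒜 n)) : Prop :=
  ∀ n j : ℕ, ∀ f ∈ cocycles 𝒜 n j, ExtAdjoin 𝒜 G n f

/-- All cocycles whose bidegree lies in `T`. -/
def classesIn (T : Set (ℕ × ℕ)) (n : ℕ) : Set (BarFun 𝒜 n) :=
  {f | ∃ j, (n, j) ∈ T ∧ f ∈ cocycles 𝒜 n j}

/-- `E(A)` is generated, as an algebra, by its components in the bidegrees `T`. -/
def ExtGeneratedIn (T : Set (ℕ × ℕ)) : Prop := GeneratesExt 𝒜 (classesIn 𝒜 T)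

/-- `A` is Koszul: `E(A)` is generated by `Ext_A^{1,1}(k, k)`. -/
def IsKoszul : Prop := ExtGeneratedIn 𝒜 {(1, 1)}

/-- `A` is `N`-Koszul in the sense of Backelin: `Ext_A^{ij}(k, k) = 0` for `i < j ≤ N`. -/
def IsBackelinKoszul (N : ℕ) : Prop :=
  ∀ i j : ℕ, i < j → j ≤ N → Subsingleton (Ext 𝒜 i j)

/-- `E(A)` is generated, as an algebra, by finitely many (bihomogeneous) classes. -/
def ExtFinitelyGenerated : Prop :=
  ∃ G : ∀ n : ℕ, Set (BarFun 𝒜 n),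
    {q : (n : ℕ) × BarFun 𝒜 n | q.2 ∈ G q.1}.Finite ∧
    (∀ n, ∀ f ∈ G n, ∃ j, f ∈ cocycles 𝒜 n j) ∧ GeneratesExt 𝒜 G

/-- `A` is `δ`-Koszul in the sense of Green and Marcos. -/
def IsDeltaKoszul (δ : ℕ → ℕ) : Prop :=
  (∀ i j : ℕ, j ≠ δ i → Subsingleton (Ext 𝒜 i j)) ∧ ExtFinitelyGenerated 𝒜

end Ext

/-! ### Minimal graded resolutions and global dimension -/

section Resolution

variable {k A : Type*} [Field k] [Ring A] [Algebra k A]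

/-- Let `ε : A → k` be the augmentation. The matrices `lam i`, with rows indexed by `I (i + 1)` and
columns by `I i`, define through right multiplication of row vectors a sequence
`⋯ → P^2 → P^1 → P^0 → k → 0` of left modules, where `P^i = A^{I i}` is graded free on basis
vectors of the degrees `deg i`, `P^0 = A` is free on `e₀` of degree `0` and `P^0 → k` is `ε`.
The predicate says that this is a minimal graded free resolution of the trivial left
module `k`: the maps preserve degrees, have their images in `A₊ P`, and the sequence is exact. -/
structure IsMinimalGradedResolution (𝒜 : ℕ → Submodule k A) [GradedAlgebra 𝒜] (ε : A →ₐ[k] k)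
    (I : ℕ → Type) [∀ i, Fintype (I i)] (deg : ∀ i, I i → ℕ) (e₀ : I 0)
    (lam : ∀ i, Matrix (I (i + 1)) (I i) A) : Prop where
  unique : ∀ e : I 0, e = e₀
  deg_zero : deg 0 e₀ = 0
  homogeneous : ∀ i ρ σ, lam i ρ σ = 0 ∨
    ∃ d, deg (i + 1) ρ = deg i σ + d ∧ lam i ρ σ ∈ 𝒜 d
  minimal : ∀ i ρ σ, lam i ρ σ ∈ Aplus 𝒜
  exact_zero : Function.Exact (Matrix.vecMulLinear (lam 0)) (fun v : I 0 → A => ε (v e₀))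
  exact_succ : ∀ i,
    Function.Exact (Matrix.vecMulLinear (lam (i + 1))) (Matrix.vecMulLinear (lam i))

end Resolution

/-- The left global dimension: the supremum of the projective dimensions of all left modules. -/
noncomputable def leftGlobalDimension (R : Type u) [Ring R] : WithBot ℕ∞ :=
  sSup (Set.range fun M : ModuleCat.{u} R => CategoryTheory.projectiveDimension M)

/-! ### Quadratic algebras -/

section Quadratic

variable {k ι : Type*} [Field k]

/-- The words of length `n` span this subspace of the free algebra. -/
def freeGrade (k ι : Type*) [Field k] (n : ℕ) : Submodule k (FreeAlgebra k ι) :=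
  Submodule.span k (Set.range (FreeAlgebra.ι k (X := ι))) ^ n

/-- A set of relations `a = b` between homogeneous elements of degree two. -/
def QuadraticRel (r : FreeAlgebra k ι → FreeAlgebra k ι → Prop) : Prop :=
  ∀ a b, r a b → a ∈ freeGrade k ι 2 ∧ b ∈ freeGrade k ι 2

/-- The grading by word length on the algebra with generators `ι` and relations `r`. -/
noncomputable def quotGrade (r : FreeAlgebra k ι → FreeAlgebra k ι → Prop) (n : ℕ) :
    Submodule k (RingQuot r) :=
  Submodule.span k (Set.range fun g : ι => RingQuot.mkAlgHom k r (FreeAlgebra.ι k g)) ^ n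

instance (r : FreeAlgebra k ι → FreeAlgebra k ι → Prop) :
    SetLike.GradedMonoid (quotGrade r) :=
  Submodule.nat_power_gradedMonoid _

open scoped DirectSum in
/-- The map that exhibits the grading of the free algebra on the quotient. -/
noncomputable def quotDecomposeFree (r : FreeAlgebra k ι → FreeAlgebra k ι → Prop) :
    FreeAlgebra k ι →ₐ[k] ⨁ i, quotGrade r i :=
  FreeAlgebra.lift k fun g => DirectSum.of (fun i => quotGrade r i) 1
    ⟨RingQuot.mkAlgHom k r (FreeAlgebra.ι k g), by
      simpa [quotGrade] using Submodule.subset_span (Set.mem_range_self g)⟩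

theorem mk_mem_quotGrade (r : FreeAlgebra k ι → FreeAlgebra k ι → Prop) {n : ℕ}
    {a : FreeAlgebra k ι} (ha : a ∈ freeGrade k ι n) :
    RingQuot.mkAlgHom k r a ∈ quotGrade r n := by
  have h : (freeGrade k ι n).map (RingQuot.mkAlgHom k r).toLinearMap = quotGrade r n := by
    rw [freeGrade, quotGrade, Submodule.map_pow, Submodule.map_span, ← Set.range_comp]
    rfl
  rw [← h]
  exact ⟨a, ha, rfl⟩

theorem quotDecomposeFree_of_mem (r : FreeAlgebra k ι → FreeAlgebra k ι → Prop) {n : ℕ}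
    {a : FreeAlgebra k ι} (ha : a ∈ freeGrade k ι n) :
    quotDecomposeFree r a = DirectSum.of (fun i => quotGrade r i) n
      ⟨RingQuot.mkAlgHom k r a, mk_mem_quotGrade r ha⟩ := by
  unfold freeGrade at ha
  induction ha using Submodule.pow_induction_on_left' with
  | algebraMap c =>
    rw [AlgHom.commutes, DirectSum.algebraMap_apply]
    congr 1
    exact Subtype.ext (AlgHom.commutes (RingQuot.mkAlgHom k r) c).symm
  | add x y i hx hy ihx ihy =>
    rw [map_add, ihx, ihy, ← map_add]
    congr 1
    exact Subtype.ext (map_add _ _ _).symm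
  | mem_mul m hm i x hx ih =>
    have h1 : quotDecomposeFree r m = DirectSum.of (fun i => quotGrade r i) 1
        ⟨RingQuot.mkAlgHom k r m, mk_mem_quotGrade r (by simpa [freeGrade] using hm)⟩ := by
      clear ih
      induction hm using Submodule.span_induction with
      | mem y hy =>
        obtain ⟨g, rfl⟩ := hy
        simp [quotDecomposeFree]
      | zero =>
        rw [map_zero, eq_comm]
        convert map_zero (DirectSum.of (fun i => quotGrade r i) 1)
        exact map_zero _
      | add y z hy hz ihy ihz =>
        rw [map_add, ihy, ihz, ← map_add]
        congr 1
        exact Subtype.ext (map_add _ _ _).symm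
      | smul c y hy ihy =>
        rw [map_smul, ihy]
        refine ((DirectSum.lof k ℕ (fun i => quotGrade r i) 1).map_smul c _).symm.trans ?_
        exact congrArg (DirectSum.of (fun i => quotGrade r i) 1)
          (Subtype.ext (map_smul (RingQuot.mkAlgHom k r) c y).symm)
    rw [map_mul, ih, h1, DirectSum.of_mul_of]
    exact DirectSum.of_eq_of_gradedMonoid_eq
      (Sigma.subtype_ext (add_comm _ _) (map_mul _ _ _).symm)

/-- An algebra given by generators and quadratic relations is graded by word length. -/
@[reducible] noncomputable def quotGradedAlgebra {r : FreeAlgebra k ι → FreeAlgebra k ι → Prop}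
    (hr : QuadraticRel r) : GradedAlgebra (quotGrade r) :=
  GradedAlgebra.ofAlgHom _
    (RingQuot.liftAlgHom k ⟨quotDecomposeFree r, fun a b h => by
      rw [quotDecomposeFree_of_mem r (hr a b h).1, quotDecomposeFree_of_mem r (hr a b h).2]
      congr 1
      exact Subtype.ext (RingQuot.mkAlgHom_rel k h)⟩)
    (by
      apply RingQuot.ringQuot_ext'
      apply FreeAlgebra.hom_ext
      funext g
      simp [quotDecomposeFree])
    (fun i x => by
      obtain ⟨x, hx⟩ := x
      have h : (freeGrade k ι i).map (RingQuot.mkAlgHom k r).toLinearMap = quotGrade r i := by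
        rw [freeGrade, quotGrade, Submodule.map_pow, Submodule.map_span, ← Set.range_comp]
        rfl
      rw [← h] at hx
      obtain ⟨a, ha, rfl⟩ := hx
      simp [quotDecomposeFree_of_mem r ha])

/-- A graded algebra is quadratic if it is isomorphic, as a graded algebra, to the algebra given
by finitely many generators of degree one and by relations of degree two. -/
def IsQuadratic {A : Type*} [Ring A] [Algebra k A] (𝒜 : ℕ → Submodule k A) : Prop :=
  ∃ (N : ℕ) (r : FreeAlgebra k (Fin N) → FreeAlgebra k (Fin N) → Prop) (φ : RingQuot r ≃ₐ[k] A),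
    QuadraticRel r ∧ ∀ i, 𝒜 i = (quotGrade r i).map φ.toLinearMap

end Quadratic

/-! ### The algebra `C` -/

/-- The generators: `n`; `p, q, r`; `s, t, u`; `v, w`; `x_i` for `1 ≤ i ≤ m - 2`; `y_i` for
`1 ≤ i ≤ m - 3`; `z_i` for `1 ≤ i ≤ m - 4`. The layers are `S_1 = {n}`, `S_2 = {p, q, r}`,
`S_3 = {s, t, u}`, `S_4 = {v, w, x_1, y_1, z_1}` and `S_{i+3} = {x_i, y_i, z_i}` for `i ≥ 2`
(only the letters in the given ranges). -/
inductive Gen (m : ℕ) : Type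
  | n | p | q | r | s | t | u | v | w
  | x (i : ℕ) (h : 1 ≤ i ∧ i + 2 ≤ m)
  | y (i : ℕ) (h : 1 ≤ i ∧ i + 3 ≤ m)
  | z (i : ℕ) (h : 1 ≤ i ∧ i + 4 ≤ m)

section Algebra

variable (k : Type*) [Field k] (m : ℕ)

/-- A generator as an element of the free algebra. -/
abbrev fr (g : Gen m) : FreeAlgebra k (Gen m) := FreeAlgebra.ι k g

/-- The defining relations of `C`. -/
inductive Rel : FreeAlgebra k (Gen m) → FreeAlgebra k (Gen m) → Prop
  | np_nq : Rel (fr k m .n * fr k m .p) (fr k m .n * fr k m .q)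
  | np_nr : Rel (fr k m .n * fr k m .p) (fr k m .n * fr k m .r)
  | ps_pt : Rel (fr k m .p * fr k m .s) (fr k m .p * fr k m .t)
  | qt_qu : Rel (fr k m .q * fr k m .t) (fr k m .q * fr k m .u)
  | rs_ru : Rel (fr k m .r * fr k m .s) (fr k m .r * fr k m .u)
  | sv_sw : Rel (fr k m .s * fr k m .v) (fr k m .s * fr k m .w)
  | tw_tx (h : 1 ≤ 1 ∧ 1 + 2 ≤ m) : Rel (fr k m .t * fr k m .w) (fr k m .t * fr k m (.x 1 h))
  | uv_ux (h : 1 ≤ 1 ∧ 1 + 2 ≤ m) : Rel (fr k m .u * fr k m .v) (fr k m .u * fr k m (.x 1 h))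
  | sv_sy (h : 1 ≤ 1 ∧ 1 + 3 ≤ m) : Rel (fr k m .s * fr k m .v) (fr k m .s * fr k m (.y 1 h))
  | tw_ty (h : 1 ≤ 1 ∧ 1 + 3 ≤ m) : Rel (fr k m .t * fr k m .w) (fr k m .t * fr k m (.y 1 h))
  | ux_uy (h : 1 ≤ 1 ∧ 1 + 2 ≤ m) (h' : 1 ≤ 1 ∧ 1 + 3 ≤ m) :
      Rel (fr k m .u * fr k m (.x 1 h)) (fr k m .u * fr k m (.y 1 h'))
  | sz (h : 1 ≤ 1 ∧ 1 + 4 ≤ m) : Rel (fr k m .s * fr k m (.z 1 h)) 0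
  | tz (h : 1 ≤ 1 ∧ 1 + 4 ≤ m) : Rel (fr k m .t * fr k m (.z 1 h)) 0
  | uz (h : 1 ≤ 1 ∧ 1 + 4 ≤ m) : Rel (fr k m .u * fr k m (.z 1 h)) 0
  | vx (h : 1 ≤ 2 ∧ 2 + 2 ≤ m) : Rel (fr k m .v * fr k m (.x 2 h)) 0
  | wx (h : 1 ≤ 2 ∧ 2 + 2 ≤ m) : Rel (fr k m .w * fr k m (.x 2 h)) 0
  | xx (i : ℕ) (h : 1 ≤ i ∧ i + 2 ≤ m) (h' : 1 ≤ i + 1 ∧ i + 1 + 2 ≤ m) :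
      Rel (fr k m (.x i h) * fr k m (.x (i + 1) h')) 0
  | yx_zy (i : ℕ) (h₁ : 1 ≤ i ∧ i + 3 ≤ m) (h₂ : 1 ≤ i + 1 ∧ i + 1 + 2 ≤ m)
      (h₃ : 1 ≤ i ∧ i + 4 ≤ m) (h₄ : 1 ≤ i + 1 ∧ i + 1 + 3 ≤ m) :
      Rel (fr k m (.y i h₁) * fr k m (.x (i + 1) h₂) +
        fr k m (.z i h₃) * fr k m (.y (i + 1) h₄)) 0
  | zz (i : ℕ) (h : 1 ≤ i ∧ i + 4 ≤ m) (h' : 1 ≤ i + 1 ∧ i + 1 + 4 ≤ m) :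
      Rel (fr k m (.z i h) * fr k m (.z (i + 1) h')) 0

/-- The algebra `C`. -/
abbrev C : Type _ := RingQuot (Rel k m)

theorem fr_mul_fr_mem (a b : Gen m) : fr k m a * fr k m b ∈ freeGrade k (Gen m) 2 := by
  rw [freeGrade, pow_two]
  exact Submodule.mul_mem_mul (Submodule.subset_span ⟨a, rfl⟩) (Submodule.subset_span ⟨b, rfl⟩)

theorem quadraticRel_Rel : QuadraticRel (Rel k m) := by
  intro a b h
  have h0 : (0 : FreeAlgebra k (Gen m)) ∈ freeGrade k (Gen m) 2 := Submodule.zero_mem _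
  cases h
  all_goals first
    | exact ⟨fr_mul_fr_mem k m _ _, fr_mul_fr_mem k m _ _⟩
    | exact ⟨fr_mul_fr_mem k m _ _, h0⟩
    | exact ⟨Submodule.add_mem _ (fr_mul_fr_mem k m _ _) (fr_mul_fr_mem k m _ _), h0⟩

/-- The component `C_i`. -/
noncomputable abbrev gradeC : ℕ → Submodule k (C k m) := quotGrade (Rel k m)

noncomputable instance : GradedAlgebra (gradeC k m) := quotGradedAlgebra (quadraticRel_Rel k m)

/-- The augmentation `C → k`, which sends every generator to zero. -/
noncomputable def augC : C k m →ₐ[k] k :=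
  RingQuot.liftAlgHom k ⟨FreeAlgebra.lift k fun _ : Gen m => (0 : k), fun a b h => by
    cases h <;> simp⟩

/-- A generator as an element of `C`. -/
noncomputable def gen (g : Gen m) : C k m := RingQuot.mkAlgHom k (Rel k m) (FreeAlgebra.ι k g)

/-- `x_i` as an element of `C` (zero if there is no such generator). -/
noncomputable def genX (i : ℕ) : C k m :=
  if h : 1 ≤ i ∧ i + 2 ≤ m then gen k m (.x i h) else 0

/-- `y_i` as an element of `C` (zero if there is no such generator). -/
noncomputable def genY (i : ℕ) : C k m :=
  if h : 1 ≤ i ∧ i + 3 ≤ m then gen k m (.y i h) else 0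

/-- `z_i` as an element of `C` (zero if there is no such generator). -/
noncomputable def genZ (i : ℕ) : C k m :=
  if h : 1 ≤ i ∧ i + 4 ≤ m then gen k m (.z i h) else 0

end Algebra

/-! ### The complex `P` -/

/-- Labels for the basis vectors of the modules `P^j`, that is, for the rows of `λ_j` and the columns
of `λ_{j+1}`: `unit` is the basis vector of `P^0 = C`; the rows of `λ_1` are labelled by the
generators (`N 0` is `n`, `P` is `p, q, r`, `S` is `s, t, u`); for `j ≥ 2` the rows of `λ_j` are those
of its blocks: `N` for `η'` (two rows) or `η` (one row), `P` for `δ`, `S` for `ε`, `z` for `ζ`,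
`a` for `α` or `α'`, `b` for `β` (six rows) or `β'` (three rows), `v, w, x, y` for
`γ`, `γ'`, the `χ_i` and the last block `x_{m-j}`; and `top` for the row of degree `m + 1`
of `λ_m`. The index `i : Fin m` in `x i`, `y i`, `z i` is the subscript, `1 ≤ i`. -/
inductive Lab (m : ℕ) : Type
  | unit
  | N (a : Fin 2)
  | P (a : Fin 3)
  | S (a : Fin 3)
  | v
  | w
  | x (i : Fin m)
  | y (i : Fin m)
  | z (i : Fin m)
  | a (c : Fin 3)
  | b (c : Fin 6)
  | top
  deriving DecidableEq, Fintype

/-- The labels that occur in cohomological degree `j`. -/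
def Lab.Mem (m j : ℕ) : Lab m → Prop
  | .unit => j = 0
  | .N c => if c = 0 then 1 ≤ j ∧ (j + 1 ≤ m ∨ j ≤ 3) else j = 2
  | .P _ => 1 ≤ j ∧ (j + 2 ≤ m ∨ j ≤ 2)
  | .S _ => 1 ≤ j ∧ (j + 3 ≤ m ∨ j = 1)
  | .v => 1 ≤ j ∧ j + 2 ≤ m
  | .w => 1 ≤ j ∧ j + 2 ≤ m
  | .x i => 1 ≤ j ∧ 1 ≤ (i : ℕ) ∧ i + j + 1 ≤ m
  | .y i => 1 ≤ j ∧ 1 ≤ (i : ℕ) ∧ i + j + 2 ≤ m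
  | .z i => 1 ≤ j ∧ 1 ≤ (i : ℕ) ∧ i + j + 3 ≤ m
  | .a _ => 3 ≤ j ∧ j + 1 ≤ m
  | .b c => 2 ≤ j ∧ (if (c : ℕ) < 3 then j + 1 ≤ m else j + 2 ≤ m)
  | .top => j = m

/-- The index set of the basis of `P^j`. -/
abbrev Idx (m j : ℕ) : Type := {l : Lab m // l.Mem m j}

noncomputable instance (m j : ℕ) : Fintype (Idx m j) := Fintype.ofFinite _

/-- The degree of a basis vector of `P^j`. -/
def Lab.deg (m j : ℕ) : Lab m → ℕ
  | .top => m + 1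
  | _ => j

section Complex

variable (k : Type*) [Field k] (m : ℕ)

/-- The column `λ_1`. -/
noncomputable def lamOne : Lab m → C k m
  | .N _ => gen k m .n
  | .P c => ![gen k m .p, gen k m .q, gen k m .r] c
  | .S c => ![gen k m .s, gen k m .t, gen k m .u] c
  | .v => gen k m .v
  | .w => gen k m .w
  | .x i => genX k m i
  | .y i => genY k m i
  | .z i => genZ k m i
  | _ => 0

/-- The block `η'`, on the columns `n, p, q, r`; its first column is zero. -/
noncomputable def etaTwo : Matrix (Fin 2) (Fin 3) (C k m) :=
  let n := gen k m .n
  !![n, -n, 0; n, 0, -n]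

/-- The block `η`, without its zero column. -/
noncomputable def eta : Fin 3 → C k m :=
  let n := gen k m .n
  ![n, n, -n]

/-- The block `δ`. -/
noncomputable def delta : Matrix (Fin 3) (Fin 3) (C k m) :=
  let p := gen k m .p
  let q := gen k m .q
  let r := gen k m .r
  !![-p, p, 0; 0, -q, q; -r, 0, r]

/-- The block `ε`. -/
noncomputable def epsilon : Fin 3 → C k m := ![gen k m .s, gen k m .t, gen k m .u]

/-- The block `α'`; the block `α` has three more columns, which are zero. -/
noncomputable def alpha : Matrix (Fin 3) (Fin 6) (C k m) :=
  let p := gen k m .p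
  let q := gen k m .q
  let r := gen k m .r
  !![p, 0, 0, -p, p, 0; 0, q, 0, 0, -q, q; 0, 0, r, -r, 0, r]

/-- The block `β`, on the columns `v, w, x_1, y_1`; its upper left `3 × 3` corner is `β'`. -/
noncomputable def beta : Matrix (Fin 6) (Fin 4) (C k m) :=
  let s := gen k m .s
  let t := gen k m .t
  let u := gen k m .u
  !![s, -s, 0, 0; 0, t, -t, 0; u, 0, -u, 0; s, 0, 0, -s; 0, t, 0, -t; 0, 0, u, -u]

/-- The nonzero entries of `λ_m` in the row of degree `m + 1`, on the columns of `β'`. -/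
noncomputable def topRow : Fin 6 → C k m :=
  let np := gen k m .n * gen k m .p
  ![np, np, -np, 0, 0, 0]

/-- The entries of `λ_j`, `j ≥ 2`. -/
noncomputable def lamEntry (j : ℕ) : Lab m → Lab m → C k m
  | .N c, .P d => if j = 2 then etaTwo k m c d else eta k m d
  | .P c, .S d => delta k m c d
  | .S c, .z i => if (i : ℕ) = 1 then epsilon k m c else 0
  | .z i, .z i' => if (i' : ℕ) = i + 1 then genZ k m i else 0
  | .a c, .b d => alpha k m c d
  | .b c, .v => beta k m c 0
  | .b c, .w => beta k m c 1
  | .b c, .x i => if (i : ℕ) = 1 then beta k m c 2 else 0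
  | .b c, .y i => if (i : ℕ) = 1 then beta k m c 3 else 0
  | .v, .x i => if (i : ℕ) = 2 then gen k m .v else 0
  | .w, .x i => if (i : ℕ) = 2 then gen k m .w else 0
  | .x i, .x i' => if (i' : ℕ) = i + 1 then genX k m i else 0
  | .y i, .x i' => if (i' : ℕ) = i + 1 then genY k m i else 0
  | .y i, .y i' => if (i' : ℕ) = i + 1 then genZ k m i else 0
  | .top, .b d => topRow k m d
  | _, _ => 0

/-- The matrix `λ_{i+1}`, which gives the map `P^{i+1} → P^i` by right multiplication. -/
noncomputable def lam : ∀ i : ℕ, Matrix (Idx m (i + 1)) (Idx m i) (C k m)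
  | 0 => fun ρ _ => lamOne k m ρ.1
  | i + 1 => fun ρ σ => lamEntry k m (i + 2) ρ.1 σ.1

end Complex

/-- The basis vector of `P^0 = C`. -/
def idxUnit (m : ℕ) : Idx m 0 := ⟨.unit, rfl⟩

end QuadExt

/-! Almost everything follows from the exactness of `P` and its minimality; only the upper bound on
the global dimension needs a further argument about arbitrary modules.

Exactness. The rows of `λ_2` are the defining relations, so they span the left relations between the
generators of `C₊`: `mem_range_lam_one` proves this by letting `C` act on `k × N`, where `N` is the
free module modulo those rows. Hence every equation `a g + b h + ⋯ = 0` between generators can be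
solved by reading off columns of `λ_2`, which gives small syzygy lemmas such as `eq_zero_of_mul_n`,
`exists_of_pqr` and `exists_of_stu`. The matrices `λ_j` are made of blocks, and `exists_colSum_eq`
finds the kernel block by block.

The entry of degree two arises as follows. The kernel of the six-row block `β` is spanned by the
linear rows of `α`, and the product `η α` is `(np, np, -np, 0, 0, 0)`, because `np = nq = nr`
cancels the last three columns. The letters `y_i` run out as `j` grows: `y_1` is missing from
`P^{m-2}`, so `P^{m-1}` keeps only the first three rows `β'`. A row on these three that is killed by
`β'` is a multiple of `η α` (`exists_topRow_of_beta`). The linear syzygies are gone and one syzygy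
with quadratic entries is left. All coefficients are `±1`, so the field plays no role.

Ext. For any minimal graded resolution, `exists_classMap` identifies `Ext^{n,j}` with the functions
on the basis vectors of `P^n` of degree `j`. It uses dimension shifting in the normalized bar
complex: bar cochains on a free module have a contracting homotopy, so a cocycle of degree `n + 1`
on a syzygy is traded for one of degree `n` on the next syzygy. For `C` the only off-diagonal class,
up to scalars, has bidegree `(m, m + 1)`.

Generation. A cochain of bidegree `(n, n)` is a sum of products of linear forms on `A_1`
(`extAdjoin_diagonal`), and products of diagonal classes are diagonal (`ExtAdjoin.exists_diagonal`).
Hence the diagonal together with the class of bidegree `(m, m + 1)` generates, and that class cannot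
be omitted. Since `m` is arbitrary, no bound on the degrees of generators exists.

Global dimension. The trivial module has projective dimension `m` by minimality. For an arbitrary,
possibly ungraded module `M`, the kernel of `A ⊗ M → M` is filtered according to the layers of the
generators. The successive quotients are direct summands of `A₊ ⊗ M`, which is resolved by `P ⊗ M`;
`LayeredPresentation.pdLT_succ` draws the conclusion. -/

set_option linter.unusedSectionVars false

namespace QuadExt

/-! ### Bar cochains with values in the dual of a module -/

section BarCochains

variable {k A : Type*} [Field k] [Ring A] [Algebra k A]
variable (𝒜 : ℕ → Submodule k A) [GradedAlgebra 𝒜]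

/-- Bar cochains of degree `n` on a left module `X`: multilinear maps `A₊ⁿ × X → k`. -/
def ModCochain (X : Type*) [AddCommGroup X] [Module k X] (n : ℕ) : Type _ :=
  MultilinearMap k (fun _ : Fin n => Aplus 𝒜) (X →ₗ[k] k)

section Instances

variable (X : Type*) [AddCommGroup X] [Module k X] (n : ℕ)

noncomputable instance : AddCommGroup (ModCochain 𝒜 X n) :=
  inferInstanceAs (AddCommGroup (MultilinearMap k (fun _ : Fin n => Aplus 𝒜) (X →ₗ[k] k)))

noncomputable instance : Module k (ModCochain 𝒜 X n) :=
  inferInstanceAs (Module k (MultilinearMap k (fun _ : Fin n => Aplus 𝒜) (X →ₗ[k] k)))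

instance : FunLike (ModCochain 𝒜 X n) (Fin n → Aplus 𝒜) (X →ₗ[k] k) :=
  inferInstanceAs (FunLike (MultilinearMap k (fun _ : Fin n => Aplus 𝒜) (X →ₗ[k] k)) _ _)

end Instances

/-- The multiplication of `A₊` from the left by a fixed element. -/
def plusMulLeft (a : Aplus 𝒜) : Aplus 𝒜 →ₗ[k] Aplus 𝒜 where
  toFun b := plusMul 𝒜 a b
  map_add' _ _ := Subtype.ext (mul_add _ _ _)
  map_smul' _ _ := Subtype.ext (mul_smul_comm _ _ _)

theorem coe_plusMul (a b : Aplus 𝒜) : (plusMul 𝒜 a b : A) = a * b := rfl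

variable {X Y : Type*} [AddCommGroup X] [Module k X] [Module A X] [IsScalarTower k A X]
  [AddCommGroup Y] [Module k Y] [Module A Y] [IsScalarTower k A Y]

namespace ModCochain

section Basic

omit [Module A X] [IsScalarTower k A X] [Module A Y] [IsScalarTower k A Y]

@[ext] theorem ext {n : ℕ} {f g : ModCochain 𝒜 X n} (h : ∀ x y, f x y = g x y) : f = g :=
  MultilinearMap.ext fun x => LinearMap.ext fun y => h x y

@[simp] theorem add_apply {n : ℕ} (f g : ModCochain 𝒜 X n) (x : Fin n → Aplus 𝒜) (y : X) :
    (f + g) x y = f x y + g x y := rfl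

@[simp] theorem sub_apply {n : ℕ} (f g : ModCochain 𝒜 X n) (x : Fin n → Aplus 𝒜) (y : X) :
    (f - g) x y = f x y - g x y := rfl

@[simp] theorem neg_apply {n : ℕ} (f : ModCochain 𝒜 X n) (x : Fin n → Aplus 𝒜) (y : X) :
    (- f) x y = - f x y := rfl

@[simp] theorem smul_apply {n : ℕ} (c : k) (f : ModCochain 𝒜 X n) (x : Fin n → Aplus 𝒜) (y : X) :
    (c • f) x y = c * f x y := rfl

@[simp] theorem zero_apply {n : ℕ} (x : Fin n → Aplus 𝒜) (y : X) :
    (0 : ModCochain 𝒜 X n) x y = 0 := rfl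

/-- Fixing the first argument. -/
noncomputable def app {n : ℕ} :
    ModCochain 𝒜 X (n + 1) ≃ₗ[k] (Aplus 𝒜 →ₗ[k] ModCochain 𝒜 X n) :=
  multilinearCurryLeftEquiv k (fun _ : Fin (n + 1) => Aplus 𝒜) (X →ₗ[k] k)

theorem app_apply {n : ℕ} (f : ModCochain 𝒜 X (n + 1)) (a : Aplus 𝒜) (x : Fin n → Aplus 𝒜) :
    app 𝒜 f a x = f (Fin.cons a x) := rfl

theorem ext_app {n : ℕ} {f g : ModCochain 𝒜 X (n + 1)} (h : ∀ a, app 𝒜 f a = app 𝒜 g a) :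
    f = g :=
  (app 𝒜).injective (LinearMap.ext h)

/-- Precomposition of the last argument with a linear map. -/
noncomputable def pre {n : ℕ} (φ : X →ₗ[k] Y) : ModCochain 𝒜 Y n →ₗ[k] ModCochain 𝒜 X n where
  toFun f := (LinearMap.lcomp k k φ).compMultilinearMap f
  map_add' _ _ := rfl
  map_smul' _ _ := rfl

@[simp] theorem pre_apply {n : ℕ} (φ : X →ₗ[k] Y) (f : ModCochain 𝒜 Y n)
    (x : Fin n → Aplus 𝒜) (y : X) : pre 𝒜 φ f x y = f x (φ y) := rfl

theorem app_pre {n : ℕ} (φ : X →ₗ[k] Y) (f : ModCochain 𝒜 Y (n + 1)) (a : Aplus 𝒜) :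
    app 𝒜 (pre 𝒜 φ f) a = pre 𝒜 φ (app 𝒜 f a) := rfl

/-- Multiplication of the first argument from the left by a fixed element. -/
noncomputable def mulFirst {n : ℕ} (a : Aplus 𝒜) : ModCochain 𝒜 X (n + 1) →ₗ[k] ModCochain 𝒜 X (n + 1) where
  toFun f := (app 𝒜).symm (app 𝒜 f ∘ₗ plusMulLeft 𝒜 a)
  map_add' _ _ := by simp [LinearMap.add_comp]
  map_smul' _ _ := by simp [LinearMap.smul_comp]

@[simp] theorem app_mulFirst {n : ℕ} (a b : Aplus 𝒜) (f : ModCochain 𝒜 X (n + 1)) :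
    app 𝒜 (mulFirst 𝒜 a f) b = app 𝒜 f (plusMul 𝒜 a b) := rfl

theorem app_symm_apply {n : ℕ} (f : Aplus 𝒜 →ₗ[k] ModCochain 𝒜 X n) (a : Aplus 𝒜) :
    app 𝒜 ((app 𝒜).symm f) a = f a := by simp

end Basic

/-- The bar differential. -/
noncomputable def D : ∀ {n : ℕ}, ModCochain 𝒜 X n →ₗ[k] ModCochain 𝒜 X (n + 1)
  | 0 =>
    { toFun := fun f => (app 𝒜).symm
        { toFun := fun a => - pre 𝒜 (Algebra.lsmul k k X (a : A)) f
          map_add' := fun a b => by ext; simp; abel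
          map_smul' := fun c a => by ext; simp }
      map_add' := fun f g => ext_app 𝒜 fun a => by
        simp only [map_add, LinearMap.add_apply, app_symm_apply, LinearMap.coe_mk, AddHom.coe_mk]
        abel
      map_smul' := fun c f => ext_app 𝒜 fun a => by
        simp only [map_smul, LinearMap.smul_apply, app_symm_apply, LinearMap.coe_mk, AddHom.coe_mk,
          RingHom.id_apply, smul_neg] }
  | n + 1 =>
    { toFun := fun f => (app 𝒜).symm
        { toFun := fun a => - mulFirst 𝒜 a f - D (app 𝒜 f a)
          map_add' := fun a b => by
            have h : mulFirst 𝒜 (a + b) f = mulFirst 𝒜 a f + mulFirst 𝒜 b f :=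
              ext_app 𝒜 fun c => by
                have : plusMul 𝒜 (a + b) c = plusMul 𝒜 a c + plusMul 𝒜 b c :=
                  Subtype.ext (add_mul _ _ _)
                simp [this]
            rw [h, map_add, map_add]; abel
          map_smul' := fun t a => by
            have h : mulFirst 𝒜 (t • a) f = t • mulFirst 𝒜 a f :=
              ext_app 𝒜 fun c => by
                have : plusMul 𝒜 (t • a) c = t • plusMul 𝒜 a c :=
                  Subtype.ext (smul_mul_assoc _ _ _)
                simp [this]
            rw [h, map_smul, map_smul, RingHom.id_apply, smul_sub, smul_neg] }
      map_add' := fun f g => ext_app 𝒜 fun a => by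
        simp only [map_add, LinearMap.add_apply, app_symm_apply, LinearMap.coe_mk, AddHom.coe_mk]
        abel
      map_smul' := fun c f => ext_app 𝒜 fun a => by
        simp only [map_smul, LinearMap.smul_apply, app_symm_apply, LinearMap.coe_mk, AddHom.coe_mk,
          RingHom.id_apply, smul_neg, smul_sub] }

theorem app_D_zero (f : ModCochain 𝒜 X 0) (a : Aplus 𝒜) :
    app 𝒜 (D 𝒜 f) a = - pre 𝒜 (Algebra.lsmul k k X (a : A)) f := rfl

theorem app_D_succ {n : ℕ} (f : ModCochain 𝒜 X (n + 1)) (a : Aplus 𝒜) :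
    app 𝒜 (D 𝒜 f) a = - mulFirst 𝒜 a f - D 𝒜 (app 𝒜 f a) := rfl

/-- Induction on the degree after fixing the first argument. By associativity, multiplying the first
argument by `ab` is multiplying by `b` after `a`, so the terms that do not vanish by induction
cancel in pairs. -/
theorem D_D : ∀ {n : ℕ} (f : ModCochain 𝒜 X n), D 𝒜 (D 𝒜 f) = 0
  | 0, f => by
    refine ext_app 𝒜 fun a => ext_app 𝒜 fun b => ?_
    rw [app_D_succ, app_D_zero]
    simp only [map_sub, map_neg, LinearMap.sub_apply, LinearMap.neg_apply, app_mulFirst,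
      app_D_zero, map_zero, LinearMap.zero_apply]
    ext x y
    simp [coe_plusMul]
  | n + 1, f => by
    refine ext_app 𝒜 fun a => ext_app 𝒜 fun b => ?_
    have h : D 𝒜 (- mulFirst 𝒜 a f - D 𝒜 (app 𝒜 f a)) = - D 𝒜 (mulFirst 𝒜 a f) := by
      rw [map_sub, map_neg, D_D, sub_zero]
    rw [app_D_succ, app_D_succ, h]
    simp only [map_sub, map_neg, LinearMap.sub_apply, LinearMap.neg_apply, app_mulFirst,
      app_D_succ, map_zero, LinearMap.zero_apply]
    have : mulFirst 𝒜 (plusMul 𝒜 a b) f = mulFirst 𝒜 b (mulFirst 𝒜 a f) :=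
      ext_app 𝒜 fun c => by
        simp only [app_mulFirst]
        congr 1
        exact Subtype.ext (mul_assoc _ _ _)
    rw [this]
    abel

/-- Linearity over `A`, and not only over `k`, enters in degree zero alone: there the last bar
argument acts on the module. -/
theorem D_pre : ∀ {n : ℕ} (φ : X →ₗ[A] Y) (f : ModCochain 𝒜 Y n),
    D 𝒜 (pre 𝒜 (φ.restrictScalars k) f) = pre 𝒜 (φ.restrictScalars k) (D 𝒜 f)
  | 0, φ, f => by
    refine ext_app 𝒜 fun a => ?_
    rw [app_pre, app_D_zero, app_D_zero]
    ext x y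
    simp
  | n + 1, φ, f => by
    refine ext_app 𝒜 fun a => ?_
    rw [app_pre, app_D_succ, app_D_succ, app_pre, D_pre, map_sub, map_neg]
    congr 2

end ModCochain

end BarCochains

/-! ### Projection of `A` onto the augmentation ideal -/

section Augmented

variable {k A : Type*} [Field k] [Ring A] [Algebra k A]
variable (𝒜 : ℕ → Submodule k A) [GradedAlgebra 𝒜]

theorem mem_Aplus {a : A} : a ∈ Aplus 𝒜 ↔ GradedRing.proj 𝒜 0 a = 0 := Iff.rfl

theorem mem_Aplus_of_mem {a : A} {d : ℕ} (hd : d ≠ 0) (ha : a ∈ 𝒜 d) : a ∈ Aplus 𝒜 := by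
  rw [mem_Aplus, GradedRing.proj_apply, DirectSum.decompose_of_mem_ne 𝒜 ha hd]

theorem eq_zero_of_mem_Aplus {a : A} (h0 : a ∈ 𝒜 0) (ha : a ∈ Aplus 𝒜) : a = 0 := by
  rw [mem_Aplus, GradedRing.proj_apply, DirectSum.decompose_of_mem_same 𝒜 h0] at ha
  exact ha

variable {𝒜} {ε : A →ₐ[k] k} (hε : ∀ a, ε a = 0 ↔ a ∈ Aplus 𝒜)

/-- The component of an element in the augmentation ideal. -/
def plusPart : A →ₗ[k] Aplus 𝒜 where
  toFun a := ⟨a - algebraMap k A (ε a), by rw [← hε]; simp⟩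
  map_add' a b := Subtype.ext (by simp; abel)
  map_smul' c a := Subtype.ext (by simp [Algebra.smul_def, mul_sub])

theorem coe_plusPart (a : A) : (plusPart hε a : A) = a - algebraMap k A (ε a) := rfl

theorem plusPart_coe (a : Aplus 𝒜) : plusPart hε a = a :=
  Subtype.ext (by simp [coe_plusPart, (hε _).2 a.2])

/-- The term `ε b • a` measures how far `plusPart` is from commuting with left multiplication; it
cancels in the homotopy formula `D_S_add_S_D`. -/
theorem plusPart_mul (a : Aplus 𝒜) (b : A) :
    plusPart hε (a * b) = plusMul 𝒜 a (plusPart hε b) + ε b • a :=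
  Subtype.ext (by
    simp [coe_plusPart, (hε _).2 a.2, coe_plusMul, mul_sub, Algebra.smul_def,
      Algebra.commutes (ε b) (a : A)])

theorem plusPart_mem {a : A} {d : ℕ} (ha : a ∈ 𝒜 d) : (plusPart hε a : A) ∈ 𝒜 d := by
  rcases eq_or_ne d 0 with rfl | hd
  · have : algebraMap k A (ε a) ∈ 𝒜 0 := by
      rw [Algebra.algebraMap_eq_smul_one]
      exact Submodule.smul_mem _ _ SetLike.GradedOne.one_mem
    exact Submodule.sub_mem _ ha this
  · rw [coe_plusPart, (hε a).2 (mem_Aplus_of_mem 𝒜 hd ha), map_zero, sub_zero]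
    exact ha

end Augmented

end QuadExt

namespace QuadExt

/-! ### Free modules: the contracting homotopy of bar cochains, and internal degrees -/

section Free

variable {k A : Type*} [Field k] [Ring A] [Algebra k A]
variable {𝒜 : ℕ → Submodule k A} [GradedAlgebra 𝒜]
variable {ε : A →ₐ[k] k} (hε : ∀ a, ε a = 0 ↔ a ∈ Aplus 𝒜)
variable {J J' : Type} [Fintype J] [Fintype J']

open scoped Classical in
/-- The standard basis vectors of a free module. -/
noncomputable def unitVec (A : Type*) [Ring A] {J : Type} (ρ : J) : J → A := Pi.single ρ 1

theorem sum_smul_unitVec (v : J → A) : ∑ ρ, v ρ • unitVec A ρ = v := by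
  classical
  funext σ
  simp [unitVec, Pi.single_apply]

theorem vecMulLinear_eq (M : Matrix J J' A) (v : J → A) :
    Matrix.vecMulLinear M v = ∑ ρ, v ρ • M ρ := by
  funext σ
  simp [Matrix.vecMul, dotProduct]

theorem vecMulLinear_unitVec (M : Matrix J J' A) (ρ : J) :
    Matrix.vecMulLinear M (unitVec A ρ) = M ρ := by
  classical
  funext σ
  simp [unitVec]

variable (𝒜) in
/-- The component of degree `e` of the module `A` shifted by `s`. -/
def shiftGrade (s e : ℕ) : Submodule k A := if s ≤ e then 𝒜 (e - s) else ⊥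

variable (𝒜) in
/-- The component of degree `e` of the graded free module on basis vectors of degrees `deg`. -/
def freeModGrade (deg : J → ℕ) (e : ℕ) : Submodule k (J → A) :=
  Submodule.pi Set.univ fun ρ => shiftGrade 𝒜 (deg ρ) e

theorem mem_shiftGrade {s e : ℕ} {a : A} :
    a ∈ shiftGrade 𝒜 s e ↔ a = 0 ∨ ∃ d, e = s + d ∧ a ∈ 𝒜 d := by
  unfold shiftGrade
  split_ifs with h
  · constructor
    · exact fun ha => .inr ⟨_, by omega, ha⟩
    · rintro (rfl | ⟨d, rfl, ha⟩)
      · exact zero_mem _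
      · simpa using ha
  · constructor
    · exact fun ha => .inl (by simpa using ha)
    · rintro (rfl | ⟨d, rfl, ha⟩)
      · exact zero_mem _
      · omega

theorem mem_freeModGrade {deg : J → ℕ} {e : ℕ} {v : J → A} :
    v ∈ freeModGrade 𝒜 deg e ↔ ∀ ρ, v ρ = 0 ∨ ∃ d, e = deg ρ + d ∧ v ρ ∈ 𝒜 d := by
  simp [freeModGrade, mem_shiftGrade]

theorem unitVec_mem (deg : J → ℕ) (ρ : J) : unitVec A ρ ∈ freeModGrade 𝒜 deg (deg ρ) := by
  classical
  rw [mem_freeModGrade]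
  intro σ
  by_cases h : σ = ρ
  · subst h
    exact .inr ⟨0, rfl, by simpa [unitVec] using SetLike.GradedOne.one_mem⟩
  · exact .inl (by simp [unitVec, h])

theorem smul_mem_freeModGrade {deg : J → ℕ} {d e : ℕ} {a : A} {v : J → A} (ha : a ∈ 𝒜 d)
    (hv : v ∈ freeModGrade 𝒜 deg e) : a • v ∈ freeModGrade 𝒜 deg (d + e) := by
  rw [mem_freeModGrade] at *
  intro ρ
  rcases hv ρ with h | ⟨c, hc, h⟩
  · exact .inl (by simp [h])
  · exact .inr ⟨d + c, by omega, SetLike.GradedMul.mul_mem ha h⟩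

namespace ModCochain

/-- Evaluation of cochains. -/
def ev {X : Type*} [AddCommGroup X] [Module k X] {n : ℕ} (x : Fin n → Aplus 𝒜) (y : X) :
    ModCochain 𝒜 X n →ₗ[k] k where
  toFun f := f x y
  map_add' _ _ := rfl
  map_smul' _ _ := rfl

/-- Cochains without arguments in `A₊`. -/
def ofDual {X : Type*} [AddCommGroup X] [Module k X] :
    (X →ₗ[k] k) →ₗ[k] ModCochain 𝒜 X 0 where
  toFun φ := MultilinearMap.constOfIsEmpty k (fun _ : Fin 0 => Aplus 𝒜) φ
  map_add' _ _ := rfl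
  map_smul' _ _ := rfl

/-- The contracting homotopy of the bar cochains on a free module. -/
noncomputable def S : ∀ {n : ℕ}, ModCochain 𝒜 (J → A) (n + 1) →ₗ[k] ModCochain 𝒜 (J → A) n
  | 0 =>
    { toFun := fun f => ofDual (∑ ρ, ev default (unitVec A ρ) ∘ₗ
        app 𝒜 f ∘ₗ plusPart hε ∘ₗ LinearMap.proj ρ)
      map_add' := fun f g => by
        rw [← map_add, ← Finset.sum_add_distrib]
        congr 1
      map_smul' := fun c f => by
        rw [← map_smul, Finset.smul_sum]
        congr 1 }
  | n + 1 =>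
    { toFun := fun f => - (app 𝒜).symm (S ∘ₗ app 𝒜 f)
      map_add' := fun f g => by
        rw [map_add, LinearMap.comp_add, map_add, neg_add]
      map_smul' := fun c f => by
        rw [map_smul, LinearMap.comp_smul, map_smul, smul_neg, RingHom.id_apply] }

theorem S_zero_apply (f : ModCochain 𝒜 (J → A) 1) (x : Fin 0 → Aplus 𝒜) (v : J → A) :
    S hε f x v = ∑ ρ, app 𝒜 f (plusPart hε (v ρ)) x (unitVec A ρ) := by
  rw [Subsingleton.elim x default]
  change (∑ ρ, ev default (unitVec A ρ) ∘ₗ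
        app 𝒜 f ∘ₗ plusPart hε ∘ₗ LinearMap.proj ρ : (J → A) →ₗ[k] k) v = _
  rw [LinearMap.sum_apply]
  rfl

theorem app_S_succ {n : ℕ} (f : ModCochain 𝒜 (J → A) (n + 2)) (a : Aplus 𝒜) :
    app 𝒜 (S hε f) a = - S hε (app 𝒜 f a) := rfl

/-- On `v = ∑ v_ρ e_ρ` the homotopy moves the `A₊`-part of the coefficient `v_ρ` into the last bar
slot and leaves the basis vector `e_ρ` as module argument. All steps but the base case are formal,
since both `D` and `S` recurse on the first argument. The base case uses that the scalar parts `ε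
(v_ρ)` cancel and that the vectors `v_ρ e_ρ` add up to `v`. -/
theorem D_S_add_S_D : ∀ {n : ℕ} (f : ModCochain 𝒜 (J → A) (n + 1)),
    D 𝒜 (S hε f) + S hε (D 𝒜 f) = - f
  | 0, f => by
    refine ext_app 𝒜 fun a => ?_
    rw [map_add, LinearMap.add_apply, app_D_zero, app_S_succ, app_D_succ]
    ext x v
    have h : ∀ ρ, app 𝒜 (mulFirst 𝒜 a f) (plusPart hε (v ρ)) x (unitVec A ρ) =
        app 𝒜 f (plusPart hε ((a : A) * v ρ)) x (unitVec A ρ) -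
          ε (v ρ) * app 𝒜 f a x (unitVec A ρ) := fun ρ => by
      rw [plusPart_mul, map_add, map_smul]; simp
    have h' : ∀ ρ, app 𝒜 (D 𝒜 (app 𝒜 f a)) (plusPart hε (v ρ)) x (unitVec A ρ) =
        ε (v ρ) * app 𝒜 f a x (unitVec A ρ) - app 𝒜 f a x (v ρ • unitVec A ρ) := fun ρ => by
      have : (plusPart hε (v ρ) : A) • unitVec A ρ
          = v ρ • unitVec A ρ - ε (v ρ) • unitVec A ρ := by
        rw [coe_plusPart, sub_smul, algebraMap_smul]
      rw [app_D_zero]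
      simp [this]
    have h'' : app 𝒜 f a x v = ∑ ρ, app 𝒜 f a x (v ρ • unitVec A ρ) := by
      rw [← map_sum, sum_smul_unitVec]
    simp only [add_apply, neg_apply, pre_apply, S_zero_apply, map_sub, map_neg, sub_apply,
      LinearMap.neg_apply, h, h', h'', Algebra.lsmul_coe, Pi.smul_apply,
      smul_eq_mul, Finset.sum_sub_distrib]
    ring
  | n + 1, f => by
    refine ext_app 𝒜 fun a => ?_
    have h1 : S hε (mulFirst 𝒜 a f) = mulFirst 𝒜 a (S hε f) :=
      ext_app 𝒜 fun b => rfl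
    have h2 : D 𝒜 (- S hε (app 𝒜 f a)) = - D 𝒜 (S hε (app 𝒜 f a)) := map_neg _ _
    have h3 := D_S_add_S_D (app 𝒜 f a)
    rw [map_add, LinearMap.add_apply, app_D_succ, app_S_succ, app_S_succ,
      app_D_succ, h2, map_sub,
      map_neg, h1, map_neg, LinearMap.neg_apply, ← h3]
    abel

theorem D_neg_S {n : ℕ} (f : ModCochain 𝒜 (J → A) (n + 1)) (hf : D 𝒜 f = 0) :
    D 𝒜 (- S hε f) = f := by
  have h := D_S_add_S_D hε f
  rw [hf, map_zero, add_zero] at h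
  rw [map_neg, h, neg_neg]

/-- A cochain of internal degree `j` whose arguments are preceded by arguments of total
degree `c`. -/
def IsHomog (deg : J → ℕ) (c j : ℕ) {n : ℕ} (f : ModCochain 𝒜 (J → A) n) : Prop :=
  ∀ (d : Fin n → ℕ) (x : Fin n → Aplus 𝒜) (e : ℕ) (v : J → A),
    (∀ l, (x l : A) ∈ 𝒜 (d l)) → v ∈ freeModGrade 𝒜 deg e → c + ∑ l, d l + e ≠ j → f x v = 0

theorem isHomog_succ {deg : J → ℕ} {c j n : ℕ} {f : ModCochain 𝒜 (J → A) (n + 1)} :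
    IsHomog deg c j f ↔ ∀ d (a : Aplus 𝒜), (a : A) ∈ 𝒜 d → IsHomog deg (c + d) j (app 𝒜 f a) := by
  constructor
  · intro h d a ha d' x e v hx hv hj
    refine h (Fin.cons d d') (Fin.cons a x) e v ?_ hv ?_
    · intro l
      refine Fin.cases ?_ (fun i => ?_) l
      · simpa using ha
      · simpa using hx i
    · rw [Fin.sum_univ_succ]
      simpa [add_assoc] using hj
  · intro h d x e v hx hv hj
    have := h (d 0) (x 0) (hx 0) (Fin.tail d) (Fin.tail x) e v (fun l => hx l.succ) hv (by
      rw [Fin.sum_univ_succ] at hj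
      simpa [add_assoc, Fin.tail] using hj)
    rwa [app_apply, Fin.cons_self_tail] at this

section

variable {deg : J → ℕ} {c j n : ℕ}

theorem IsHomog.neg {f : ModCochain 𝒜 (J → A) n} (hf : IsHomog deg c j f) :
    IsHomog deg c j (- f) := fun d x e v hx hv h => by simp [hf d x e v hx hv h]

theorem IsHomog.sub {f g : ModCochain 𝒜 (J → A) n} (hf : IsHomog deg c j f)
    (hg : IsHomog deg c j g) : IsHomog deg c j (f - g) :=
  fun d x e v hx hv h => by simp [hf d x e v hx hv h, hg d x e v hx hv h]

theorem IsHomog.pre {deg' : J' → ℕ} {φ : (J → A) →ₗ[k] (J' → A)}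
    (hφ : ∀ e, ∀ v ∈ freeModGrade 𝒜 deg e, φ v ∈ freeModGrade 𝒜 deg' e)
    {f : ModCochain 𝒜 (J' → A) n} (hf : IsHomog deg' c j f) :
    IsHomog deg c j (pre 𝒜 φ f) :=
  fun d x e v hx hv h => hf d x e _ hx (hφ e v hv) h

end

theorem IsHomog.S {deg : J → ℕ} {j : ℕ} : ∀ {c n : ℕ} {f : ModCochain 𝒜 (J → A) (n + 1)},
    IsHomog deg c j f → IsHomog deg c j (S hε f)
  | c, 0, f, hf => by
    intro d x e v hx hv h
    rw [S_zero_apply]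
    refine Finset.sum_eq_zero fun ρ _ => ?_
    rw [mem_freeModGrade] at hv
    rcases hv ρ with h0 | ⟨b, hb, h0⟩
    · simp [h0]
    · refine isHomog_succ.1 hf b _ (plusPart_mem hε h0) d x _ _ hx (unitVec_mem deg ρ) ?_
      simp at h ⊢
      omega
  | c, n + 1, f, hf => by
    rw [isHomog_succ] at hf ⊢
    intro d a ha
    rw [app_S_succ]
    exact (IsHomog.S (hf d a ha)).neg

theorem IsHomog.D {deg : J → ℕ} {j : ℕ} : ∀ {c n : ℕ} {f : ModCochain 𝒜 (J → A) n},
    IsHomog deg c j f → IsHomog deg c j (D 𝒜 f)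
  | c, 0, f, hf => by
    rw [isHomog_succ]
    intro b a ha d x e v hx hv h
    rw [app_D_zero, neg_apply, pre_apply, Algebra.lsmul_coe,
      hf d x _ _ hx (smul_mem_freeModGrade ha hv), neg_zero]
    simp at h ⊢
    omega
  | c, n + 1, f, hf => by
    rw [isHomog_succ]
    intro b a ha
    rw [app_D_succ]
    refine IsHomog.sub (IsHomog.neg ?_) (IsHomog.D (isHomog_succ.1 hf b a ha))
    rw [isHomog_succ]
    intro b' a' ha'
    rw [app_mulFirst, add_assoc]
    exact isHomog_succ.1 hf _ _ (SetLike.GradedMul.mul_mem ha ha')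

end ModCochain
end Free
end QuadExt

namespace QuadExt

/-! ### Graded splittings over the field -/

section GradedSection

variable {k A : Type*} [Field k] [Ring A] [Algebra k A]
variable {𝒜 : ℕ → Submodule k A} [GradedAlgebra 𝒜]
variable {J J' : Type} [Fintype J] [Fintype J']

/-- Over a field the range of `φ` is a direct summand of the target and `φ` has a section over it;
compose the projection with the section. -/
theorem exists_generalizedInverse {V W : Type*} [AddCommGroup V] [Module k V] [AddCommGroup W]
    [Module k W] (φ : V →ₗ[k] W) : ∃ σ : W →ₗ[k] V, ∀ y, φ (σ (φ y)) = φ y := by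
  obtain ⟨s, hs⟩ := φ.rangeRestrict.exists_rightInverse_of_surjective (LinearMap.range_rangeRestrict φ)
  obtain ⟨r, hr⟩ := (LinearMap.range φ).subtype.exists_leftInverse_of_injective
    (Submodule.ker_subtype _)
  refine ⟨s ∘ₗ r, fun y => ?_⟩
  have h1 : r (φ y) = φ.rangeRestrict y := LinearMap.congr_fun hr (φ.rangeRestrict y)
  have h2 := congrArg Subtype.val (LinearMap.congr_fun hs (φ.rangeRestrict y))
  simpa [h1] using h2

theorem linearMap_ext_homogeneous {V : Type*} [AddCommGroup V] [Module k V]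
    {f g : (J → A) →ₗ[k] V} (deg : J → ℕ)
    (h : ∀ e, ∀ v ∈ freeModGrade 𝒜 deg e, f v = g v) : f = g := by
  have key : ∀ (ρ : J) (a : A), f (a • unitVec A ρ) = g (a • unitVec A ρ) := by
    intro ρ a
    induction a using DirectSum.Decomposition.inductionOn 𝒜 with
    | zero => simp
    | homogeneous a => exact h _ _ (smul_mem_freeModGrade a.2 (unitVec_mem deg ρ))
    | add a b ha hb => rw [add_smul, map_add, map_add, ha, hb]
  ext v
  rw [← sum_smul_unitVec v, map_sum, map_sum]
  exact Finset.sum_congr rfl fun ρ _ => key ρ _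

/-- Choose a generalized inverse in each degree and glue the choices along `A = ⨁ A_d` in every
coordinate. The identity needs checking on homogeneous vectors only. -/
theorem exists_graded_generalizedInverse {deg : J → ℕ} {deg' : J' → ℕ}
    (φ : (J' → A) →ₗ[k] (J → A))
    (hφ : ∀ e, ∀ v ∈ freeModGrade 𝒜 deg' e, φ v ∈ freeModGrade 𝒜 deg e) :
    ∃ σ : (J → A) →ₗ[k] (J' → A),
      (∀ e, ∀ v ∈ freeModGrade 𝒜 deg e, σ v ∈ freeModGrade 𝒜 deg' e) ∧
      ∀ y, φ (σ (φ y)) = φ y := by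
  choose g hg using fun e => exists_generalizedInverse (φ.restrict (hφ e))
  let single : ∀ (ρ : J) (d : ℕ), 𝒜 d →ₗ[k] freeModGrade 𝒜 deg (d + deg ρ) := fun ρ d =>
    { toFun := fun a => ⟨(a : A) • unitVec A ρ, smul_mem_freeModGrade a.2 (unitVec_mem deg ρ)⟩
      map_add' := fun a b => Subtype.ext (add_smul _ _ _)
      map_smul' := fun c a => Subtype.ext (smul_assoc _ _ _) }
  let T : ∀ ρ : J, A →ₗ[k] (J' → A) := fun ρ =>
    DirectSum.toModule k ℕ _ (fun d => (freeModGrade 𝒜 deg' (d + deg ρ)).subtype ∘ₗ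
      g (d + deg ρ) ∘ₗ single ρ d) ∘ₗ (DirectSum.decomposeLinearEquiv 𝒜).toLinearMap
  have hT : ∀ ρ d (a : 𝒜 d), T ρ a = g (d + deg ρ) (single ρ d a) := by
    intro ρ d a
    simp only [T, LinearMap.comp_apply, LinearEquiv.coe_coe, DirectSum.decomposeLinearEquiv_apply,
      DirectSum.decompose_coe]
    exact DirectSum.toModule_lof (M := fun i => 𝒜 i) k d a
  let σ : (J → A) →ₗ[k] (J' → A) := ∑ ρ, T ρ ∘ₗ LinearMap.proj ρ
  -- A homogeneous vector of degree `e` is the sum of its coordinate parts, all of degree `e`, so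
  -- the glued map agrees on it with the single choice `g e`.
  have hσ : ∀ e (v : freeModGrade 𝒜 deg e), σ v = g e v := by
    intro e v
    have h1 : ∀ ρ, ∃ w : freeModGrade 𝒜 deg e, (w : J → A) = (v : J → A) ρ • unitVec A ρ ∧
        T ρ ((v : J → A) ρ) = g e w := by
      intro ρ
      rcases mem_freeModGrade.1 v.2 ρ with h | ⟨d, hd, h⟩
      · exact ⟨0, by simp [h], by simp [h]⟩
      · have hd' : e = d + deg ρ := by omega
        clear hd
        subst hd'
        exact ⟨single ρ d ⟨_, h⟩, rfl, hT ρ d ⟨_, h⟩⟩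
    choose w hw1 hw2 using h1
    have h2 : v = ∑ ρ, w ρ := Subtype.ext (by
      rw [AddSubmonoidClass.coe_finsetSum]
      simp only [hw1, sum_smul_unitVec])
    conv_rhs => rw [h2]
    rw [map_sum, AddSubmonoidClass.coe_finsetSum]
    simp only [σ, LinearMap.sum_apply, LinearMap.comp_apply, LinearMap.proj_apply, hw2]
  refine ⟨σ, fun e v hv => ?_, fun y => ?_⟩
  · rw [hσ e ⟨v, hv⟩]
    exact (g e _).2
  · have : φ ∘ₗ σ ∘ₗ φ = φ := linearMap_ext_homogeneous (𝒜 := 𝒜) deg' fun e v hv => by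
      have h := congrArg Subtype.val (hg e ⟨v, hv⟩)
      simp only [LinearMap.comp_apply]
      rw [hσ e ⟨φ v, hφ e v hv⟩]
      exact h
    exact LinearMap.congr_fun this y

end GradedSection

/-! ### Dimension shifting along a minimal resolution -/

section Comparison

variable {k A : Type*} [Field k] [Ring A] [Algebra k A]
variable {𝒜 : ℕ → Submodule k A} [GradedAlgebra 𝒜]
variable {ε : A →ₐ[k] k} (hε : ∀ a, ε a = 0 ↔ a ∈ Aplus 𝒜)
variable {I : ℕ → Type} [∀ i, Fintype (I i)] {deg : ∀ i, I i → ℕ} {e₀ : I 0}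
  {lam : ∀ i, Matrix (I (i + 1)) (I i) A}

/-- The differential of a resolution as a linear map over the field. -/
noncomputable abbrev resMap (k : Type*) [Field k] [Algebra k A]
    (lam : ∀ i, Matrix (I (i + 1)) (I i) A) (l : ℕ) :
    (I (l + 1) → A) →ₗ[k] (I l → A) := (Matrix.vecMulLinear (lam l)).restrictScalars k

namespace IsMinimalGradedResolution

variable (hres : IsMinimalGradedResolution 𝒜 ε I deg e₀ lam)

include hres in
theorem resMap_mem (l e : ℕ) (v : I (l + 1) → A) (hv : v ∈ freeModGrade 𝒜 (deg (l + 1)) e) :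
    resMap k lam l v ∈ freeModGrade 𝒜 (deg l) e := by
  rw [LinearMap.restrictScalars_apply, vecMulLinear_eq]
  refine Submodule.sum_mem _ fun ρ _ => ?_
  rcases mem_freeModGrade.1 hv ρ with h | ⟨d, rfl, h⟩
  · rw [h, zero_smul]; exact zero_mem _
  rw [mem_freeModGrade]
  intro σ
  rcases hres.homogeneous l ρ σ with h' | ⟨d', hd', h'⟩
  · exact .inl (by simp [h'])
  · exact .inr ⟨d + d', by omega, SetLike.GradedMul.mul_mem h h'⟩

include hres in
theorem resMap_resMap (l : ℕ) (v : I (l + 2) → A) :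
    resMap k lam l (resMap k lam (l + 1) v) = 0 :=
  (hres.exact_succ l _).2 ⟨v, rfl⟩

include hres in
theorem exists_splitting (l : ℕ) : ∃ σ : (I l → A) →ₗ[k] (I (l + 1) → A),
    (∀ e, ∀ v ∈ freeModGrade 𝒜 (deg l) e, σ v ∈ freeModGrade 𝒜 (deg (l + 1)) e) ∧
      ∀ y, resMap k lam l (σ (resMap k lam l y)) = resMap k lam l y :=
  exists_graded_generalizedInverse _ (hres.resMap_mem l)

end IsMinimalGradedResolution

namespace ModCochain

variable (hres : IsMinimalGradedResolution 𝒜 ε I deg e₀ lam)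

include hres in
-- A cochain on `P^{l+1}` that dies on the image of `P^{l+2}` is a cochain on the syzygy inside
-- `P^l`. Since the syzygy splits off over `k`, compatibly with degrees, the cochain extends to all
-- of `P^l`.
theorem exists_pre_eq {l n c j : ℕ} (f : ModCochain 𝒜 (I (l + 1) → A) n)
    (hf : pre 𝒜 (resMap k lam (l + 1)) f = 0) (hj : IsHomog (deg (l + 1)) c j f) :
    ∃ g : ModCochain 𝒜 (I l → A) n, pre 𝒜 (resMap k lam l) g = f ∧ IsHomog (deg l) c j g := by
  obtain ⟨σ, hσ, hσ'⟩ := hres.exists_splitting l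
  refine ⟨pre 𝒜 σ f, ?_, hj.pre hσ⟩
  ext x y
  have h : resMap k lam l (σ (resMap k lam l y) - y) = 0 := by rw [map_sub, hσ', sub_self]
  obtain ⟨z, hz⟩ := (hres.exact_succ l _).1 h
  have h' := congrArg (fun g => g x z) hf
  simp only [pre_apply, zero_apply] at h' ⊢
  rw [LinearMap.restrictScalars_apply, hz, map_sub, sub_eq_zero] at h'
  exact h'

theorem apply_smul_of_D_eq_zero {X : Type*} [AddCommGroup X] [Module k X] [Module A X]
    [IsScalarTower k A X] {f : ModCochain 𝒜 X 0} (hf : D 𝒜 f = 0) {a : A} (ha : a ∈ Aplus 𝒜)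
    (x : Fin 0 → Aplus 𝒜) (y : X) : f x (a • y) = 0 := by
  have h := congrArg (fun g => app 𝒜 g ⟨a, ha⟩ x y) hf
  simpa [app_D_zero] using h

include hε hres in
-- A cocycle without bar arguments kills `A₊ P^l`, and by minimality the differential has its image
-- there.
theorem pre_resMap_eq_zero {l : ℕ} {f : ModCochain 𝒜 (I l → A) 0} (hf : D 𝒜 f = 0) :
    pre 𝒜 (resMap k lam l) f = 0 := by
  ext x v
  rw [pre_apply, LinearMap.restrictScalars_apply, vecMulLinear_eq, map_sum, zero_apply]
  refine Finset.sum_eq_zero fun ρ _ => ?_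
  rw [← sum_smul_unitVec (lam l ρ), Finset.smul_sum, map_sum]
  refine Finset.sum_eq_zero fun σ _ => ?_
  have hm : v ρ * lam l ρ σ ∈ Aplus 𝒜 := by
    rw [← hε, map_mul, (hε _).2 (hres.minimal l ρ σ), mul_zero]
  rw [smul_smul, apply_smul_of_D_eq_zero hf hm]

/-- The cohomological degree that is reached after `n` steps from `l`. -/
def stepIdx : ℕ → ℕ → ℕ
  | 0, l => l
  | n + 1, l => stepIdx n (l + 1)

theorem stepIdx_eq : ∀ n l, stepIdx n l = l + n
  | 0, _ => rfl
  | n + 1, _ => (stepIdx_eq n _).trans (by omega)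

variable (lam) in
/-- The comparison of bar cochains with the dual of a minimal resolution. -/
noncomputable def res : ∀ n l, ModCochain 𝒜 (I l → A) n →ₗ[k] (I (stepIdx n l) → k)
  | 0, _ => LinearMap.pi fun ρ => ev default (unitVec A ρ)
  -- For a cocycle `f` on a syzygy, `- S f` is a primitive on the free module. Its pullback to
  -- `P^{l+1}` is a cocycle of one degree less on the next syzygy.
  | n + 1, l => res n (l + 1) ∘ₗ pre 𝒜 (resMap k lam l) ∘ₗ (- S hε)

theorem res_succ_apply {n l : ℕ} (f : ModCochain 𝒜 (I l → A) (n + 1)) :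
    res hε lam (n + 1) l f = res hε lam n (l + 1) (pre 𝒜 (resMap k lam l) (- S hε f)) := rfl

/-- The chosen primitive of `D u` differs from `u` by a cocycle `e`, so the claim reduces to the
vanishing of `res` on pullbacks of cocycles. It is kept as a hypothesis because the two facts are
proved by one induction. -/
theorem res_D_of {n l : ℕ} (u : ModCochain 𝒜 (I l → A) n)
    (h : ∀ e : ModCochain 𝒜 (I l → A) n, D 𝒜 e = 0 →
      res hε lam n (l + 1) (pre 𝒜 (resMap k lam l) e) = 0) :
    res hε lam (n + 1) l (D 𝒜 u) = res hε lam n (l + 1) (pre 𝒜 (resMap k lam l) u) := by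
  have h1 : D 𝒜 (- S hε (D 𝒜 u) - u) = 0 := by
    rw [map_sub, D_neg_S hε (D 𝒜 u) (D_D 𝒜 u), sub_self]
  have h2 := h _ h1
  rw [map_sub, map_sub, sub_eq_zero] at h2
  rw [res_succ_apply, h2]

include hres in
-- In positive degree a cocycle on the free module `P^l` is a coboundary, hence so is its pullback;
-- `res_D_of` then pulls the primitive back along two consecutive differentials, which gives zero.
-- In degree zero minimality applies.
theorem res_pre_eq_zero : ∀ {n l : ℕ} (e : ModCochain 𝒜 (I l → A) n), D 𝒜 e = 0 →
    res hε lam n (l + 1) (pre 𝒜 (resMap k lam l) e) = 0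
  | 0, l, e, he => by
    rw [pre_resMap_eq_zero hε hres he, map_zero]
  | n + 1, l, e, he => by
    have h : pre 𝒜 (resMap k lam l) e = D 𝒜 (pre 𝒜 (resMap k lam l) (- S hε e)) := by
      rw [D_pre, D_neg_S hε e he]
    have h2 : pre 𝒜 (resMap k lam (l + 1)) (pre 𝒜 (resMap k lam l) (- S hε e)) = 0 := by
      ext x v
      rw [pre_apply, pre_apply, hres.resMap_resMap, map_zero, zero_apply]
    rw [h, res_D_of hε _ (fun e he => res_pre_eq_zero e he), h2, map_zero]
    rfl

include hres in
theorem res_D {n l : ℕ} (u : ModCochain 𝒜 (I l → A) n) :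
    res hε lam (n + 1) l (D 𝒜 u) = res hε lam n (l + 1) (pre 𝒜 (resMap k lam l) u) :=
  res_D_of hε u fun e he => res_pre_eq_zero hε hres e he

/-- Modulo `A₊ P^l`, which the cocycle kills, the free module is spanned over `k` by its basis
vectors. -/
theorem eq_zero_of_res_zero {l : ℕ} {f : ModCochain 𝒜 (I l → A) 0} (hD : D 𝒜 f = 0)
    (h : res hε lam 0 l f = 0) : f = 0 := by
  ext x v
  rw [Subsingleton.elim x default, ← sum_smul_unitVec v, map_sum, zero_apply]
  refine Finset.sum_eq_zero fun ρ _ => ?_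
  have h1 : v ρ = (plusPart hε (v ρ) : A) + algebraMap k A (ε (v ρ)) := by simp [coe_plusPart]
  have h2 : f default (unitVec A ρ) = 0 := congrFun h ρ
  rw [h1, add_smul, map_add, apply_smul_of_D_eq_zero hD (plusPart hε (v ρ)).2, algebraMap_smul,
    map_smul, h2, smul_zero, add_zero]

include hres in
-- Injectivity of the comparison, by induction on the degree. The condition `pre … = 0` says that a
-- cochain lives on the cokernel of the differential, that is, on a syzygy or on `k`. The point is
-- to find a primitive that lives there as well, and is homogeneous.
theorem exists_D_eq : ∀ {n l j : ℕ} (f : ModCochain 𝒜 (I l → A) (n + 1)),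
    IsHomog (deg l) 0 j f → D 𝒜 f = 0 → pre 𝒜 (resMap k lam l) f = 0 →
    res hε lam (n + 1) l f = 0 →
    ∃ g : ModCochain 𝒜 (I l → A) n, IsHomog (deg l) 0 j g ∧ D 𝒜 g = f ∧
      pre 𝒜 (resMap k lam l) g = 0
  | n, l, j, f, hj, hD, hp, hr => by
    have hh : IsHomog (deg l) 0 j (- S hε f) := (hj.S hε).neg
    have hDh := D_neg_S hε f hD
    have hj1 : IsHomog (deg (l + 1)) 0 j (pre 𝒜 (resMap k lam l) (- S hε f)) :=
      hh.pre (hres.resMap_mem l)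
    have hD1 : D 𝒜 (pre 𝒜 (resMap k lam l) (- S hε f)) = 0 := by rw [D_pre, hDh, hp]
    have hp1 : pre 𝒜 (resMap k lam (l + 1)) (pre 𝒜 (resMap k lam l) (- S hε f)) = 0 := by
      ext x v
      rw [pre_apply, pre_apply, hres.resMap_resMap, map_zero, zero_apply]
    rw [res_succ_apply] at hr
    match n with
    | 0 => exact ⟨_, hh, hDh, eq_zero_of_res_zero hε hD1 hr⟩
    | n + 1 =>
      obtain ⟨g', hg1, hg2, hg3⟩ := exists_D_eq _ hj1 hD1 hp1 hr
      obtain ⟨g, hg, hgj⟩ := exists_pre_eq hres g' hg3 hg1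
      -- The primitive `- S f` need not descend to the syzygy. Its pullback is `D g'` by induction,
      -- so subtracting `D g`, with `g` an extension of `g'`, repairs this without changing the
      -- differential.
      refine ⟨- S hε f - D 𝒜 g, hh.sub hgj.D, ?_, ?_⟩
      · rw [map_sub, D_D, sub_zero, hDh]
      · rw [map_sub, ← D_pre, hg, hg2, sub_self]

include hε hres in
theorem exists_res_zero_eq {l j : ℕ} (φ : I l → k) (hφ : ∀ ρ, deg l ρ ≠ j → φ ρ = 0) :
    ∃ f : ModCochain 𝒜 (I l → A) 0, IsHomog (deg l) 0 j f ∧ D 𝒜 f = 0 ∧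
      pre 𝒜 (resMap k lam l) f = 0 ∧ res hε lam 0 l f = φ := by
  classical
  let f : ModCochain 𝒜 (I l → A) 0 := ofDual (∑ ρ : I l, φ ρ • ε.toLinearMap ∘ₗ LinearMap.proj ρ)
  have hf : ∀ x v, f x v = ∑ ρ : I l, φ ρ * ε (v ρ) := by
    intro x v
    change (∑ ρ : I l, φ ρ • ε.toLinearMap ∘ₗ LinearMap.proj ρ) v = _
    simp [LinearMap.sum_apply]
  have hD : D 𝒜 f = 0 := by
    refine ext_app 𝒜 fun a => ?_
    ext x v
    rw [app_D_zero, neg_apply, pre_apply, hf]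
    simp [(hε _).2 a.2]
  refine ⟨f, ?_, hD, pre_resMap_eq_zero hε hres hD, ?_⟩
  · intro d x e v _ hv he
    rw [hf]
    refine Finset.sum_eq_zero fun ρ _ => ?_
    rcases mem_freeModGrade.1 hv ρ with h | ⟨b, hb, h⟩
    · simp [h]
    · rcases eq_or_ne b 0 with rfl | hb0
      · rw [hφ ρ (by simp at he hb; omega), zero_mul]
      · rw [(hε _).2 (mem_Aplus_of_mem 𝒜 hb0 h), mul_zero]
  · refine funext fun (ρ : I l) => ?_
    change f default (unitVec A ρ) = φ ρ
    rw [hf, Finset.sum_eq_single ρ]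
    · simp [unitVec]
    · intro σ _ hσ
      simp [unitVec, hσ]
    · simp

include hres in
-- Surjectivity of the comparison: realize `φ` one step further along the resolution, extend that
-- cochain from the syzygy to the free module, and take its differential.
theorem exists_res_eq : ∀ {n l j : ℕ} (φ : I (stepIdx n l) → k),
    (∀ ρ, deg _ ρ ≠ j → φ ρ = 0) →
    ∃ f : ModCochain 𝒜 (I l → A) n, IsHomog (deg l) 0 j f ∧ D 𝒜 f = 0 ∧
      pre 𝒜 (resMap k lam l) f = 0 ∧ res hε lam n l f = φ
  | 0, l, j, φ, hφ => exists_res_zero_eq hε hres φ hφ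
  | n + 1, l, j, φ, hφ => by
    obtain ⟨f', hj, hD, hp, hr⟩ := exists_res_eq (n := n) (l := l + 1) φ hφ
    obtain ⟨h, hh, hhj⟩ := exists_pre_eq hres f' hp hj
    refine ⟨D 𝒜 h, hhj.D, D_D 𝒜 h, ?_, ?_⟩
    · rw [← D_pre, hh, hD]
    · rw [res_D hε hres, hh, hr]

end ModCochain

end Comparison
end QuadExt

namespace QuadExt

/-! ### The bar differential of `k`, in recursive form -/

section BarD

variable {k A : Type*} [Field k] [Ring A] [Algebra k A]
variable {𝒜 : ℕ → Submodule k A} [GradedAlgebra 𝒜]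

theorem contractNth_cons_zero {α : Type*} {n : ℕ} (op : α → α → α) (a : α) (x : Fin (n + 1) → α) :
    Fin.contractNth (0 : Fin (n + 2)) op (Fin.cons a x : Fin (n + 2) → α) =
      Fin.cons (op a (x 0)) (Fin.tail x) := by
  funext i
  refine Fin.cases ?_ (fun i => ?_) i
  · rw [Fin.contractNth_apply_of_eq _ _ _ _ rfl]
    rfl
  · rw [Fin.contractNth_apply_of_gt _ _ _ _ (by simp)]
    rfl

theorem contractNth_cons_succ {α : Type*} {n : ℕ} (op : α → α → α) (a : α) (x : Fin (n + 1) → α)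
    (j : Fin (n + 1)) :
    Fin.contractNth j.succ op (Fin.cons a x : Fin (n + 2) → α) =
      (Fin.cons a (Fin.contractNth j op x) : Fin (n + 1) → α) := by
  funext i
  refine Fin.cases ?_ (fun i => ?_) i
  · rw [Fin.contractNth_apply_of_lt _ _ _ _ (by simp)]
    rfl
  · rcases lt_trichotomy (i : ℕ) j with h | h | h
    · rw [Fin.contractNth_apply_of_lt _ _ _ _ (by simpa using h)]
      change _ = Fin.contractNth j op x i
      rw [Fin.contractNth_apply_of_lt _ _ _ _ h]
      rfl
    · rw [Fin.contractNth_apply_of_eq _ _ _ _ (by simpa using h)]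
      change _ = Fin.contractNth j op x i
      rw [Fin.contractNth_apply_of_eq _ _ _ _ h]
      rfl
    · rw [Fin.contractNth_apply_of_gt _ _ _ _ (by simpa using h)]
      change _ = Fin.contractNth j op x i
      rw [Fin.contractNth_apply_of_gt _ _ _ _ h]
      rfl

theorem barD_zero (f : BarFun 𝒜 0) : barD 𝒜 0 f = 0 := by
  funext x
  simp [barD]

/-- This recursion on the first argument is the one that defines `ModCochain.D`, so the two
differentials can be compared. -/
theorem barD_cons {n : ℕ} (f : BarFun 𝒜 (n + 1)) (a : Aplus 𝒜) (x : Fin (n + 1) → Aplus 𝒜) :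
    barD 𝒜 (n + 1) f (Fin.cons a x) = - f (Fin.cons (plusMul 𝒜 a (x 0)) (Fin.tail x)) -
      barD 𝒜 n (fun t => f (Fin.cons a t)) x := by
  simp only [barD, LinearMap.coe_mk, AddHom.coe_mk]
  rw [Fin.sum_univ_succ]
  have h : ∀ j : Fin n, Fin.contractNth (Fin.castSucc j.succ) (plusMul 𝒜)
      (Fin.cons a x : Fin (n + 2) → Aplus 𝒜) =
      (Fin.cons a (Fin.contractNth j.castSucc (plusMul 𝒜) x) : Fin (n + 1) → Aplus 𝒜) :=
    fun j => contractNth_cons_succ _ _ _ j.castSucc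
  simp only [h, Fin.castSucc_zero, contractNth_cons_zero]
  rw [sub_eq_add_neg, ← Finset.sum_neg_distrib]
  congr 1
  · simp
  · exact Finset.sum_congr rfl fun j _ => by rw [Fin.val_succ]; ring

end BarD

/-! ### Ext read off from a minimal resolution -/

section ExtDim

variable {k A : Type*} [Field k] [Ring A] [Algebra k A]
variable {𝒜 : ℕ → Submodule k A} [GradedAlgebra 𝒜]
variable {ε : A →ₐ[k] k} (hε : ∀ a, ε a = 0 ↔ a ∈ Aplus 𝒜)
variable {I : ℕ → Type} [∀ i, Fintype (I i)] {deg : ∀ i, I i → ℕ} {e₀ : I 0}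
  {lam : ∀ i, Matrix (I (i + 1)) (I i) A}

namespace ModCochain

/-- A cochain on `A` as a bar cochain on the free module `P^0`. -/
noncomputable def ofCochain {n : ℕ} (ε : A →ₐ[k] k) (e₀ : I 0)
    (F : MultilinearMap k (fun _ : Fin n => Aplus 𝒜) k) : ModCochain 𝒜 (I 0 → A) n :=
  (LinearMap.toSpanSingleton k ((I 0 → A) →ₗ[k] k)
    (ε.toLinearMap ∘ₗ LinearMap.proj e₀)).compMultilinearMap F

@[simp] theorem ofCochain_apply {n : ℕ} (F : MultilinearMap k (fun _ : Fin n => Aplus 𝒜) k)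
    (x : Fin n → Aplus 𝒜) (v : I 0 → A) : ofCochain ε e₀ F x v = F x * ε (v e₀) := rfl

/-- The restriction of a bar cochain on a module to one element. -/
def evalAt {X : Type*} [AddCommGroup X] [Module k X] {n : ℕ} (g : ModCochain 𝒜 X n) (y : X) :
    MultilinearMap k (fun _ : Fin n => Aplus 𝒜) k :=
  (LinearMap.applyₗ (R := k) y).compMultilinearMap
    (show MultilinearMap k (fun _ : Fin n => Aplus 𝒜) (X →ₗ[k] k) from g)

@[simp] theorem evalAt_apply {X : Type*} [AddCommGroup X] [Module k X] {n : ℕ}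
    (g : ModCochain 𝒜 X n) (y : X) (x : Fin n → Aplus 𝒜) : evalAt g y x = g x y := rfl

include hε in
-- Cochains on `P^0` that factor through the augmentation are the cochains of `k`. The term in which
-- the last argument acts on the module disappears, as `ε` vanishes on `A₊`.
theorem D_apply_of_eq : ∀ {n : ℕ} {g : ModCochain 𝒜 (I 0 → A) n} {F : BarFun 𝒜 n},
    (∀ x v, g x v = F x * ε (v e₀)) → ∀ x v, D 𝒜 g x v = barD 𝒜 n F x * ε (v e₀)
  | 0, g, F, h, x, v => by
    rw [← Fin.cons_self_tail x, ← app_apply, app_D_zero, barD_zero, neg_apply, pre_apply, h]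
    simp [(hε _).2 (x 0).2]
  | n + 1, g, F, h, x, v => by
    rw [← Fin.cons_self_tail x, ← app_apply, app_D_succ, barD_cons, sub_apply, neg_apply,
      D_apply_of_eq (F := fun t => F (Fin.cons (x 0) t)) (fun y w => h _ w)]
    have h1 : mulFirst 𝒜 (x 0) g (Fin.tail x) v =
        g (Fin.cons (plusMul 𝒜 (x 0) (Fin.tail x 0)) (Fin.tail (Fin.tail x))) v := by
      conv_lhs => rw [← Fin.cons_self_tail (Fin.tail x)]
      rfl
    rw [h1, h]
    ring

include hε in
theorem D_ofCochain {n : ℕ} (F : MultilinearMap k (fun _ : Fin n => Aplus 𝒜) k)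
    (x : Fin (n + 1) → Aplus 𝒜) (v : I 0 → A) :
    D 𝒜 (ofCochain ε e₀ F) x v = barD 𝒜 n F x * ε (v e₀) :=
  D_apply_of_eq hε (F := F) (fun _ _ => rfl) x v

include hε in
theorem ofCochain_isHomog {n j : ℕ} {deg : I 0 → ℕ} (hd : deg e₀ = 0)
    {F : MultilinearMap k (fun _ : Fin n => Aplus 𝒜) k} (hF : ⇑F ∈ cochains 𝒜 n j) :
    IsHomog deg 0 j (ofCochain ε e₀ F) := by
  intro d x e v hx hv hj
  rw [ofCochain_apply]
  rcases mem_freeModGrade.1 hv e₀ with h | ⟨b, hb, h⟩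
  · simp [h]
  · rcases eq_or_ne b 0 with rfl | hb0
    · rw [hF.2 d x hx (by omega), zero_mul]
    · rw [(hε _).2 (mem_Aplus_of_mem 𝒜 hb0 h), mul_zero]

theorem evalAt_mem_cochains {n j : ℕ} {deg : I 0 → ℕ} (hd : deg e₀ = 0)
    {g : ModCochain 𝒜 (I 0 → A) n} (hg : IsHomog deg 0 j g) :
    ⇑(evalAt g (unitVec A e₀)) ∈ cochains 𝒜 n j := by
  refine ⟨⟨_, fun _ => rfl⟩, fun d x hx hj => ?_⟩
  refine hg d x (deg e₀) _ hx (unitVec_mem deg e₀) ?_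
  omega

variable (hres : IsMinimalGradedResolution 𝒜 ε I deg e₀ lam)

include hres in
theorem pre_ofCochain {n : ℕ} (F : MultilinearMap k (fun _ : Fin n => Aplus 𝒜) k) :
    pre 𝒜 (resMap k lam 0) (ofCochain ε e₀ F) = 0 := by
  ext x v
  have h : ε (resMap k lam 0 v e₀) = 0 := (hres.exact_zero _).2 ⟨v, rfl⟩
  rw [pre_apply, ofCochain_apply, h, mul_zero, zero_apply]

include hres in
-- By exactness at `P^0` the cokernel of `P^1 → P^0` is `k`, so a cochain that dies on the image of
-- `P^1` is determined by its value at the basis vector.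
theorem apply_eq_of_pre_eq_zero {n : ℕ} {g : ModCochain 𝒜 (I 0 → A) n}
    (hg : pre 𝒜 (resMap k lam 0) g = 0) (x : Fin n → Aplus 𝒜) (v : I 0 → A) :
    g x v = g x (unitVec A e₀) * ε (v e₀) := by
  have h1 : ε ((v - ε (v e₀) • unitVec A e₀) e₀) = 0 := by
    simp [unitVec]
  obtain ⟨w, hw⟩ := (hres.exact_zero _).1 h1
  have h2 := congrArg (fun g => g x w) hg
  simp only [pre_apply, LinearMap.restrictScalars_apply, hw, map_sub, map_smul, zero_apply,
    smul_eq_mul, sub_eq_zero] at h2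
  rw [h2, mul_comm]

theorem res_eq_zero_of_deg_ne : ∀ {n l j : ℕ} (f : ModCochain 𝒜 (I l → A) n),
    IsMinimalGradedResolution 𝒜 ε I deg e₀ lam → IsHomog (deg l) 0 j f →
    ∀ ρ, deg (stepIdx n l) ρ ≠ j → res hε lam n l f ρ = 0
  | 0, l, j, f, _, hf, ρ, h => by
    refine hf (fun _ => 0) default _ _ (fun i => i.elim0) (unitVec_mem (deg l) ρ) ?_
    have h' : deg l ρ ≠ j := h
    simpa using h'
  | n + 1, l, j, f, hres, hf, ρ, h =>
    res_eq_zero_of_deg_ne (n := n) (l := l + 1) _ hres ((hf.S hε).neg.pre (hres.resMap_mem l)) ρ h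

end ModCochain

open ModCochain

variable (hres : IsMinimalGradedResolution 𝒜 ε I deg e₀ lam)

include hε in
-- Multilinearity and the internal degree are inherited from `ModCochain.D` on the free module `A`
-- of rank one; no resolution is involved, and the constant index family `Unit` stands in for one.
theorem barD_mem_cochains {n j : ℕ} {f : BarFun 𝒜 n} (hf : f ∈ cochains 𝒜 n j) :
    barD 𝒜 n f ∈ cochains 𝒜 (n + 1) j := by
  obtain ⟨F, hF⟩ := hf.1
  have hF' : ⇑F = f := funext hF
  let e₀ : (fun _ : ℕ => Unit) 0 := ()
  let g : ModCochain 𝒜 (Unit → A) n := ofCochain (I := fun _ => Unit) ε e₀ F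
  have hg : IsHomog (fun _ : Unit => 0) 0 j g :=
    ofCochain_isHomog (I := fun _ => Unit) hε rfl (hF'.symm ▸ hf)
  have h := evalAt_mem_cochains (I := fun _ => Unit) (e₀ := e₀) rfl hg.D
  convert h using 1
  funext x
  rw [evalAt_apply, D_ofCochain (I := fun _ => Unit) hε, hF']
  simp [unitVec]

/-- The cocycles as bar cochains on `P^0`. -/
noncomputable def cocycleToMod (ε : A →ₐ[k] k) (e₀ : I 0) (n j : ℕ) :
    cocycles 𝒜 n j →ₗ[k] ModCochain 𝒜 (I 0 → A) n where
  toFun f := ofCochain ε e₀ f.2.1.1.choose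
  map_add' f g := by
    ext x v
    have h := fun f : cocycles 𝒜 n j => f.2.1.1.choose_spec x
    rw [ModCochain.add_apply, ofCochain_apply, ofCochain_apply, ofCochain_apply, h, h, h]
    simp [add_mul]
  map_smul' c f := by
    ext x v
    have h := fun f : cocycles 𝒜 n j => f.2.1.1.choose_spec x
    rw [RingHom.id_apply, ModCochain.smul_apply, ofCochain_apply, ofCochain_apply, h, h]
    simp [mul_assoc]

theorem cocycleToMod_apply {n j : ℕ} (f : cocycles 𝒜 n j) (x : Fin n → Aplus 𝒜) (v : I 0 → A) :
    cocycleToMod ε e₀ n j f x v = f.1 x * ε (v e₀) := by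
  rw [← f.2.1.1.choose_spec x]
  rfl

include hε hres in
-- The map `c` is the comparison map on cocycles of `k`. Its three properties state that it induces
-- a bijection from `Ext^{n,j}` onto the functions supported on the basis vectors of degree `j`.
theorem exists_classMap (n j : ℕ) : ∃ c : cocycles 𝒜 n j →ₗ[k] (I n → k),
    (∀ f, c f = 0 ↔ f.1 ∈ coboundaries 𝒜 n j) ∧ (∀ f ρ, deg n ρ ≠ j → c f ρ = 0) ∧
    ∀ φ : I n → k, (∀ ρ, deg n ρ ≠ j → φ ρ = 0) → ∃ f, c f = φ := by
  -- The index `stepIdx n 0` equals `n` only propositionally; a variable `i` makes the target type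
  -- rewritable.
  have key : ∀ i, stepIdx n 0 = i → ∃ c : cocycles 𝒜 n j →ₗ[k] (I i → k),
      (∀ f, c f = 0 ↔ f.1 ∈ coboundaries 𝒜 n j) ∧ (∀ f ρ, deg i ρ ≠ j → c f ρ = 0) ∧
      ∀ φ : I i → k, (∀ ρ, deg i ρ ≠ j → φ ρ = 0) → ∃ f, c f = φ := by
    rintro i rfl
    have hF : ∀ f : cocycles 𝒜 n j, ⇑f.2.1.1.choose = f.1 := fun f => funext f.2.1.1.choose_spec
    have hu : ε (unitVec A e₀ e₀) = 1 := by simp [unitVec]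
    have hj : ∀ f : cocycles 𝒜 n j, IsHomog (deg 0) 0 j (cocycleToMod ε e₀ n j f) := fun f =>
      ofCochain_isHomog hε hres.deg_zero (by rw [hF]; exact f.2.1)
    have hp : ∀ f : cocycles 𝒜 n j, pre 𝒜 (resMap k lam 0) (cocycleToMod ε e₀ n j f) = 0 :=
      fun f => pre_ofCochain hres _
    have hD : ∀ f : cocycles 𝒜 n j, D 𝒜 (cocycleToMod ε e₀ n j f) = 0 := fun f => by
      ext x v
      rw [D_apply_of_eq hε (cocycleToMod_apply f), LinearMap.mem_ker.1 f.2.2]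
      simp
    refine ⟨res hε lam n 0 ∘ₗ cocycleToMod ε e₀ n j, fun f => ?_, fun f ρ hρ => ?_, fun φ hφ => ?_⟩
    · rw [LinearMap.comp_apply]
      match n, f with
      | 0, f =>
        constructor
        · intro h
          have h0 := eq_zero_of_res_zero hε (hD f) h
          refine (Submodule.mem_bot k).2 (funext fun x => ?_)
          have := congrArg (fun g => g x (unitVec A e₀)) h0
          simpa [cocycleToMod_apply, hu] using this
        · intro h
          have : f = 0 := Subtype.ext ((Submodule.mem_bot k).1 h)
          rw [this, map_zero, map_zero]
      | n + 1, f =>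
        constructor
        · intro h
          obtain ⟨g, hg1, hg2, hg3⟩ := exists_D_eq hε hres _ (hj f) (hD f) (hp f) h
          refine ⟨_, evalAt_mem_cochains hres.deg_zero hg1, funext fun x => ?_⟩
          have h1 := D_apply_of_eq hε (F := ⇑(evalAt g (unitVec A e₀)))
            (apply_eq_of_pre_eq_zero hres hg3) x (unitVec A e₀)
          rw [hg2, cocycleToMod_apply, hu, mul_one, mul_one] at h1
          exact h1.symm
        · rintro ⟨h, hh, hhf⟩
          obtain ⟨H, hH⟩ := hh.1
          have h1 : cocycleToMod ε e₀ (n + 1) j f = D 𝒜 (ofCochain ε e₀ H) := by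
            ext x v
            rw [D_ofCochain hε, cocycleToMod_apply, ← hhf, ← funext hH]
          rw [h1, res_D hε hres, pre_ofCochain hres, map_zero]
          rfl
    · exact res_eq_zero_of_deg_ne hε _ hres (hj f) ρ hρ
    · obtain ⟨g, hg1, hg2, hg3, hg4⟩ := exists_res_eq hε hres φ hφ
      have h1 := apply_eq_of_pre_eq_zero hres hg3
      refine ⟨⟨⇑(evalAt g (unitVec A e₀)), evalAt_mem_cochains hres.deg_zero hg1, ?_⟩, ?_⟩
      · change barD 𝒜 n _ = 0
        funext x
        have h2 := D_apply_of_eq hε (F := ⇑(evalAt g (unitVec A e₀))) h1 x (unitVec A e₀)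
        rw [hg2, hu, mul_one] at h2
        exact h2.symm
      · rw [LinearMap.comp_apply, ← hg4]
        congr 1
        ext x v
        rw [cocycleToMod_apply, h1]
        rfl
  exact key n ((stepIdx_eq n 0).trans (by omega))

include hε hres in
/-- A bidegree in which the minimal resolution has no basis vector carries no classes. -/
theorem coboundary_of_deg_ne {n j : ℕ} (h : ∀ ρ, deg n ρ ≠ j) {f : BarFun 𝒜 n}
    (hf : f ∈ cocycles 𝒜 n j) : f ∈ coboundaries 𝒜 n j := by
  obtain ⟨c, hc, hs, -⟩ := exists_classMap hε hres n j
  exact (hc ⟨f, hf⟩).1 (funext fun ρ => hs _ ρ (h ρ))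

include hε hres in
theorem ext_subsingleton_of_deg_ne {n j : ℕ} (h : ∀ ρ, deg n ρ ≠ j) :
    Subsingleton (Ext 𝒜 n j) :=
  Submodule.Quotient.subsingleton_iff.2 (eq_top_iff.2 fun f _ =>
    (show f.1 ∈ coboundaries 𝒜 n j from coboundary_of_deg_ne hε hres h f.2))

include hε hres in
theorem exists_not_coboundary {n : ℕ} (ρ : I n) :
    ∃ f ∈ cocycles 𝒜 n (deg n ρ), f ∉ coboundaries 𝒜 n (deg n ρ) := by
  classical
  obtain ⟨c, hc, -, hs⟩ := exists_classMap hε hres n (deg n ρ)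
  obtain ⟨f, hf⟩ := hs (Pi.single ρ 1) fun σ hσ => by
    rw [Pi.single_apply, if_neg]
    rintro rfl
    exact hσ rfl
  refine ⟨f.1, f.2, fun h => ?_⟩
  have h1 := congrFun ((hc f).2 h) ρ
  rw [hf] at h1
  simp at h1

include hε hres in
theorem ext_nontrivial {n : ℕ} (ρ : I n) : Nontrivial (Ext 𝒜 n (deg n ρ)) := by
  obtain ⟨f, hf, hf'⟩ := exists_not_coboundary hε hres ρ
  refine Submodule.Quotient.nontrivial_iff.2 fun h => hf' ?_
  have : (⟨f, hf⟩ : cocycles 𝒜 n (deg n ρ)) ∈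
      (coboundaries 𝒜 n (deg n ρ)).submoduleOf (cocycles 𝒜 n (deg n ρ)) := h ▸ trivial
  exact this

include hε hres in
theorem exists_generator {n : ℕ} (ρ : I n) (hρ : ∀ σ, deg n σ = deg n ρ → σ = ρ) :
    ∃ f₀ ∈ cocycles 𝒜 n (deg n ρ), ∀ f ∈ cocycles 𝒜 n (deg n ρ), ∃ a : k,
      f - a • f₀ ∈ coboundaries 𝒜 n (deg n ρ) := by
  classical
  obtain ⟨c, hc, hs, hs'⟩ := exists_classMap hε hres n (deg n ρ)
  obtain ⟨f₀, hf₀⟩ := hs' (Pi.single ρ 1) fun σ hσ => by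
    rw [Pi.single_apply, if_neg]
    rintro rfl
    exact hσ rfl
  refine ⟨f₀.1, f₀.2, fun f hf => ⟨c ⟨f, hf⟩ ρ, ?_⟩⟩
  refine (hc (⟨f, hf⟩ - (c ⟨f, hf⟩ ρ) • f₀)).1 (funext fun σ => ?_)
  rw [map_sub, map_smul, hf₀]
  by_cases h : σ = ρ
  · subst h
    simp
  · simp [h, hs _ σ (fun h' => h (hρ σ h'))]

end ExtDim
end QuadExt

namespace QuadExt

/-! ### Products in the Yoneda algebra and its generators -/

section Products

variable {k A : Type*} [Field k] [Ring A] [Algebra k A]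
variable {𝒜 : ℕ → Submodule k A} [GradedAlgebra 𝒜]
variable {ε : A →ₐ[k] k} (hε : ∀ a, ε a = 0 ↔ a ∈ Aplus 𝒜)

/-! #### Multilinear functions and homogeneous arguments -/

include hε in
theorem linearMap_eq_zero_of_homogeneous {V : Type*} [AddCommGroup V] [Module k V]
    (φ : Aplus 𝒜 →ₗ[k] V) (h : ∀ d (a : Aplus 𝒜), (a : A) ∈ 𝒜 d → φ a = 0) : φ = 0 := by
  have key : ∀ a : A, φ (plusPart hε a) = 0 := by
    intro a
    induction a using DirectSum.Decomposition.inductionOn 𝒜 with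
    | zero => simp
    | homogeneous a => exact h _ _ (plusPart_mem hε a.2)
    | add a b ha hb => rw [map_add, map_add, ha, hb, add_zero]
  ext a
  rw [← plusPart_coe hε a, key, LinearMap.zero_apply]

include hε in
theorem multilinear_eq_zero_of_homogeneous {V : Type*} [AddCommGroup V] [Module k V] :
    ∀ {n : ℕ} (F : MultilinearMap k (fun _ : Fin n => Aplus 𝒜) V),
    (∀ (d : Fin n → ℕ) (x : Fin n → Aplus 𝒜), (∀ l, (x l : A) ∈ 𝒜 (d l)) → F x = 0) →
    ∀ x, F x = 0
  | 0, F, h, x => h (fun _ => 0) x fun l => l.elim0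
  | n + 1, F, h, x => by
    have h0 : F.curryLeft = 0 := by
      refine linearMap_eq_zero_of_homogeneous hε _ fun d a ha => MultilinearMap.ext ?_
      refine multilinear_eq_zero_of_homogeneous _ fun d' y hy => ?_
      refine h (Fin.cons d d') (Fin.cons a y) fun l => ?_
      refine Fin.cases ?_ (fun i => ?_) l
      · simpa using ha
      · simpa using hy i
    have h1 := congrArg (fun G => G (x 0) (Fin.tail x)) h0
    simpa using h1

include hε in
theorem cochains_ext {n j j' : ℕ} {f g : BarFun 𝒜 n} (hf : f ∈ cochains 𝒜 n j)
    (hg : g ∈ cochains 𝒜 n j')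
    (h : ∀ (d : Fin n → ℕ) (x : Fin n → Aplus 𝒜), (∀ l, (x l : A) ∈ 𝒜 (d l)) → f x = g x) :
    f = g := by
  obtain ⟨F, hF⟩ := hf.1
  obtain ⟨G, hG⟩ := hg.1
  funext x
  have := multilinear_eq_zero_of_homogeneous hε (F - G) (fun d x hx => by
    change F x - G x = 0
    rw [hF, hG, h d x hx, sub_self]) x
  change F x - G x = 0 at this
  rwa [hF, hG, sub_eq_zero] at this

theorem coe_eq_zero_of_deg_zero {a : Aplus 𝒜} (ha : (a : A) ∈ 𝒜 0) : a = 0 :=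
  Subtype.ext (eq_zero_of_mem_Aplus 𝒜 ha a.2)

include hε in
-- Nonzero homogeneous elements of `A₊` have degree at least one, so `n` of them have total degree
-- at least `n`.
theorem cochains_eq_zero_of_lt {n j : ℕ} (h : j < n) {f : BarFun 𝒜 n}
    (hf : f ∈ cochains 𝒜 n j) : f = 0 := by
  refine cochains_ext hε hf (zero_mem (cochains 𝒜 n j)) fun d x hx => ?_
  by_cases h0 : ∃ l, d l = 0
  · obtain ⟨l, hl⟩ := h0
    obtain ⟨F, hF⟩ := hf.1
    rw [← hF, Pi.zero_apply]
    exact F.map_coord_zero l (coe_eq_zero_of_deg_zero (hl ▸ hx l))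
  · push Not at h0
    refine hf.2 d x hx ?_
    have : ∑ _l : Fin n, 1 ≤ ∑ l, d l := Finset.sum_le_sum fun l _ => Nat.pos_of_ne_zero (h0 l)
    simp at this
    omega

/-! #### The Leibniz rule -/

/-- The sequence in which the entries `j` and `j + 1` are multiplied. -/
def contractSeq {α : Type*} (op : α → α → α) (j : ℕ) (y : ℕ → α) (i : ℕ) : α :=
  if i < j then y i else if i = j then op (y j) (y (j + 1)) else y (i + 1)

theorem barD_seq {n : ℕ} (f : BarFun 𝒜 n) (y : ℕ → Aplus 𝒜) :
    barD 𝒜 n f (fun i => y i) = ∑ j ∈ Finset.range n, (-1 : k) ^ (j + 1) *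
      f (fun i => contractSeq (plusMul 𝒜) j y i) := by
  rw [← Fin.sum_univ_eq_sum_range fun j => (-1 : k) ^ (j + 1) *
      f (fun i => contractSeq (plusMul 𝒜) j y i)]
  simp only [barD, LinearMap.coe_mk, AddHom.coe_mk]
  refine Finset.sum_congr rfl fun j _ => ?_
  congr 2
  funext i
  rcases lt_trichotomy (i : ℕ) j with h | h | h
  · rw [Fin.contractNth_apply_of_lt _ _ _ _ (by simpa using h)]
    simp [contractSeq, h]
  · rw [Fin.contractNth_apply_of_eq _ _ _ _ (by simpa using h)]
    simp [contractSeq, h]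
  · rw [Fin.contractNth_apply_of_gt _ _ _ _ (by simpa using h)]
    simp [contractSeq, not_lt_of_gt h, h.ne']

theorem cup_seq {a b : ℕ} (f : BarFun 𝒜 a) (g : BarFun 𝒜 b) (y : ℕ → Aplus 𝒜) :
    cup 𝒜 f g (fun i => y i) = f (fun i => y i) * g (fun i => y (a + i)) := rfl

/-- The graded Leibniz rule. Evaluating at the initial segment of an infinite sequence avoids
transport between `Fin (a + 1 + b)` and `Fin (a + b + 1)`. -/
theorem barD_cup_seq {a b : ℕ} (f : BarFun 𝒜 a) (g : BarFun 𝒜 b) (y : ℕ → Aplus 𝒜) :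
    barD 𝒜 (a + b) (cup 𝒜 f g) (fun i => y i) =
      barD 𝒜 a f (fun i => y i) * g (fun i => y (a + 1 + i)) +
      (-1) ^ a * (f (fun i => y i) * barD 𝒜 b g (fun i => y (a + i))) := by
  have hg := barD_seq g (fun i => y (a + i))
  rw [barD_seq, barD_seq, hg, Finset.sum_range_add, Finset.sum_mul, Finset.mul_sum, Finset.mul_sum]
  congr 1
  · refine Finset.sum_congr rfl fun j hj => ?_
    rw [Finset.mem_range] at hj
    have h1 : (fun i : Fin b => contractSeq (plusMul 𝒜) j y (a + i)) = fun i : Fin b =>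
        y (a + 1 + i) := by
      funext i
      rw [contractSeq, if_neg (by omega), if_neg (by omega)]
      congr 1
      omega
    have h2 := cup_seq f g (contractSeq (plusMul 𝒜) j y)
    rw [h1] at h2
    rw [h2, mul_assoc]
  · refine Finset.sum_congr rfl fun j hj => ?_
    have h1 : (fun i : Fin a => contractSeq (plusMul 𝒜) (a + j) y i) = fun i : Fin a => y i := by
      funext i
      rw [contractSeq, if_pos (by omega)]
    have h3 : (fun i : Fin b => contractSeq (plusMul 𝒜) (a + j) y (a + i)) = fun i : Fin b =>
        contractSeq (plusMul 𝒜) j (fun i => y (a + i)) i := by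
      funext i
      simp only [contractSeq, Nat.add_lt_add_iff_left, Nat.add_left_cancel_iff, add_assoc]
    have h2 := cup_seq f g (contractSeq (plusMul 𝒜) (a + j) y)
    rw [h1, h3] at h2
    rw [h2]
    ring

theorem barFun_ext_seq {n : ℕ} {f g : BarFun 𝒜 n}
    (h : ∀ y : ℕ → Aplus 𝒜, f (fun i => y i) = g (fun i => y i)) : f = g := by
  funext x
  have hx : x = fun i : Fin n => (fun l : ℕ => if h : l < n then x ⟨l, h⟩ else 0) i := by
    funext i
    simp
  rw [hx]
  exact h fun l : ℕ => if h : l < n then x ⟨l, h⟩ else 0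

theorem cup_mem_cochains {a b i j : ℕ} {f : BarFun 𝒜 a} {g : BarFun 𝒜 b}
    (hf : f ∈ cochains 𝒜 a i) (hg : g ∈ cochains 𝒜 b j) :
    cup 𝒜 f g ∈ cochains 𝒜 (a + b) (i + j) := by
  obtain ⟨F, hF⟩ := hf.1
  obtain ⟨G, hG⟩ := hg.1
  refine ⟨⟨((LinearMap.mul' k k).compMultilinearMap
    (F.domCoprod G)).domDomCongr finSumFinEquiv, fun x => ?_⟩, fun d x hx hd => ?_⟩
  · simp [cup, hF, hG]
  · rw [Fin.sum_univ_add] at hd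
    by_cases h : ∑ l, d (Fin.castAdd b l) = i
    · have h' : ∑ l, d (Fin.natAdd a l) ≠ j := by omega
      rw [cup, hg.2 _ _ (fun l => hx (Fin.natAdd a l)) h', mul_zero]
    · rw [cup, hf.2 _ _ (fun l => hx (Fin.castAdd b l)) h, zero_mul]

theorem cup_mem_cocycles {a b i j : ℕ} {f : BarFun 𝒜 a} {g : BarFun 𝒜 b}
    (hf : f ∈ cocycles 𝒜 a i) (hg : g ∈ cocycles 𝒜 b j) :
    cup 𝒜 f g ∈ cocycles 𝒜 (a + b) (i + j) := by
  refine ⟨cup_mem_cochains hf.1 hg.1, ?_⟩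
  have h1 : barD 𝒜 a f = 0 := hf.2
  have h2 : barD 𝒜 b g = 0 := hg.2
  change barD 𝒜 (a + b) (cup 𝒜 f g) = 0
  refine barFun_ext_seq fun y => ?_
  rw [barD_cup_seq, h1, h2]
  simp

theorem mem_coboundaries_of_seq {p n j : ℕ} (e : p + 1 = n) {h : BarFun 𝒜 p}
    (hh : h ∈ cochains 𝒜 p j) {f : BarFun 𝒜 n}
    (hf : ∀ y : ℕ → Aplus 𝒜, f (fun i => y i) = barD 𝒜 p h (fun i => y i)) :
    f ∈ coboundaries 𝒜 n j := by
  subst e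
  exact ⟨h, hh, barFun_ext_seq fun y => (hf y).symm⟩

theorem cup_coboundary {a b i j : ℕ} {f : BarFun 𝒜 a} {g : BarFun 𝒜 b}
    (hf : f ∈ cocycles 𝒜 a i) (hg : g ∈ coboundaries 𝒜 b j) :
    cup 𝒜 f g ∈ coboundaries 𝒜 (a + b) (i + j) := by
  match b, g, hg with
  | 0, g, hg =>
    rw [(Submodule.mem_bot k).1 hg]
    convert zero_mem (coboundaries 𝒜 (a + 0) (i + j))
    funext x
    simp [cup]
  | b + 1, g, hg =>
    obtain ⟨h, hh, rfl⟩ := hg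
    have h1 : barD 𝒜 a f = 0 := hf.2
    refine mem_coboundaries_of_seq (p := a + b) rfl (h := (-1 : k) ^ a • cup 𝒜 f h)
      (Submodule.smul_mem _ _ (cup_mem_cochains hf.1 hh)) fun y => ?_
    refine (cup_seq f (barD 𝒜 b h) y).trans ?_
    rw [map_smul, Pi.smul_apply, barD_cup_seq, h1, smul_eq_mul]
    simp [← mul_assoc, ← mul_pow]

theorem coboundary_cup {a b i j : ℕ} {f : BarFun 𝒜 a} {g : BarFun 𝒜 b}
    (hf : f ∈ coboundaries 𝒜 a i) (hg : g ∈ cocycles 𝒜 b j) :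
    cup 𝒜 f g ∈ coboundaries 𝒜 (a + b) (i + j) := by
  match a, f, hf with
  | 0, f, hf =>
    rw [(Submodule.mem_bot k).1 hf]
    convert zero_mem (coboundaries 𝒜 (0 + b) (i + j))
    funext x
    simp [cup]
  | a + 1, f, hf =>
    obtain ⟨h, hh, rfl⟩ := hf
    have h1 : barD 𝒜 b g = 0 := hg.2
    refine mem_coboundaries_of_seq (p := a + b) (by omega) (cup_mem_cochains hh hg.1) fun y => ?_
    rw [barD_cup_seq, h1, cup_seq]
    simp

/-! #### Subalgebras generated by classes near the diagonal -/

theorem cup_add_right {a b : ℕ} (f : BarFun 𝒜 a) (g g' : BarFun 𝒜 b) :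
    cup 𝒜 f (g + g') = cup 𝒜 f g + cup 𝒜 f g' := by
  funext x
  simp [cup, mul_add]

theorem cup_mem_iSup_coboundaries {a b i : ℕ} {f : BarFun 𝒜 a} {g : BarFun 𝒜 b}
    (hf : f ∈ cocycles 𝒜 a i) (hg : g ∈ ⨆ j, coboundaries 𝒜 b j) :
    cup 𝒜 f g ∈ ⨆ j, coboundaries 𝒜 (a + b) j := by
  induction hg using Submodule.iSup_induction' with
  | mem j g hg => exact Submodule.mem_iSup_of_mem _ (cup_coboundary hf hg)
  | zero =>
    convert zero_mem (⨆ j, coboundaries 𝒜 (a + b) j)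
    funext x
    simp [cup]
  | add g g' _ _ h h' =>
    rw [cup_add_right]
    exact add_mem h h'

/-- An off-diagonal factor is a coboundary by `hT`, and a product of a coboundary with a cocycle is
a coboundary; diagonal factors multiply to diagonal ones. The supremum over `j` is needed because
`ExtAdjoin` may add coboundaries of several internal degrees. -/
theorem ExtAdjoin.exists_diagonal {T : Set (ℕ × ℕ)}
    (hT : ∀ n j, (n, j) ∈ T → j ≠ n → cocycles 𝒜 n j ≤ coboundaries 𝒜 n j)
    {n : ℕ} {f : BarFun 𝒜 n} (h : ExtAdjoin 𝒜 (classesIn 𝒜 T) n f) :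
    ∃ f₀ ∈ cocycles 𝒜 n n, f - f₀ ∈ ⨆ j, coboundaries 𝒜 n j := by
  induction h with
  | one =>
    refine ⟨fun _ => 1, ⟨⟨⟨MultilinearMap.constOfIsEmpty k _ 1, fun x => rfl⟩, ?_⟩, ?_⟩, ?_⟩
    · intro d x _ hd
      simp at hd
    · exact barD_zero _
    · rw [sub_self]
      exact zero_mem _
  | @mul a b f g hf _ ih =>
    obtain ⟨j, hj, hf⟩ := hf
    obtain ⟨g₀, hg₀, hg⟩ := ih
    have hsplit : cup 𝒜 f g = cup 𝒜 f g₀ + cup 𝒜 f (g - g₀) := by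
      rw [← cup_add_right, add_sub_cancel]
    have h1 := cup_mem_iSup_coboundaries hf hg
    by_cases hja : j = a
    · subst hja
      exact ⟨_, cup_mem_cocycles hf hg₀, by rwa [hsplit, add_sub_cancel_left]⟩
    · refine ⟨0, zero_mem _, ?_⟩
      rw [sub_zero, hsplit]
      exact add_mem (Submodule.mem_iSup_of_mem _ (coboundary_cup (hT a j hj hja hf) hg₀)) h1
  | add _ _ ih ih' =>
    obtain ⟨f₀, hf₀, hf⟩ := ih
    obtain ⟨g₀, hg₀, hg⟩ := ih'
    refine ⟨_, add_mem hf₀ hg₀, ?_⟩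
    rw [add_sub_add_comm]
    exact add_mem hf hg
  | smul c _ ih =>
    obtain ⟨f₀, hf₀, hf⟩ := ih
    refine ⟨_, Submodule.smul_mem _ c hf₀, ?_⟩
    rw [← smul_sub]
    exact Submodule.smul_mem _ c hf
  | @bdry n j h hh =>
    exact ⟨0, zero_mem _, by
      rw [sub_zero]
      exact Submodule.mem_iSup_of_mem j ⟨h, hh, rfl⟩⟩

include hε in
theorem coboundaries_le_cochains (n j : ℕ) : coboundaries 𝒜 n j ≤ cochains 𝒜 n j := by
  match n with
  | 0 => exact bot_le
  | n + 1 =>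
    rintro _ ⟨h, hh, rfl⟩
    exact barD_mem_cochains hε hh

include hε in
-- In a sum of coboundaries of various internal degrees, only the summand of degree `j` is seen on
-- arguments of total degree `j`.
theorem exists_coboundary_component {n : ℕ} (j : ℕ) {f : BarFun 𝒜 n}
    (hf : f ∈ ⨆ j, coboundaries 𝒜 n j) :
    ∃ g ∈ coboundaries 𝒜 n j, ∀ (d : Fin n → ℕ) (x : Fin n → Aplus 𝒜),
      (∀ l, (x l : A) ∈ 𝒜 (d l)) → ∑ l, d l = j → f x = g x := by
  induction hf using Submodule.iSup_induction' with
  | mem i f hf =>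
    by_cases h : i = j
    · subst h
      exact ⟨f, hf, fun _ _ _ _ => rfl⟩
    · exact ⟨0, zero_mem _, fun d x hx hd =>
        (coboundaries_le_cochains hε n i hf).2 d x hx (by rw [hd]; exact fun h' => h h'.symm)⟩
  | zero => exact ⟨0, zero_mem _, fun _ _ _ _ => rfl⟩
  | add f f' _ _ h h' =>
    obtain ⟨g, hg, h⟩ := h
    obtain ⟨g', hg', h'⟩ := h'
    exact ⟨g + g', add_mem hg hg', fun d x hx hd => by
      rw [Pi.add_apply, Pi.add_apply, h d x hx hd, h' d x hx hd]⟩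

include hε in
/-- If all classes in the bidegrees `T` lie on the diagonal, then so do all classes that they
generate. -/
theorem coboundary_of_extGeneratedIn {T : Set (ℕ × ℕ)}
    (hT : ∀ n j, (n, j) ∈ T → j ≠ n → cocycles 𝒜 n j ≤ coboundaries 𝒜 n j)
    (hgen : ExtGeneratedIn 𝒜 T) {n j : ℕ} (hnj : j ≠ n) :
    cocycles 𝒜 n j ≤ coboundaries 𝒜 n j := by
  intro f hf
  obtain ⟨f₀, hf₀, h⟩ := (hgen n j f hf).exists_diagonal hT
  obtain ⟨g, hg, hfg⟩ := exists_coboundary_component hε j h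
  have hg' := coboundaries_le_cochains hε n j hg
  have : f = g := cochains_ext hε hf.1 hg' fun d x hx => by
    by_cases hd : ∑ l, d l = j
    · rw [← hfg d x hx hd, Pi.sub_apply, hf₀.1.2 d x hx (by omega), sub_zero]
    · rw [hf.1.2 d x hx hd, hg'.2 d x hx hd]
  rwa [this]

/-! #### Generators -/

theorem ExtAdjoin.mono {G G' : ∀ n : ℕ, Set (BarFun 𝒜 n)} (hG : ∀ n, G n ⊆ G' n) {n : ℕ}
    {f : BarFun 𝒜 n} (h : ExtAdjoin 𝒜 G n f) : ExtAdjoin 𝒜 G' n f := by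
  induction h with
  | one => exact .one
  | mul hf _ ih => exact .mul (hG _ hf) ih
  | add _ _ ih ih' => exact .add ih ih'
  | smul c _ ih => exact .smul c ih
  | bdry hh => exact .bdry hh

theorem ExtAdjoin.of_coboundary {G : ∀ n : ℕ, Set (BarFun 𝒜 n)} {n j : ℕ}
    {f : BarFun 𝒜 n} (h : f ∈ coboundaries 𝒜 n j) : ExtAdjoin 𝒜 G n f := by
  match n, f, h with
  | 0, f, h =>
    rw [(Submodule.mem_bot k).1 h]
    convert ExtAdjoin.smul (0 : k) (ExtAdjoin.one (𝒜 := 𝒜) (G := G))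
    rw [zero_smul]
  | n + 1, _, ⟨h, hh, rfl⟩ => exact .bdry hh

theorem ExtAdjoin.sum {G : ∀ n : ℕ, Set (BarFun 𝒜 n)} {n : ℕ} {ι : Type*} (s : Finset ι)
    {f : ι → BarFun 𝒜 n} (h : ∀ i, ExtAdjoin 𝒜 G n (f i)) : ExtAdjoin 𝒜 G n (∑ i ∈ s, f i) := by
  classical
  induction s using Finset.induction_on with
  | empty =>
    rw [Finset.sum_empty]
    exact .of_coboundary (zero_mem (coboundaries 𝒜 n 0))
  | insert i s hi ih =>
    rw [Finset.sum_insert hi]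
    exact .add (h i) ih

theorem ExtAdjoin.of_seq {G : ∀ n : ℕ, Set (BarFun 𝒜 n)} {n p : ℕ} (e : p = n)
    {f : BarFun 𝒜 p} (h : ExtAdjoin 𝒜 G p f) {g : BarFun 𝒜 n}
    (hg : ∀ y : ℕ → Aplus 𝒜, g (fun i => y i) = f (fun i => y i)) : ExtAdjoin 𝒜 G n g := by
  subst e
  rwa [barFun_ext_seq hg]

theorem ExtAdjoin.of_mem {G : ∀ n : ℕ, Set (BarFun 𝒜 n)} {n : ℕ} {f : BarFun 𝒜 n}
    (hf : f ∈ G n) : ExtAdjoin 𝒜 G n f := by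
  refine ExtAdjoin.of_seq rfl (ExtAdjoin.mul hf .one) fun y => ?_
  exact (mul_one _).symm

section Diagonal

variable (𝒜) [Module.Finite k (𝒜 1)]

/-- The coordinate functions on `A_1` as linear forms on `A`. -/
noncomputable def coordForm (i : Fin (Module.finrank k (𝒜 1))) : A →ₗ[k] k :=
  (Module.finBasis k (𝒜 1)).coord i ∘ₗ DirectSum.component k ℕ (fun i => 𝒜 i) 1 ∘ₗ
    (DirectSum.decomposeLinearEquiv 𝒜).toLinearMap

theorem coordForm_of_mem (i : Fin (Module.finrank k (𝒜 1))) (a : 𝒜 1) :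
    coordForm 𝒜 i a = (Module.finBasis k (𝒜 1)).repr a i := by
  have : (DirectSum.component k ℕ (fun i => 𝒜 i) 1) (DirectSum.decompose 𝒜 (a : A)) = a := by
    rw [DirectSum.decompose_coe]
    exact DirectSum.component.lof_self k (M := fun i => 𝒜 i) 1 a
  simp only [coordForm, LinearMap.comp_apply, LinearEquiv.coe_coe,
    DirectSum.decomposeLinearEquiv_apply, this, Module.Basis.coord_apply]

theorem coordForm_of_mem_ne (i : Fin (Module.finrank k (𝒜 1))) {d : ℕ} (hd : d ≠ 1) {a : A}
    (ha : a ∈ 𝒜 d) : coordForm 𝒜 i a = 0 := by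
  have : (DirectSum.component k ℕ (fun i => 𝒜 i) 1) (DirectSum.decompose 𝒜 a) = 0 :=
    Subtype.ext (DirectSum.decompose_of_mem_ne 𝒜 ha hd)
  simp only [coordForm, LinearMap.comp_apply, LinearEquiv.coe_coe,
    DirectSum.decomposeLinearEquiv_apply, this, map_zero]

/-- The coordinate functions on `A_1` as cochains. -/
noncomputable def coordCochain (i : Fin (Module.finrank k (𝒜 1))) : BarFun 𝒜 1 :=
  fun x => coordForm 𝒜 i (x 0)

include hε in
theorem coordCochain_mem (i : Fin (Module.finrank k (𝒜 1))) :
    coordCochain 𝒜 i ∈ cocycles 𝒜 1 1 := by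
  have h : coordCochain 𝒜 i ∈ cochains 𝒜 1 1 := by
    refine ⟨⟨(coordForm 𝒜 i ∘ₗ (Aplus 𝒜).subtype).compMultilinearMap
      (MultilinearMap.ofSubsingleton k (Aplus 𝒜) (Aplus 𝒜) (0 : Fin 1) LinearMap.id),
        fun x => rfl⟩, fun d x hx hd => ?_⟩
    exact coordForm_of_mem_ne 𝒜 i (by simpa using hd) (hx 0)
  refine ⟨h, ?_⟩
  change barD 𝒜 1 _ = 0
  exact cochains_eq_zero_of_lt hε one_lt_two (barD_mem_cochains hε h)

/-- The chosen basis of `A_1`, as elements of `A₊`. -/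
noncomputable def basisElt (i : Fin (Module.finrank k (𝒜 1))) : Aplus 𝒜 :=
  ⟨Module.finBasis k (𝒜 1) i, mem_Aplus_of_mem 𝒜 one_ne_zero (Module.finBasis k (𝒜 1) i).2⟩

include hε in
-- With `n + 1` arguments of positive degree and total degree `n + 1`, every argument must have
-- degree one. Hence the first argument enters only through its coordinates in `A_1`.
theorem diagonal_expansion {n : ℕ} {f : BarFun 𝒜 (n + 1)} (hf : f ∈ cochains 𝒜 (n + 1) (n + 1))
    (a : Aplus 𝒜) (x : Fin n → Aplus 𝒜) :
    f (Fin.cons a x) = ∑ i, coordForm 𝒜 i a * f (Fin.cons (basisElt 𝒜 i) x) := by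
  obtain ⟨F, hF⟩ := hf.1
  let Ψ : Aplus 𝒜 →ₗ[k] MultilinearMap k (fun _ : Fin n => Aplus 𝒜) k :=
    F.curryLeft - ∑ i, (coordForm 𝒜 i ∘ₗ (Aplus 𝒜).subtype).smulRight (F.curryLeft (basisElt 𝒜 i))
  have hΨ : ∀ a x, Ψ a x = f (Fin.cons a x) -
      ∑ i, coordForm 𝒜 i a * f (Fin.cons (basisElt 𝒜 i) x) := by
    intro a x
    simp [Ψ, LinearMap.sum_apply, _root_.sum_apply, hF]
  have h0 : Ψ = 0 := by
    refine linearMap_eq_zero_of_homogeneous hε _ fun d a ha => ?_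
    rcases eq_or_ne d 1 with rfl | hd
    · have h1 : a = ∑ i, coordForm 𝒜 i a • basisElt 𝒜 i := by
        have h2 := (Module.finBasis k (𝒜 1)).sum_repr ⟨a, ha⟩
        refine Subtype.ext ?_
        rw [AddSubmonoidClass.coe_finsetSum]
        conv_lhs => rw [show (a : A) = ((⟨a, ha⟩ : 𝒜 1) : A) from rfl, ← h2]
        rw [AddSubmonoidClass.coe_finsetSum]
        exact Finset.sum_congr rfl fun i _ => by
          rw [Submodule.coe_smul, Submodule.coe_smul, ← coordForm_of_mem]
          rfl
      have h3 : ∀ x, F.curryLeft a x = ∑ i, coordForm 𝒜 i a * F.curryLeft (basisElt 𝒜 i) x := by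
        intro x
        conv_lhs => rw [h1, map_sum, _root_.sum_apply]
        exact Finset.sum_congr rfl fun i _ => by rw [map_smul]; rfl
      ext x
      have h4 := h3 x
      simp only [MultilinearMap.curryLeft_apply, hF] at h4
      rw [hΨ, h4, sub_self]
      rfl
    · refine MultilinearMap.ext (multilinear_eq_zero_of_homogeneous hε _ fun d' y hy => ?_)
      rw [hΨ]
      have h1 : ∀ i, coordForm 𝒜 i a = 0 := fun i => coordForm_of_mem_ne 𝒜 i hd ha
      simp only [h1, zero_mul, Finset.sum_const_zero, sub_zero]
      have hall : ∀ l : Fin (n + 1), ((Fin.cons a y : Fin (n + 1) → Aplus 𝒜) l : A) ∈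
          𝒜 ((Fin.cons d d' : Fin (n + 1) → ℕ) l) := fun l => by
        refine Fin.cases ?_ (fun i => ?_) l
        · simpa using ha
        · simpa using hy i
      by_cases h0 : ∃ l, (Fin.cons d d' : Fin (n + 1) → ℕ) l = 0
      · obtain ⟨l, hl⟩ := h0
        rw [← hF]
        exact F.map_coord_zero l (coe_eq_zero_of_deg_zero (hl ▸ hall l))
      · push Not at h0
        refine hf.2 _ _ hall ?_
        have h2 : ∑ _l : Fin n, 1 ≤ ∑ l, d' l :=
          Finset.sum_le_sum fun l _ => Nat.pos_of_ne_zero (by simpa using h0 l.succ)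
        have h3 : d ≠ 0 := by simpa using h0 0
        rw [Fin.sum_univ_succ]
        simp at h2 ⊢
        omega
  have := congrArg (fun G => G a x) h0
  simp only [hΨ, LinearMap.zero_apply, _root_.zero_apply] at this
  exact sub_eq_zero.1 this

include hε in
theorem diagonal_component_mem {n : ℕ} {f : BarFun 𝒜 (n + 1)}
    (hf : f ∈ cochains 𝒜 (n + 1) (n + 1)) (i : Fin (Module.finrank k (𝒜 1))) :
    (fun x => f (Fin.cons (basisElt 𝒜 i) x)) ∈ cochains 𝒜 n n := by
  obtain ⟨F, hF⟩ := hf.1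
  refine ⟨⟨F.curryLeft (basisElt 𝒜 i), fun x => hF _⟩, fun d x hx hd => ?_⟩
  refine hf.2 (Fin.cons 1 d) _ (fun l => ?_) ?_
  · refine Fin.cases ?_ (fun i => ?_) l
    · exact (Module.finBasis k (𝒜 1) i).2
    · simpa using hx i
  · rw [Fin.sum_univ_succ]
    simp only [Fin.cons_zero, Fin.cons_succ]
    omega

include hε in
/-- The diagonal part of the Yoneda algebra is generated by the classes of bidegree `(1, 1)`. -/
theorem extAdjoin_diagonal {G : ∀ n : ℕ, Set (BarFun 𝒜 n)} (hG : ∀ i, coordCochain 𝒜 i ∈ G 1)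
    {n : ℕ} : ∀ {f : BarFun 𝒜 n}, f ∈ cochains 𝒜 n n → ExtAdjoin 𝒜 G n f := by
  induction n with
  | zero =>
    intro f _
    refine ExtAdjoin.of_seq rfl (ExtAdjoin.smul (f default) .one) fun y => ?_
    rw [Subsingleton.elim (fun i : Fin 0 => y i) default]
    exact (mul_one _).symm
  | succ n ih =>
    intro f hf
    -- The expansion is an equality of cochains, so no coboundaries are needed here and nothing is
    -- assumed about `f` being a cocycle.
    have h : ExtAdjoin 𝒜 G (1 + n) (∑ i, cup 𝒜 (coordCochain 𝒜 i)
        (fun x => f (Fin.cons (basisElt 𝒜 i) x))) :=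
      ExtAdjoin.sum _ fun i => .mul (hG i) (ih (diagonal_component_mem 𝒜 hε hf i))
    refine h.of_seq (add_comm 1 n) fun y => ?_
    have h1 : (fun i : Fin (n + 1) => y i) = Fin.cons (y 0) (fun i : Fin n => y (1 + i)) := by
      funext i
      refine Fin.cases rfl (fun i => ?_) i
      rw [Fin.cons_succ, Fin.val_succ, add_comm]
    rw [h1, diagonal_expansion 𝒜 hε hf, Finset.sum_apply]
    rfl

/-- The coordinate cochains and one further cochain. -/
inductive IsGenerator {m : ℕ} (f₀ : BarFun 𝒜 m) : ∀ n : ℕ, BarFun 𝒜 n → Prop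
  | coord (i : Fin (Module.finrank k (𝒜 1))) : IsGenerator f₀ 1 (coordCochain 𝒜 i)
  | extra : IsGenerator f₀ m f₀

theorem finite_isGenerator {m : ℕ} (f₀ : BarFun 𝒜 m) :
    {q : (n : ℕ) × BarFun 𝒜 n | IsGenerator 𝒜 f₀ q.1 q.2}.Finite := by
  refine ((Set.finite_range fun i => (⟨1, coordCochain 𝒜 i⟩ : (n : ℕ) × BarFun 𝒜 n)).union
    (Set.finite_singleton ⟨m, f₀⟩)).subset ?_
  rintro ⟨n, f⟩ (i | _)
  · exact .inl ⟨i, rfl⟩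
  · exact .inr rfl

include hε in
theorem exists_finite_generators {m : ℕ} {f₀ : BarFun 𝒜 m}
    (hf₀ : f₀ ∈ cocycles 𝒜 m (m + 1))
    (h₀ : ∀ f ∈ cocycles 𝒜 m (m + 1), ∃ a : k, f - a • f₀ ∈ coboundaries 𝒜 m (m + 1))
    (h : ∀ n j, j ≠ n → (n, j) ≠ (m, m + 1) → cocycles 𝒜 n j ≤ coboundaries 𝒜 n j) :
    ∃ G : ∀ n : ℕ, Set (BarFun 𝒜 n),
      {q : (n : ℕ) × BarFun 𝒜 n | q.2 ∈ G q.1}.Finite ∧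
      (∀ n, G n ⊆ classesIn 𝒜 {(1, 1), (m, m + 1)} n) ∧ GeneratesExt 𝒜 G := by
  refine ⟨fun n => {f | IsGenerator 𝒜 f₀ n f}, finite_isGenerator 𝒜 f₀, ?_, ?_⟩
  · rintro n f (i | _)
    · exact ⟨1, .inl rfl, coordCochain_mem 𝒜 hε i⟩
    · exact ⟨_, .inr rfl, hf₀⟩
  · intro n j f hf
    by_cases hnj : j = n
    · subst hnj
      exact extAdjoin_diagonal 𝒜 hε (fun i => .coord i) hf.1
    · by_cases hm : (n, j) = (m, m + 1)
      · simp only [Prod.mk.injEq] at hm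
        obtain ⟨rfl, rfl⟩ := hm
        obtain ⟨a, ha⟩ := h₀ f hf
        have := ExtAdjoin.add (G := fun n => {f | IsGenerator 𝒜 f₀ n f})
          (.of_coboundary ha) (.smul a (.of_mem (f := f₀) .extra))
        rwa [sub_add_cancel] at this
      · exact .of_coboundary (h n j hnj hm hf)

end Diagonal

end Products
end QuadExt

namespace QuadExt

/-! ### Sums over the labels of basis vectors -/

section Labels

variable {m : ℕ}

/-- The labels as a disjoint union. -/
def Lab.equivSum (m : ℕ) : Lab m ≃ (Unit ⊕ Fin 2 ⊕ Fin 3 ⊕ Fin 3 ⊕ Unit ⊕ Unit) ⊕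
    Fin m ⊕ Fin m ⊕ Fin m ⊕ Fin 3 ⊕ Fin 6 ⊕ Unit where
  toFun
    | .unit => .inl (.inl ())
    | .N c => .inl (.inr (.inl c))
    | .P c => .inl (.inr (.inr (.inl c)))
    | .S c => .inl (.inr (.inr (.inr (.inl c))))
    | .v => .inl (.inr (.inr (.inr (.inr (.inl ())))))
    | .w => .inl (.inr (.inr (.inr (.inr (.inr ())))))
    | .x i => .inr (.inl i)
    | .y i => .inr (.inr (.inl i))
    | .z i => .inr (.inr (.inr (.inl i)))
    | .a c => .inr (.inr (.inr (.inr (.inl c))))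
    | .b c => .inr (.inr (.inr (.inr (.inr (.inl c)))))
    | .top => .inr (.inr (.inr (.inr (.inr (.inr ())))))
  invFun
    | .inl (.inl ()) => .unit
    | .inl (.inr (.inl c)) => .N c
    | .inl (.inr (.inr (.inl c))) => .P c
    | .inl (.inr (.inr (.inr (.inl c)))) => .S c
    | .inl (.inr (.inr (.inr (.inr (.inl ()))))) => .v
    | .inl (.inr (.inr (.inr (.inr (.inr ()))))) => .w
    | .inr (.inl i) => .x i
    | .inr (.inr (.inl i)) => .y i
    | .inr (.inr (.inr (.inl i))) => .z i
    | .inr (.inr (.inr (.inr (.inl c)))) => .a c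
    | .inr (.inr (.inr (.inr (.inr (.inl c))))) => .b c
    | .inr (.inr (.inr (.inr (.inr (.inr ()))))) => .top
  left_inv l := by cases l <;> rfl
  right_inv l := by
    rcases l with (_ | _ | _ | _ | _ | _) | _ | _ | _ | _ | _ | _ <;> rfl

theorem Lab.sum_eq {M : Type*} [AddCommMonoid M] (F : Lab m → M) :
    ∑ l, F l = (F .unit + (∑ c, F (.N c) + (∑ c, F (.P c) + (∑ c, F (.S c) + (F .v + F .w))))) +
      (∑ i, F (.x i) + (∑ i, F (.y i) + (∑ i, F (.z i) + (∑ c, F (.a c) +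
        (∑ c, F (.b c) + F .top))))) := by
  rw [← Equiv.sum_comp (Lab.equivSum m).symm]
  simp only [Fintype.sum_sum_type, Finset.univ_unique, Finset.sum_singleton]
  rfl

/-- The extension of a function on the basis of `P^j` to all labels by zero. -/
noncomputable def extLab {M : Type*} [Zero M] {j : ℕ} (v : Idx m j → M) (l : Lab m) : M :=
  open scoped Classical in if h : l.Mem m j then v ⟨l, h⟩ else 0

theorem extLab_of_mem {M : Type*} [Zero M] {j : ℕ} (v : Idx m j → M) {l : Lab m}
    (h : l.Mem m j) : extLab v l = v ⟨l, h⟩ := dif_pos h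

theorem extLab_of_not_mem {M : Type*} [Zero M] {j : ℕ} (v : Idx m j → M) {l : Lab m}
    (h : ¬ l.Mem m j) : extLab v l = 0 := dif_neg h

theorem sum_idx {M : Type*} [AddCommMonoid M] {j : ℕ} (F : Idx m j → M) :
    ∑ ρ, F ρ = ∑ l, extLab F l := by
  classical
  refine Finset.sum_of_injOn Subtype.val Subtype.val_injective.injOn (by simp) ?_ ?_
  · intro l _ hl
    refine extLab_of_not_mem F fun h => hl ⟨⟨l, h⟩, by simp, rfl⟩
  · intro ρ _
    rw [extLab_of_mem F ρ.2]

theorem sum_idx_mul {R : Type*} [Ring R] {j : ℕ} (v : Idx m j → R) (G : Lab m → R) :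
    ∑ ρ, v ρ * G ρ.1 = ∑ l, extLab v l * G l := by
  rw [sum_idx]
  refine Finset.sum_congr rfl fun l _ => ?_
  by_cases h : l.Mem m j
  · rw [extLab_of_mem _ h, extLab_of_mem _ h]
  · rw [extLab_of_not_mem _ h, extLab_of_not_mem _ h, zero_mul]

/-- The value of a function on labels at the label with a given subscript. -/
def atIdx {M : Type*} [Zero M] (F : Fin m → M) (i : ℕ) : M := if h : i < m then F ⟨i, h⟩ else 0

theorem sum_mul_ite_succ {R : Type*} [Ring R] (F : Fin m → R) (G : ℕ → R) {i' : ℕ}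
    (h1 : 1 ≤ i') (h2 : i' ≤ m) :
    ∑ i : Fin m, F i * (if i' = (i : ℕ) + 1 then G i else 0) =
      atIdx F (i' - 1) * G (i' - 1) := by
  have h : i' - 1 < m := by omega
  rw [Finset.sum_eq_single ⟨i' - 1, h⟩]
  · rw [if_pos (by simp; omega), atIdx, dif_pos h]
  · intro i _ hi
    rw [if_neg, mul_zero]
    intro h'
    exact hi (Fin.ext (by simp; omega))
  · simp

theorem sum_ite_smul {R M : Type*} [Ring R] [AddCommGroup M] [Module R M] (F : Fin m → M) (a : R)
    {c : ℕ} (h : c < m) :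
    ∑ i : Fin m, (if (i : ℕ) = c then a else 0) • F i = a • F ⟨c, h⟩ := by
  rw [Finset.sum_eq_single ⟨c, h⟩]
  · simp
  · intro i _ hi
    rw [if_neg, zero_smul]
    exact fun h' => hi (Fin.ext h')
  · simp

end Labels

/-! ### The defining relations as equations in `C` -/

section Relations

variable (k : Type*) [Field k] (m : ℕ)

theorem mk_fr (g : Gen m) : RingQuot.mkAlgHom k (Rel k m) (fr k m g) = gen k m g := rfl

theorem nq : gen k m .n * gen k m .q = gen k m .n * gen k m .p := by
  simpa [mk_fr] using (RingQuot.mkAlgHom_rel k (Rel.np_nq (k := k) (m := m))).symm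

theorem nr : gen k m .n * gen k m .r = gen k m .n * gen k m .p := by
  simpa [mk_fr] using (RingQuot.mkAlgHom_rel k (Rel.np_nr (k := k) (m := m))).symm

theorem pt : gen k m .p * gen k m .t = gen k m .p * gen k m .s := by
  simpa [mk_fr] using (RingQuot.mkAlgHom_rel k (Rel.ps_pt (k := k) (m := m))).symm

theorem qu : gen k m .q * gen k m .u = gen k m .q * gen k m .t := by
  simpa [mk_fr] using (RingQuot.mkAlgHom_rel k (Rel.qt_qu (k := k) (m := m))).symm

theorem ru : gen k m .r * gen k m .u = gen k m .r * gen k m .s := by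
  simpa [mk_fr] using (RingQuot.mkAlgHom_rel k (Rel.rs_ru (k := k) (m := m))).symm

theorem sw : gen k m .s * gen k m .w = gen k m .s * gen k m .v := by
  simpa [mk_fr] using (RingQuot.mkAlgHom_rel k (Rel.sv_sw (k := k) (m := m))).symm

variable {m}

theorem genX_eq {i : ℕ} (h : 1 ≤ i ∧ i + 2 ≤ m) : genX k m i = gen k m (.x i h) := dif_pos h

theorem genY_eq {i : ℕ} (h : 1 ≤ i ∧ i + 3 ≤ m) : genY k m i = gen k m (.y i h) := dif_pos h

theorem genZ_eq {i : ℕ} (h : 1 ≤ i ∧ i + 4 ≤ m) : genZ k m i = gen k m (.z i h) := dif_pos h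

@[simp] theorem genX_zero : genX k m 0 = 0 := dif_neg (by omega)

@[simp] theorem genY_zero : genY k m 0 = 0 := dif_neg (by omega)

@[simp] theorem genZ_zero : genZ k m 0 = 0 := dif_neg (by omega)

theorem genZ_eq_zero {i : ℕ} (h : ¬ i + 4 ≤ m) : genZ k m i = 0 := dif_neg (by omega)

theorem tx (hm : 3 ≤ m) : gen k m .t * genX k m 1 = gen k m .t * gen k m .w := by
  rw [genX_eq k (i := 1) (by omega)]
  simpa [mk_fr] using (RingQuot.mkAlgHom_rel k (Rel.tw_tx (k := k) (m := m) (by omega))).symm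

theorem ux (hm : 3 ≤ m) : gen k m .u * genX k m 1 = gen k m .u * gen k m .v := by
  rw [genX_eq k (i := 1) (by omega)]
  simpa [mk_fr] using (RingQuot.mkAlgHom_rel k (Rel.uv_ux (k := k) (m := m) (by omega))).symm

theorem sy (hm : 4 ≤ m) : gen k m .s * genY k m 1 = gen k m .s * gen k m .v := by
  rw [genY_eq k (i := 1) (by omega)]
  simpa [mk_fr] using (RingQuot.mkAlgHom_rel k (Rel.sv_sy (k := k) (m := m) (by omega))).symm

theorem ty (hm : 4 ≤ m) : gen k m .t * genY k m 1 = gen k m .t * gen k m .w := by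
  rw [genY_eq k (i := 1) (by omega)]
  simpa [mk_fr] using (RingQuot.mkAlgHom_rel k (Rel.tw_ty (k := k) (m := m) (by omega))).symm

theorem uy (hm : 4 ≤ m) : gen k m .u * genY k m 1 = gen k m .u * gen k m .v := by
  rw [← ux k (by omega), genY_eq k (i := 1) (by omega), genX_eq k (i := 1) (by omega)]
  simpa [mk_fr] using
    (RingQuot.mkAlgHom_rel k (Rel.ux_uy (k := k) (m := m) (by omega) (by omega))).symm

theorem sz : gen k m .s * genZ k m 1 = 0 := by
  by_cases h : 1 + 4 ≤ m
  · rw [genZ_eq k (i := 1) ⟨le_rfl, h⟩]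
    simpa [mk_fr] using RingQuot.mkAlgHom_rel k (Rel.sz (k := k) (m := m) ⟨le_rfl, h⟩)
  · rw [genZ_eq_zero k h, mul_zero]

theorem tz : gen k m .t * genZ k m 1 = 0 := by
  by_cases h : 1 + 4 ≤ m
  · rw [genZ_eq k (i := 1) ⟨le_rfl, h⟩]
    simpa [mk_fr] using RingQuot.mkAlgHom_rel k (Rel.tz (k := k) (m := m) ⟨le_rfl, h⟩)
  · rw [genZ_eq_zero k h, mul_zero]

theorem uz : gen k m .u * genZ k m 1 = 0 := by
  by_cases h : 1 + 4 ≤ m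
  · rw [genZ_eq k (i := 1) ⟨le_rfl, h⟩]
    simpa [mk_fr] using RingQuot.mkAlgHom_rel k (Rel.uz (k := k) (m := m) ⟨le_rfl, h⟩)
  · rw [genZ_eq_zero k h, mul_zero]

theorem vx : gen k m .v * genX k m 2 = 0 := by
  by_cases h : 2 + 2 ≤ m
  · rw [genX_eq k (i := 2) ⟨one_le_two, h⟩]
    simpa [mk_fr] using RingQuot.mkAlgHom_rel k (Rel.vx (k := k) (m := m) ⟨one_le_two, h⟩)
  · rw [genX, dif_neg (by omega), mul_zero]

theorem wx : gen k m .w * genX k m 2 = 0 := by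
  by_cases h : 2 + 2 ≤ m
  · rw [genX_eq k (i := 2) ⟨one_le_two, h⟩]
    simpa [mk_fr] using RingQuot.mkAlgHom_rel k (Rel.wx (k := k) (m := m) ⟨one_le_two, h⟩)
  · rw [genX, dif_neg (by omega), mul_zero]

theorem xx (i : ℕ) : genX k m i * genX k m (i + 1) = 0 := by
  by_cases h : 1 ≤ i ∧ i + 1 + 2 ≤ m
  · have h1 : 1 ≤ i ∧ i + 2 ≤ m := by omega
    have h2 : 1 ≤ i + 1 ∧ i + 1 + 2 ≤ m := by omega
    rw [genX_eq k h1, genX_eq k h2]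
    simpa [mk_fr] using RingQuot.mkAlgHom_rel k (Rel.xx (k := k) (m := m) i h1 h2)
  · rcases not_and_or.1 h with h | h
    · rw [genX, dif_neg (by omega), zero_mul]
    · rw [genX, genX, dif_neg (c := 1 ≤ i + 1 ∧ _) (by omega), mul_zero]

theorem zz (i : ℕ) : genZ k m i * genZ k m (i + 1) = 0 := by
  by_cases h : 1 ≤ i ∧ i + 1 + 4 ≤ m
  · have h1 : 1 ≤ i ∧ i + 4 ≤ m := by omega
    have h2 : 1 ≤ i + 1 ∧ i + 1 + 4 ≤ m := by omega
    rw [genZ_eq k h1, genZ_eq k h2]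
    simpa [mk_fr] using RingQuot.mkAlgHom_rel k (Rel.zz (k := k) (m := m) i h1 h2)
  · rcases not_and_or.1 h with h | h
    · rw [genZ, dif_neg (by omega), zero_mul]
    · rw [genZ, genZ, dif_neg (c := 1 ≤ i + 1 ∧ _) (by omega), mul_zero]

theorem zy {i : ℕ} (h : i + 4 ≤ m) :
    genZ k m i * genY k m (i + 1) = - (genY k m i * genX k m (i + 1)) := by
  rcases Nat.eq_zero_or_pos i with rfl | hi
  · simp
  · have h1 : 1 ≤ i ∧ i + 3 ≤ m := by omega
    have h2 : 1 ≤ i + 1 ∧ i + 1 + 2 ≤ m := by omega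
    have h3 : 1 ≤ i ∧ i + 4 ≤ m := by omega
    have h4 : 1 ≤ i + 1 ∧ i + 1 + 3 ≤ m := by omega
    rw [genZ_eq k h3, genY_eq k h4, genX_eq k h2, genY_eq k h1, eq_neg_iff_add_eq_zero, add_comm]
    simpa [mk_fr] using RingQuot.mkAlgHom_rel k (Rel.yx_zy (k := k) (m := m) i h1 h2 h3 h4)

theorem npt : gen k m .n * gen k m .p * gen k m .t = gen k m .n * gen k m .p * gen k m .s := by
  rw [mul_assoc, pt, mul_assoc]

/-- Passing through `nq` replaces `u` by `t`. With `npt`, all of `nps`, `npt`, `npu` agree, which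
makes the row of degree `m + 1` a cycle. -/
theorem npu : gen k m .n * gen k m .p * gen k m .u = gen k m .n * gen k m .p * gen k m .s := by
  rw [← nq, mul_assoc, qu, ← mul_assoc, nq, npt]

end Relations

/-! ### Columns of the matrices `λ_j` -/

section Columns

variable {k : Type*} [Field k] {m : ℕ}

/-- The column sums of the matrix `λ_j` with coefficients `W`. -/
noncomputable def colSum (k : Type*) [Field k] {m : ℕ} (j : ℕ) (W : Lab m → C k m) (σ : Lab m) :
    C k m :=
  ∑ ρ, W ρ * lamEntry k m j ρ σ

variable (j : ℕ) (W : Lab m → C k m)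

theorem colSum_unit : colSum k j W .unit = 0 := by
  simp [colSum, lamEntry]

theorem colSum_N (c : Fin 2) : colSum k j W (.N c) = 0 := by
  simp [colSum, lamEntry]

theorem colSum_a (c : Fin 3) : colSum k j W (.a c) = 0 := by
  simp [colSum, lamEntry]

theorem colSum_top : colSum k j W .top = 0 := by
  simp [colSum, lamEntry]

theorem colSum_P_two (d : Fin 3) :
    colSum k 2 W (.P d) = ∑ c, W (.N c) * etaTwo k m c d := by
  simp [colSum, Lab.sum_eq, lamEntry]

theorem colSum_P (hj : j ≠ 2) (d : Fin 3) :
    colSum k j W (.P d) = (W (.N 0) + W (.N 1)) * eta k m d := by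
  simp [colSum, Lab.sum_eq, lamEntry, hj, add_mul]

theorem colSum_S (d : Fin 3) : colSum k j W (.S d) = ∑ c, W (.P c) * delta k m c d := by
  simp [colSum, Lab.sum_eq, lamEntry]

theorem colSum_b (d : Fin 6) :
    colSum k j W (.b d) = ∑ c, W (.a c) * alpha k m c d + W .top * topRow k m d := by
  simp [colSum, Lab.sum_eq, lamEntry]

theorem colSum_v : colSum k j W .v = ∑ c, W (.b c) * beta k m c 0 := by
  simp [colSum, Lab.sum_eq, lamEntry]

theorem colSum_w : colSum k j W .w = ∑ c, W (.b c) * beta k m c 1 := by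
  simp [colSum, Lab.sum_eq, lamEntry]

theorem colSum_z (i : Fin m) (hi : 1 ≤ (i : ℕ)) :
    colSum k j W (.z i) = (if (i : ℕ) = 1 then ∑ c, W (.S c) * epsilon k m c else 0) +
      atIdx (fun i => W (.z i)) (i - 1) * genZ k m (i - 1) := by
  rw [← sum_mul_ite_succ (fun i => W (.z i)) (genZ k m) hi i.2.le]
  simp only [colSum, Lab.sum_eq, lamEntry, mul_zero, Finset.sum_const_zero, zero_add, add_zero]
  congr 1
  split_ifs <;> simp

theorem colSum_y (i : Fin m) (hi : 1 ≤ (i : ℕ)) :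
    colSum k j W (.y i) = (if (i : ℕ) = 1 then ∑ c, W (.b c) * beta k m c 3 else 0) +
      atIdx (fun i => W (.y i)) (i - 1) * genZ k m (i - 1) := by
  rw [← sum_mul_ite_succ (fun i => W (.y i)) (genZ k m) hi i.2.le, add_comm]
  simp only [colSum, Lab.sum_eq, lamEntry, mul_zero, Finset.sum_const_zero, zero_add, add_zero]
  congr 1
  split_ifs <;> simp

theorem colSum_x (i : Fin m) (hi : 1 ≤ (i : ℕ)) :
    colSum k j W (.x i) = (if (i : ℕ) = 1 then ∑ c, W (.b c) * beta k m c 2 else 0) +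
      (if (i : ℕ) = 2 then W .v * gen k m .v + W .w * gen k m .w else 0) +
      atIdx (fun i => W (.x i)) (i - 1) * genX k m (i - 1) +
      atIdx (fun i => W (.y i)) (i - 1) * genY k m (i - 1) := by
  rw [← sum_mul_ite_succ (fun i => W (.y i)) (genY k m) hi i.2.le,
    ← sum_mul_ite_succ (fun i => W (.x i)) (genX k m) hi i.2.le]
  have h1 : (if (i : ℕ) = 1 then ∑ c, W (.b c) * beta k m c 2 else 0) =
      ∑ c, W (.b c) * (if (i : ℕ) = 1 then beta k m c 2 else 0) := by
    split_ifs <;> simp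
  have h2 : (if (i : ℕ) = 2 then W .v * gen k m .v + W .w * gen k m .w else 0) =
      W .v * (if (i : ℕ) = 2 then gen k m .v else 0) +
        W .w * (if (i : ℕ) = 2 then gen k m .w else 0) := by
    split_ifs <;> simp
  rw [h1, h2]
  simp only [colSum, Lab.sum_eq, lamEntry, mul_zero, Finset.sum_const_zero, zero_add, add_zero]
  abel

end Columns

/-! ### Generators and the basis of `P^1` -/

section Generators

variable {m : ℕ}

/-- The label of a generator. -/
def Gen.lab : Gen m → Lab m
  | .n => .N 0
  | .p => .P 0
  | .q => .P 1
  | .r => .P 2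
  | .s => .S 0
  | .t => .S 1
  | .u => .S 2
  | .v => .v
  | .w => .w
  | .x i h => .x ⟨i, by omega⟩
  | .y i h => .y ⟨i, by omega⟩
  | .z i h => .z ⟨i, by omega⟩

theorem Gen.lab_mem (hm : 3 ≤ m) (g : Gen m) : g.lab.Mem m 1 := by
  cases g <;> simp [Gen.lab, Lab.Mem] <;> omega

theorem Gen.lab_injective : Function.Injective (Gen.lab (m := m)) := by
  intro g g' h
  cases g <;> cases g' <;> simp [Gen.lab] at h ⊢ <;> exact h

theorem Gen.exists_lab {l : Lab m} (h : l.Mem m 1) (hm : 3 ≤ m) : ∃ g : Gen m, g.lab = l := by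
  cases l with
  | unit => simp [Lab.Mem] at h
  | N c =>
    fin_cases c
    · exact ⟨.n, rfl⟩
    · simp [Lab.Mem] at h
  | P c =>
    fin_cases c
    exacts [⟨.p, rfl⟩, ⟨.q, rfl⟩, ⟨.r, rfl⟩]
  | S c =>
    fin_cases c
    exacts [⟨.s, rfl⟩, ⟨.t, rfl⟩, ⟨.u, rfl⟩]
  | v => exact ⟨.v, rfl⟩
  | w => exact ⟨.w, rfl⟩
  | x i => exact ⟨.x i (by simp [Lab.Mem] at h; omega), rfl⟩
  | y i => exact ⟨.y i (by simp [Lab.Mem] at h; omega), rfl⟩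
  | z i => exact ⟨.z i (by simp [Lab.Mem] at h; omega), rfl⟩
  | a c => simp [Lab.Mem] at h
  | b c => simp [Lab.Mem] at h
  | top =>
    simp [Lab.Mem] at h
    omega

instance : Finite (Gen m) := Finite.of_injective _ Gen.lab_injective

theorem lamOne_lab (k : Type*) [Field k] (g : Gen m) : lamOne k m g.lab = gen k m g := by
  cases g with
  | x i h => exact genX_eq k h
  | y i h => exact genY_eq k h
  | z i h => exact genZ_eq k h
  | _ => rfl

/-- The basis vector of `P^1` that belongs to a generator. -/
def Gen.idx (hm : 3 ≤ m) (g : Gen m) : Idx m 1 := ⟨g.lab, g.lab_mem hm⟩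

theorem Gen.exists_idx (hm : 3 ≤ m) (ρ : Idx m 1) : ∃ g : Gen m, g.idx hm = ρ := by
  obtain ⟨g, hg⟩ := Gen.exists_lab ρ.2 hm
  exact ⟨g, Subtype.ext hg⟩

end Generators

end QuadExt

namespace QuadExt

/-! ### Degrees of the matrix entries -/

section Entries

variable (k : Type*) [Field k] {m : ℕ}

theorem gen_mem (g : Gen m) : gen k m g ∈ gradeC k m 1 := by
  rw [gradeC, quotGrade, pow_one]
  exact Submodule.subset_span ⟨g, rfl⟩

theorem genX_mem (i : ℕ) : genX k m i ∈ gradeC k m 1 := by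
  unfold genX
  split_ifs
  · exact gen_mem k _
  · exact zero_mem _

theorem genY_mem (i : ℕ) : genY k m i ∈ gradeC k m 1 := by
  unfold genY
  split_ifs
  · exact gen_mem k _
  · exact zero_mem _

theorem genZ_mem (i : ℕ) : genZ k m i ∈ gradeC k m 1 := by
  unfold genZ
  split_ifs
  · exact gen_mem k _
  · exact zero_mem _

theorem lamOne_mem (l : Lab m) : lamOne k m l ∈ gradeC k m 1 := by
  cases l with
  | P c => fin_cases c <;> exact gen_mem k _
  | S c => fin_cases c <;> exact gen_mem k _
  | x i => exact genX_mem k _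
  | y i => exact genY_mem k _
  | z i => exact genZ_mem k _
  | N c => exact gen_mem k _
  | v => exact gen_mem k _
  | w => exact gen_mem k _
  | _ => exact zero_mem _

theorem etaTwo_mem (c : Fin 2) (d : Fin 3) : etaTwo k m c d ∈ gradeC k m 1 := by
  fin_cases c <;> fin_cases d <;> simp [etaTwo, gen_mem]

theorem eta_mem (d : Fin 3) : eta k m d ∈ gradeC k m 1 := by
  fin_cases d <;> simp [eta, gen_mem]

theorem delta_mem (c d : Fin 3) : delta k m c d ∈ gradeC k m 1 := by
  fin_cases c <;> fin_cases d <;> simp [delta, gen_mem]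

theorem epsilon_mem (d : Fin 3) : epsilon k m d ∈ gradeC k m 1 := by
  fin_cases d <;> simp [epsilon, gen_mem]

theorem alpha_mem (c : Fin 3) (d : Fin 6) : alpha k m c d ∈ gradeC k m 1 := by
  fin_cases c <;> fin_cases d <;> simp [alpha, gen_mem]

theorem beta_mem (c : Fin 6) (d : Fin 4) : beta k m c d ∈ gradeC k m 1 := by
  fin_cases c <;> fin_cases d <;> simp [beta, gen_mem]

theorem topRow_mem (d : Fin 6) : topRow k m d ∈ gradeC k m 2 := by
  have h : gen k m .n * gen k m .p ∈ gradeC k m 2 :=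
    SetLike.GradedMul.mul_mem (gen_mem k _) (gen_mem k _)
  fin_cases d <;> simp [topRow, h]

theorem lamEntry_mem (j : ℕ) {ρ : Lab m} (hρ : ρ ≠ .top) (σ : Lab m) :
    lamEntry k m j ρ σ ∈ gradeC k m 1 := by
  cases ρ <;> cases σ <;> try exact zero_mem _
  all_goals
    simp only [lamEntry]
    try split_ifs
  all_goals
    first
    | exact zero_mem _
    | exact etaTwo_mem k _ _
    | exact eta_mem k _
    | exact delta_mem k _ _
    | exact epsilon_mem k _
    | exact genX_mem k _
    | exact genY_mem k _
    | exact genZ_mem k _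
    | exact alpha_mem k _ _
    | exact beta_mem k _ _
    | exact gen_mem k _
    | exact absurd rfl hρ

theorem lamEntry_top_right (j : ℕ) (ρ : Lab m) : lamEntry k m j ρ .top = 0 := by
  cases ρ <;> rfl

theorem lamEntry_top_left (j : ℕ) (σ : Lab m) :
    lamEntry k m j .top σ ∈ gradeC k m 2 := by
  cases σ <;> first | exact topRow_mem k _ | exact zero_mem _

theorem deg_of_ne_top {j : ℕ} {l : Lab m} (h : l ≠ .top) : l.deg m j = j := by
  cases l <;> first | rfl | exact absurd rfl h

theorem lam_homogeneous (hm : 3 ≤ m) (i : ℕ) (ρ : Idx m (i + 1)) (σ : Idx m i) :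
    lam k m i ρ σ = 0 ∨ ∃ d, d ≠ 0 ∧ ρ.1.deg m (i + 1) = σ.1.deg m i + d ∧
      lam k m i ρ σ ∈ gradeC k m d := by
  match i, ρ, σ with
  | 0, ρ, σ =>
    refine .inr ⟨1, one_ne_zero, ?_, lamOne_mem k ρ.1⟩
    rw [deg_of_ne_top (l := ρ.1), deg_of_ne_top (l := σ.1)]
    · intro h
      have := σ.2
      rw [h] at this
      simp [Lab.Mem] at this
      omega
    · intro h
      have := ρ.2
      rw [h] at this
      simp [Lab.Mem] at this
      omega
  | i + 1, ρ, σ =>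
    by_cases hσ : σ.1 = .top
    · left
      change lamEntry k m (i + 2) ρ.1 σ.1 = 0
      rw [hσ, lamEntry_top_right]
    by_cases hρ : ρ.1 = .top
    · right
      refine ⟨2, two_ne_zero, ?_, ?_⟩
      · have := ρ.2
        rw [hρ] at this ⊢
        simp only [Lab.Mem] at this
        rw [deg_of_ne_top hσ]
        simp only [Lab.deg]
        omega
      · change lamEntry k m (i + 2) ρ.1 σ.1 ∈ _
        rw [hρ]
        exact lamEntry_top_left k _ _
    · right
      refine ⟨1, one_ne_zero, ?_, lamEntry_mem k _ hρ _⟩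
      rw [deg_of_ne_top hσ, deg_of_ne_top hρ]

end Entries

/-! ### The augmentation of `C` and exactness at `P^0` -/

section Augmentation

variable (k : Type*) [Field k] {m : ℕ}

theorem augC_gen (g : Gen m) : augC k m (gen k m g) = 0 := by
  simp [augC, gen]

/-- The elements of a free algebra quotient are reached from scalars and generators. -/
theorem C_induction {P : C k m → Prop} (h0 : ∀ c : k, P (algebraMap k _ c))
    (h1 : ∀ g, P (gen k m g)) (hadd : ∀ a b, P a → P b → P (a + b))
    (hmul : ∀ a b, P a → P b → P (a * b)) (a : C k m) : P a := by
  obtain ⟨x, rfl⟩ := RingQuot.mkAlgHom_surjective k (Rel k m) a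
  induction x using FreeAlgebra.induction with
  | grade0 c => rw [AlgHom.commutes]; exact h0 c
  | grade1 g => exact h1 g
  | mul a b ha hb => rw [map_mul]; exact hmul _ _ ha hb
  | add a b ha hb => rw [map_add]; exact hadd _ _ ha hb

theorem sub_augC_mem (a : C k m) :
    a - algebraMap k _ (augC k m a) ∈ Submodule.span (C k m) (Set.range (gen k m)) := by
  induction a using C_induction with
  | h0 c => simp
  | h1 g =>
    rw [augC_gen, map_zero, sub_zero]
    exact Submodule.subset_span ⟨g, rfl⟩
  | hadd a b ha hb =>
    rw [map_add, map_add, add_sub_add_comm]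
    exact add_mem ha hb
  | hmul a b ha hb =>
    have : a * b - algebraMap k _ (augC k m (a * b)) =
        a • (b - algebraMap k _ (augC k m b)) +
          algebraMap k (C k m) (augC k m b) • (a - algebraMap k _ (augC k m a)) := by
      rw [map_mul, mul_comm (augC k m a), map_mul, smul_eq_mul, smul_eq_mul, mul_sub, mul_sub,
        Algebra.commutes (augC k m b) a]
      abel
    rw [this]
    exact add_mem (Submodule.smul_mem _ _ hb) (Submodule.smul_mem _ _ ha)

theorem mul_mem_Aplus {A : Type*} [Ring A] [Algebra k A] (𝒜 : ℕ → Submodule k A)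
    [GradedAlgebra 𝒜] (a : A) {b : A} (hb : b ∈ Aplus 𝒜) : a * b ∈ Aplus 𝒜 := by
  have h : GradedRing.projZeroRingHom 𝒜 b = 0 := by
    simpa [Aplus, GradedAlgebra.proj_apply, GradedRing.projZeroRingHom_apply] using hb
  have h2 : GradedRing.projZeroRingHom 𝒜 (a * b) = 0 := by rw [map_mul, h, mul_zero]
  simpa [Aplus, GradedAlgebra.proj_apply, GradedRing.projZeroRingHom_apply] using h2

theorem augC_eq_zero_iff (a : C k m) : augC k m a = 0 ↔ a ∈ Aplus (gradeC k m) := by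
  have h : a - algebraMap k _ (augC k m a) ∈ Aplus (gradeC k m) := by
    have h1 := sub_augC_mem k a
    generalize a - algebraMap k _ (augC k m a) = b at h1
    induction h1 using Submodule.span_induction with
    | mem x hx =>
      obtain ⟨g, rfl⟩ := hx
      exact mem_Aplus_of_mem _ one_ne_zero (gen_mem k g)
    | zero => exact zero_mem _
    | add x y _ _ hx hy => exact add_mem hx hy
    | smul a x _ hx => exact mul_mem_Aplus k _ a hx
  constructor
  · intro h0
    rwa [h0, map_zero, sub_zero] at h
  · intro ha
    have h1 : algebraMap k (C k m) (augC k m a) ∈ Aplus (gradeC k m) := by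
      have := Submodule.sub_mem _ ha h
      rwa [sub_sub_cancel] at this
    have h2 : algebraMap k (C k m) (augC k m a) ∈ gradeC k m 0 := by
      rw [Algebra.algebraMap_eq_smul_one]
      exact Submodule.smul_mem _ _ SetLike.GradedOne.one_mem
    have h3 := congrArg (augC k m) (eq_zero_of_mem_Aplus _ h2 h1)
    simpa using h3

theorem lam_exact_zero (hm : 3 ≤ m) :
    Function.Exact (Matrix.vecMulLinear (lam k m 0))
      (fun v : Idx m 0 → C k m => augC k m (v (idxUnit m))) := by
  intro v
  constructor
  · intro h
    have hv : v = fun _ => v (idxUnit m) := by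
      funext ρ
      congr 1
      rcases ρ with ⟨l, hl⟩
      refine Subtype.ext ?_
      cases l <;> simp [Lab.Mem, idxUnit] at hl ⊢
      omega
    replace h : augC k m (v (idxUnit m)) = 0 := h
    let ψ : C k m →ₗ[C k m] (Idx m 0 → C k m) := LinearMap.pi fun _ => LinearMap.id
    have h1 : Submodule.span (C k m) (Set.range (gen k m)) ≤
        (LinearMap.range (Matrix.vecMulLinear (lam k m 0))).comap ψ := by
      rw [Submodule.span_le]
      rintro _ ⟨g, rfl⟩
      refine ⟨unitVec _ (g.idx hm), ?_⟩
      rw [vecMulLinear_unitVec]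
      funext σ
      exact lamOne_lab k g
    have h2 := sub_augC_mem k (v (idxUnit m))
    rw [h, map_zero, sub_zero] at h2
    rw [hv]
    exact h1 h2
  · rintro ⟨w, rfl⟩
    change augC k m (∑ ρ, w ρ * lamOne k m ρ.1) = 0
    rw [map_sum]
    refine Finset.sum_eq_zero fun ρ _ => ?_
    obtain ⟨g, rfl⟩ := Gen.exists_idx hm ρ
    rw [map_mul]
    change _ * augC k m (lamOne k m g.lab) = 0
    rw [lamOne_lab, augC_gen, mul_zero]

end Augmentation

/-! ### Exactness at `P^1`: the relations of the left module `C₊` -/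

section Presentation

variable (k : Type*) [Field k] {m : ℕ}

theorem sum_idx_smul {R M : Type*} [Ring R] [AddCommGroup M] [Module R M] {j : ℕ} (G : Lab m → R)
    (v : Idx m j → M) : ∑ ρ, G ρ.1 • v ρ = ∑ l, G l • extLab v l := by
  rw [sum_idx]
  refine Finset.sum_congr rfl fun l _ => ?_
  by_cases h : l.Mem m j
  · rw [extLab_of_mem _ h, extLab_of_mem _ h]
  · rw [extLab_of_not_mem _ h, extLab_of_not_mem _ h, smul_zero]

section Rows

variable {k}
variable {M : Type*} [AddCommGroup M] [Module (C k m) M] (j : ℕ) (e : Lab m → M)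

/-- The row of `λ_j` with label `ρ`, evaluated at elements of a module. -/
noncomputable def rowSum (k : Type*) [Field k] {m : ℕ} {M : Type*} [AddCommGroup M]
    [Module (C k m) M] (j : ℕ) (e : Lab m → M) (ρ : Lab m) : M := ∑ l, lamEntry k m j ρ l • e l

theorem rowSum_N_two (c : Fin 2) : rowSum k 2 e (.N c) = ∑ d, etaTwo k m c d • e (.P d) := by
  simp [rowSum, Lab.sum_eq, lamEntry]

theorem rowSum_P (c : Fin 3) : rowSum k j e (.P c) = ∑ d, delta k m c d • e (.S d) := by
  simp [rowSum, Lab.sum_eq, lamEntry]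

theorem rowSum_S (c : Fin 3) (h : 1 < m) :
    rowSum k j e (.S c) = epsilon k m c • e (.z ⟨1, h⟩) := by
  rw [← sum_ite_smul (fun i => e (.z i))]
  simp [rowSum, Lab.sum_eq, lamEntry]

theorem rowSum_z (i : Fin m) (h : (i : ℕ) + 1 < m) :
    rowSum k j e (.z i) = genZ k m i • e (.z ⟨i + 1, h⟩) := by
  rw [← sum_ite_smul (fun i => e (.z i))]
  simp [rowSum, Lab.sum_eq, lamEntry]

theorem rowSum_b (c : Fin 6) (h : 1 < m) :
    rowSum k j e (.b c) = beta k m c 0 • e .v + beta k m c 1 • e .w +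
      (beta k m c 2 • e (.x ⟨1, h⟩) + beta k m c 3 • e (.y ⟨1, h⟩)) := by
  rw [← sum_ite_smul (fun i => e (.x i)), ← sum_ite_smul (fun i => e (.y i))]
  simp [rowSum, Lab.sum_eq, lamEntry]

theorem rowSum_v (h : 2 < m) : rowSum k j e .v = gen k m .v • e (.x ⟨2, h⟩) := by
  rw [← sum_ite_smul (fun i => e (.x i))]
  simp [rowSum, Lab.sum_eq, lamEntry]

theorem rowSum_w (h : 2 < m) : rowSum k j e .w = gen k m .w • e (.x ⟨2, h⟩) := by
  rw [← sum_ite_smul (fun i => e (.x i))]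
  simp [rowSum, Lab.sum_eq, lamEntry]

theorem rowSum_x (i : Fin m) (h : (i : ℕ) + 1 < m) :
    rowSum k j e (.x i) = genX k m i • e (.x ⟨i + 1, h⟩) := by
  rw [← sum_ite_smul (fun i => e (.x i))]
  simp [rowSum, Lab.sum_eq, lamEntry]

theorem rowSum_y (i : Fin m) (h : (i : ℕ) + 1 < m) :
    rowSum k j e (.y i) = genY k m i • e (.x ⟨i + 1, h⟩) + genZ k m i • e (.y ⟨i + 1, h⟩) := by
  rw [← sum_ite_smul (fun i => e (.x i)), ← sum_ite_smul (fun i => e (.y i))]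
  simp [rowSum, Lab.sum_eq, lamEntry]

end Rows

/-- Given elements `e g` of a module `N`, a generator `g` acts on `k × N`, with `1 ∈ k` sent
to `e g`. -/
noncomputable def extAct {N : Type*} [AddCommGroup N] [Module k N] [Module (C k m) N]
    [IsScalarTower k (C k m) N] (η : N) (a : C k m) : Module.End k (k × N) :=
  LinearMap.prod 0 (LinearMap.toSpanSingleton k N η ∘ₗ LinearMap.fst k k N +
    Algebra.lsmul k k N a ∘ₗ LinearMap.snd k k N)

section

variable {N : Type*} [AddCommGroup N] [Module k N] [Module (C k m) N] [IsScalarTower k (C k m) N]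

theorem extAct_apply (η : N) (a : C k m) (x : k × N) :
    extAct k η a x = (0, x.1 • η + a • x.2) := rfl

theorem extAct_mul (η η' : N) (a b : C k m) :
    extAct k η a * extAct k η' b = extAct k (a • η') (a * b) := by
  refine LinearMap.ext fun x => ?_
  have : a • (x.1 • η') = x.1 • a • η' := smul_comm _ _ _
  simp [extAct_apply, Module.End.mul_apply, mul_smul, this]

theorem extAct_add (η η' : N) (a b : C k m) :
    extAct k η a + extAct k η' b = extAct k (η + η') (a + b) := by
  refine LinearMap.ext fun x => ?_
  simp only [LinearMap.add_apply, extAct_apply, Prod.mk_add_mk, add_zero, add_smul, smul_add]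
  congr 1
  abel

theorem extAct_zero : extAct k (0 : N) (0 : C k m) = 0 := by
  refine LinearMap.ext fun x => ?_
  simp [extAct_apply]

/-- If the elements `e g` satisfy the relations that the rows of `λ_2` express, the algebra acts
on `k × N`. -/
theorem exists_extAct (hm : 3 ≤ m) (e : Lab m → N) 
    (he : ∀ ρ : Lab m, ρ.Mem m 2 → rowSum k 2 e ρ = 0) :
    ∃ Ψ : C k m →ₐ[k] Module.End k (k × N), ∀ g, Ψ (gen k m g) = extAct k (e g.lab) (gen k m g) := by
  have hN := fun c h => (rowSum_N_two (k := k) e c).symm.trans (he _ h)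
  have hP := fun c h => (rowSum_P (k := k) 2 e c).symm.trans (he _ h)
  have hS := fun c h' h => (rowSum_S (k := k) 2 e c h').symm.trans (he _ h)
  have hb := fun c h' h => (rowSum_b (k := k) 2 e c h').symm.trans (he _ h)
  -- By `extAct_mul`, a word `ab` acts through the vector `a • e b` and the element `ab` of `C`. A
  -- defining relation therefore holds for the action as soon as the corresponding row of `λ_2`
  -- vanishes on `e`.
  have hrel : ∀ a b : FreeAlgebra k (Gen m), Rel k m a b →
      FreeAlgebra.lift k (fun g : Gen m => extAct k (e g.lab) (gen k m g)) a =
      FreeAlgebra.lift k (fun g : Gen m => extAct k (e g.lab) (gen k m g)) b := by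
    intro a b h
    have h0 := RingQuot.mkAlgHom_rel k h
    cases h <;> simp only [map_mul, map_add, map_zero, FreeAlgebra.lift_ι_apply, extAct_mul,
      extAct_add, mk_fr] at h0 ⊢ <;> rw [h0]
    case np_nq =>
      have := hN 0 (by simp [Lab.Mem])
      simp [Fin.sum_univ_three, etaTwo, add_neg_eq_zero] at this
      rw [Gen.lab, Gen.lab, this]
    case np_nr =>
      have := hN 1 (by simp [Lab.Mem])
      simp [Fin.sum_univ_three, etaTwo, add_neg_eq_zero] at this
      rw [Gen.lab, Gen.lab, this]
    case ps_pt =>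
      have := hP 0 (by simp [Lab.Mem])
      simp [Fin.sum_univ_three, delta, neg_add_eq_zero] at this
      rw [Gen.lab, Gen.lab, this]
    case qt_qu =>
      have := hP 1 (by simp [Lab.Mem])
      simp [Fin.sum_univ_three, delta, neg_add_eq_zero] at this
      rw [Gen.lab, Gen.lab, this]
    case rs_ru =>
      have := hP 2 (by simp [Lab.Mem])
      simp [Fin.sum_univ_three, delta, neg_add_eq_zero] at this
      rw [Gen.lab, Gen.lab, this]
    case sv_sw =>
      have := hb 0 (by omega) (by simp [Lab.Mem]; omega)
      simp [beta, add_neg_eq_zero] at this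
      rw [Gen.lab, Gen.lab, this]
    case tw_tx =>
      have := hb 1 (by omega) (by simp [Lab.Mem]; omega)
      simp [beta, add_neg_eq_zero] at this
      rw [Gen.lab, Gen.lab, this]
    case uv_ux =>
      have := hb 2 (by omega) (by simp [Lab.Mem]; omega)
      simp [beta, add_neg_eq_zero] at this
      rw [Gen.lab, Gen.lab, this]
    case sv_sy =>
      have := hb 3 (by omega) (by simp [Lab.Mem]; omega)
      simp [beta, add_neg_eq_zero] at this
      rw [Gen.lab, Gen.lab, this]
    case tw_ty =>
      have := hb 4 (by omega) (by simp [Lab.Mem]; omega)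
      simp [beta, add_neg_eq_zero] at this
      rw [Gen.lab, Gen.lab, this]
    case ux_uy =>
      have := hb 5 (by omega) (by simp [Lab.Mem]; omega)
      simp [beta, add_neg_eq_zero] at this
      rw [Gen.lab, Gen.lab, this]
    case sz =>
      have := hS 0 (by omega) (by simp [Lab.Mem]; omega)
      simp [epsilon] at this
      rw [Gen.lab, this, extAct_zero]
    case tz =>
      have := hS 1 (by omega) (by simp [Lab.Mem]; omega)
      simp [epsilon] at this
      rw [Gen.lab, this, extAct_zero]
    case uz =>
      have := hS 2 (by omega) (by simp [Lab.Mem]; omega)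
      simp [epsilon] at this
      rw [Gen.lab, this, extAct_zero]
    case vx =>
      have := (rowSum_v (k := k) 2 e (by omega)).symm.trans (he _ (by simp [Lab.Mem]; omega))
      rw [Gen.lab, this, extAct_zero]
    case wx =>
      have := (rowSum_w (k := k) 2 e (by omega)).symm.trans (he _ (by simp [Lab.Mem]; omega))
      rw [Gen.lab, this, extAct_zero]
    case xx i h h' =>
      have := (rowSum_x (k := k) 2 e ⟨i, by omega⟩ (by simp; omega)).symm.trans
        (he _ (by simp [Lab.Mem]; omega))
      rw [genX_eq k h] at this
      rw [Gen.lab, this, extAct_zero]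
    case yx_zy i h₁ h₂ h₃ h₄ =>
      have := (rowSum_y (k := k) 2 e ⟨i, by omega⟩ (by simp; omega)).symm.trans
        (he _ (by simp [Lab.Mem]; omega))
      rw [genY_eq k h₁, genZ_eq k h₃] at this
      rw [Gen.lab, Gen.lab, this, extAct_zero]
    case zz i h h' =>
      have := (rowSum_z (k := k) 2 e ⟨i, by omega⟩ (by simp; omega)).symm.trans
        (he _ (by simp [Lab.Mem]; omega))
      rw [genZ_eq k h] at this
      rw [Gen.lab, this, extAct_zero]
  refine ⟨RingQuot.liftAlgHom k ⟨_, fun a b h => hrel a b h⟩, fun g => ?_⟩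
  rw [gen, RingQuot.liftAlgHom_mkAlgHom_apply, FreeAlgebra.lift_ι_apply]
  rfl

end

/-- The relations of the left module `C₊` on the generators are spanned by the rows of `λ_2`. -/
theorem mem_range_lam_one (hm : 3 ≤ m) (v : Idx m 1 → C k m)
    (hv : ∑ ρ, v ρ * lamOne k m ρ.1 = 0) :
    v ∈ LinearMap.range (Matrix.vecMulLinear (lam k m 1)) := by
  let R := LinearMap.range (Matrix.vecMulLinear (lam k m 1))
  let u : Idx m 1 → (Idx m 1 → C k m) ⧸ R := fun ρ => R.mkQ (unitVec _ ρ)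
  have he : ∀ ρ : Lab m, ρ.Mem m 2 → rowSum k 2 (extLab u) ρ = 0 := by
    intro ρ hρ
    have h1 : Matrix.vecMulLinear (lam k m 1) (unitVec _ ⟨ρ, hρ⟩) =
        ∑ σ : Idx m 1, lamEntry k m 2 ρ σ.1 • unitVec _ σ := by
      rw [vecMulLinear_unitVec]
      exact (sum_smul_unitVec _).symm
    have h2 : R.mkQ (∑ σ : Idx m 1, lamEntry k m 2 ρ σ.1 • unitVec _ σ) = 0 := by
      rw [← h1]
      exact (Submodule.Quotient.mk_eq_zero R).2 ⟨_, rfl⟩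
    rw [map_sum] at h2
    simp only [map_smul] at h2
    rw [rowSum, ← h2]
    exact (sum_idx_smul _ _).symm
  obtain ⟨Ψ, hΨ⟩ := exists_extAct k hm (extLab u) he
  -- The copy of `N` inside `k × N` is a submodule with its original action, so once a generator has
  -- moved `(1, 0)` into `N`, the coefficients act as usual.
  have h1 : ∀ (a : C k m) (ν : (Idx m 1 → C k m) ⧸ R), Ψ a (0, ν) = (0, a • ν) := by
    intro a
    induction a using C_induction with
    | h0 c => intro ν; simp [Module.algebraMap_end_apply]
    | h1 g => intro ν; rw [hΨ, extAct_apply]; simp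
    | hadd a b ha hb => intro ν; rw [map_add, LinearMap.add_apply, ha, hb, add_smul]; simp
    | hmul a b ha hb => intro ν; rw [map_mul, Module.End.mul_apply, hb, ha, mul_smul]
  have h2 : ∀ ρ : Idx m 1, Ψ (lamOne k m ρ.1) (1, 0) = (0, u ρ) := by
    intro ρ
    obtain ⟨g, rfl⟩ := Gen.exists_idx hm ρ
    change Ψ (lamOne k m g.lab) (1, 0) = _
    rw [lamOne_lab, hΨ, extAct_apply, extLab_of_mem _ (g.lab_mem hm)]
    simp
    rfl
  -- The element `∑ v_ρ g_ρ` of `C` sends `(1, 0)` to the class of `v` modulo the rows of `λ_2`; if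
  -- the element is zero, so is the class.
  have h3 : Ψ (∑ ρ, v ρ * lamOne k m ρ.1) (1, 0) = (0, R.mkQ v) := by
    rw [map_sum, LinearMap.sum_apply]
    simp only [map_mul, Module.End.mul_apply, h2, h1]
    conv_rhs => rw [← sum_smul_unitVec v, map_sum]
    simp only [map_smul]
    ext
    · simp [Prod.fst_sum]
    · simp [Prod.snd_sum, u]
  rw [hv, map_zero] at h3
  exact (Submodule.Quotient.mk_eq_zero R).1 (congrArg Prod.snd h3).symm

end Presentation

end QuadExt

namespace QuadExt

/-! ### Solving linear equations between generators -/

section Syzygies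

variable (k : Type*) [Field k] {m : ℕ}

theorem lamOne_of_not_mem (hm : 3 ≤ m) {l : Lab m} (h : ¬ l.Mem m 1) (hl : l ≠ .N 1) :
    lamOne k m l = 0 := by
  cases l with
  | N c =>
    fin_cases c
    · exact absurd (by simp [Lab.Mem]) h
    · exact absurd rfl hl
  | P c => exact absurd (by simp [Lab.Mem]) h
  | S c => exact absurd (by simp [Lab.Mem]) h
  | v => exact absurd (by simp [Lab.Mem]; omega) h
  | w => exact absurd (by simp [Lab.Mem]; omega) h
  | x i => exact dif_neg fun h' => h (by simp [Lab.Mem]; omega)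
  | y i => exact dif_neg fun h' => h (by simp [Lab.Mem]; omega)
  | z i => exact dif_neg fun h' => h (by simp [Lab.Mem]; omega)
  | _ => rfl

/-- The label `.N 1` is excluded by hand: `lamOne` assigns `n` to both labels `.N`, but only `.N 0`
belongs to `P^1`. -/
theorem sum_idx_mul_lamOne (hm : 3 ≤ m) (V : Lab m → C k m) (hV : V (.N 1) = 0) :
    ∑ ρ : Idx m 1, V ρ.1 * lamOne k m ρ.1 = ∑ l, V l * lamOne k m l := by
  rw [sum_idx_mul (fun ρ : Idx m 1 => V ρ.1)]
  refine Finset.sum_congr rfl fun l _ => ?_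
  by_cases h : l.Mem m 1
  · rw [extLab_of_mem _ h]
  · rw [extLab_of_not_mem _ h, zero_mul]
    by_cases hl : l = .N 1
    · rw [hl, hV, zero_mul]
    · rw [lamOne_of_not_mem k hm h hl, mul_zero]

theorem vecMulLinear_lam_succ {j : ℕ} (w : Idx m (j + 2) → C k m) (σ : Idx m (j + 1)) :
    Matrix.vecMulLinear (lam k m (j + 1)) w σ = colSum k (j + 2) (extLab w) σ.1 :=
  sum_idx_mul w fun l => lamEntry k m (j + 2) l σ.1

/-- Relations between the generators of the left module `C₊`. -/
theorem exists_colSum_two (hm : 3 ≤ m) (V : Lab m → C k m) (hN : V (.N 1) = 0)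
    (hV : ∑ l, V l * lamOne k m l = 0) :
    ∃ W : Lab m → C k m, ∀ σ : Lab m, σ.Mem m 1 → V σ = colSum k 2 W σ := by
  obtain ⟨w, hw⟩ := mem_range_lam_one k hm (fun ρ => V ρ.1)
    ((sum_idx_mul_lamOne k hm V hN).trans hV)
  refine ⟨extLab w, fun σ hσ => ?_⟩
  rw [← vecMulLinear_lam_succ k w ⟨σ, hσ⟩, hw]

theorem sum_single_mul {R : Type*} [Ring R] (l : Lab m) (a : R) (G : Lab m → R) :
    ∑ l', (Pi.single l a : Lab m → R) l' * G l' = a * G l := by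
  rw [Finset.sum_eq_single l]
  · simp
  · intro b _ hb
    rw [Pi.single_eq_of_ne hb, zero_mul]
  · simp

variable {k}

/-- `neg_mul`, stated with the negation of `RingQuot`. -/
theorem C_neg_mul (a b : C k m) : -a * b = -(a * b) := neg_mul a b

/-- `mul_neg`, stated with the negation of `RingQuot`. -/
theorem C_mul_neg (a b : C k m) : a * -b = -(a * b) := mul_neg a b

local notation "𝗇" => gen k m Gen.n
local notation "𝗉" => gen k m Gen.p
local notation "𝗊" => gen k m Gen.q
local notation "𝗋" => gen k m Gen.r
local notation "𝗌" => gen k m Gen.s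
local notation "𝗍" => gen k m Gen.t
local notation "𝗎" => gen k m Gen.u

/-- No defining relation ends in `n`, so the column of `λ_2` at `n` is zero. -/
theorem eq_zero_of_mul_n (hm : 3 ≤ m) {a : C k m} (h : a * 𝗇 = 0) : a = 0 := by
  obtain ⟨W, hW⟩ := exists_colSum_two k hm (Pi.single (.N 0) a) (by simp)
    (by rw [sum_single_mul]; exact h)
  have := hW (.N 0) (by simp [Lab.Mem])
  rwa [colSum_N, Pi.single_eq_same] at this

theorem exists_of_pqr (hm : 3 ≤ m) {a b c : C k m} (h : a * 𝗉 + b * 𝗊 + c * 𝗋 = 0) :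
    ∃ f g, a = (f + g) * 𝗇 ∧ b = -(f * 𝗇) ∧ c = -(g * 𝗇) := by
  obtain ⟨W, hW⟩ := exists_colSum_two k hm
    (Pi.single (.P 0) a + Pi.single (.P 1) b + Pi.single (.P 2) c) (by simp) (by
      simp only [Pi.add_apply, add_mul, Finset.sum_add_distrib, sum_single_mul]
      exact h)
  have h0 := hW (.P 0) (by simp [Lab.Mem])
  have h1 := hW (.P 1) (by simp [Lab.Mem])
  have h2 := hW (.P 2) (by simp [Lab.Mem])
  simp [colSum_P_two, etaTwo, C_mul_neg] at h0 h1 h2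
  exact ⟨W (.N 0), W (.N 1), by rw [h0, add_mul], h1, h2⟩

theorem exists_of_stu (hm : 3 ≤ m) {a b c : C k m} (h : a * 𝗌 + b * 𝗍 + c * 𝗎 = 0) :
    ∃ d e f, a = -(d * 𝗉) - f * 𝗋 ∧ b = d * 𝗉 - e * 𝗊 ∧ c = e * 𝗊 + f * 𝗋 := by
  obtain ⟨W, hW⟩ := exists_colSum_two k hm
    (Pi.single (.S 0) a + Pi.single (.S 1) b + Pi.single (.S 2) c) (by simp) (by
      simp only [Pi.add_apply, add_mul, Finset.sum_add_distrib, sum_single_mul]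
      exact h)
  have h0 := hW (.S 0) (by simp [Lab.Mem])
  have h1 := hW (.S 1) (by simp [Lab.Mem])
  have h2 := hW (.S 2) (by simp [Lab.Mem])
  simp [colSum_S, delta, C_mul_neg, Fin.sum_univ_three] at h0 h1 h2
  exact ⟨W (.P 0), W (.P 1), W (.P 2), by rw [h0]; abel, by rw [h1]; abel, h2⟩

theorem exists_of_vwxy (hm : 4 ≤ m) {a b c d : C k m}
    (h : a * gen k m .v + b * gen k m .w + c * genX k m 1 + d * genY k m 1 = 0) :
    ∃ B : Fin 6 → C k m, a = ∑ i, B i * beta k m i 0 ∧ b = ∑ i, B i * beta k m i 1 ∧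
      c = ∑ i, B i * beta k m i 2 ∧ d = ∑ i, B i * beta k m i 3 := by
  have hl : 1 < m := by omega
  obtain ⟨W, hW⟩ := exists_colSum_two k (by omega)
    (Pi.single .v a + Pi.single .w b + Pi.single (.x ⟨1, hl⟩) c + Pi.single (.y ⟨1, hl⟩) d)
    (by simp) (by
      simp only [Pi.add_apply, add_mul, Finset.sum_add_distrib, sum_single_mul]
      exact h)
  have h0 := hW .v (by simp [Lab.Mem]; omega)
  have h1 := hW .w (by simp [Lab.Mem]; omega)
  have h2 := hW (.x ⟨1, hl⟩) (by simp [Lab.Mem]; omega)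
  have h3 := hW (.y ⟨1, hl⟩) (by simp [Lab.Mem]; omega)
  rw [colSum_v] at h0
  rw [colSum_w] at h1
  rw [colSum_x _ _ _ (by simp)] at h2
  rw [colSum_y _ _ _ (by simp)] at h3
  refine ⟨fun i => W (.b i), ?_⟩
  simp at h0 h1 h2 h3
  exact ⟨h0, h1, h2, h3⟩

theorem exists_of_z_one (hm : 5 ≤ m) {a : C k m} (h : a * genZ k m 1 = 0) :
    ∃ E : Fin 3 → C k m, a = ∑ i, E i * epsilon k m i := by
  have h1 : 1 < m := by omega
  obtain ⟨W, hW⟩ := exists_colSum_two k (by omega) (Pi.single (.z ⟨1, h1⟩) a) (by simp) (by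
      rw [sum_single_mul]
      exact h)
  have h0 := hW (.z ⟨1, h1⟩) (by simp [Lab.Mem]; omega)
  rw [colSum_z _ _ _ (by simp)] at h0
  simp at h0
  exact ⟨fun i => W (.S i), h0⟩

theorem exists_of_z (i : ℕ) (hi : 1 ≤ i) (hm : i + 5 ≤ m) {a : C k m}
    (h : a * genZ k m (i + 1) = 0) : ∃ c, a = c * genZ k m i := by
  have h1 : i + 1 < m := by omega
  obtain ⟨W, hW⟩ := exists_colSum_two k (by omega) (Pi.single (.z ⟨i + 1, h1⟩) a) (by simp) (by
      rw [sum_single_mul]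
      exact h)
  have h0 := hW (.z ⟨i + 1, h1⟩) (by simp [Lab.Mem]; omega)
  rw [colSum_z _ _ _ (by simp)] at h0
  simp [show i ≠ 0 by omega] at h0
  exact ⟨_, h0⟩

theorem exists_of_xy (i : ℕ) (hi : 1 ≤ i) (hm : i + 4 ≤ m) {a b : C k m}
    (h : a * genX k m (i + 1) + b * genY k m (i + 1) = 0) :
    ∃ c d e f, (i ≠ 1 → e = 0 ∧ f = 0) ∧
      a = e * gen k m .v + f * gen k m .w + c * genX k m i + d * genY k m i ∧
      b = d * genZ k m i := by
  have h1 : i + 1 < m := by omega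
  obtain ⟨W, hW⟩ := exists_colSum_two k (by omega)
    (Pi.single (.x ⟨i + 1, h1⟩) a + Pi.single (.y ⟨i + 1, h1⟩) b) (by simp) (by
      simp only [Pi.add_apply, add_mul, Finset.sum_add_distrib, sum_single_mul]
      exact h)
  have h0 := hW (.x ⟨i + 1, h1⟩) (by simp [Lab.Mem]; omega)
  have h2 := hW (.y ⟨i + 1, h1⟩) (by simp [Lab.Mem]; omega)
  rw [colSum_x _ _ _ (by simp)] at h0
  rw [colSum_y _ _ _ (by simp)] at h2
  simp [show i ≠ 0 by omega] at h0 h2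
  by_cases hi1 : i = 1
  · rw [if_pos hi1] at h0
    exact ⟨_, _, W .v, W .w, by simp [hi1], h0, h2⟩
  · rw [if_neg hi1, zero_add] at h0
    exact ⟨_, _, 0, 0, by simp, by rw [zero_mul, zero_mul, zero_add, zero_add]; exact h0, h2⟩

theorem eq_zero_of_mul_p (hm : 3 ≤ m) {a : C k m} (h : a * 𝗉 = 0) : a = 0 := by
  obtain ⟨f, g, h1, h2, h3⟩ := exists_of_pqr hm (a := a) (b := 0) (c := 0) (by simpa using h)
  rw [h1, add_mul, neg_eq_zero.1 h2.symm, neg_eq_zero.1 h3.symm, add_zero]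

theorem eq_zero_of_mul_q (hm : 3 ≤ m) {a : C k m} (h : a * 𝗊 = 0) : a = 0 := by
  obtain ⟨f, g, h1, h2, h3⟩ := exists_of_pqr hm (a := 0) (b := a) (c := 0) (by simpa using h)
  rw [add_mul, neg_eq_zero.1 h3.symm, add_zero] at h1
  rw [h2, ← h1, neg_zero]

theorem eq_zero_of_mul_r (hm : 3 ≤ m) {a : C k m} (h : a * 𝗋 = 0) : a = 0 := by
  obtain ⟨f, g, h1, h2, h3⟩ := exists_of_pqr hm (a := 0) (b := 0) (c := a) (by simpa using h)
  rw [add_mul, neg_eq_zero.1 h2.symm, zero_add] at h1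
  rw [h3, ← h1, neg_zero]

/-- A syzygy of `s, t, u` has three parameters. Absence of `t` forces `d p = e q`, hence `d = e = f'
n`, and `np = nq = nr` turns these contributions into multiples of `r`. The cases of `s, t` and `t,
u` are parallel. -/
theorem exists_of_su (hm : 3 ≤ m) {a c : C k m} (h : a * 𝗌 + c * 𝗎 = 0) :
    ∃ f, a = -(f * 𝗋) ∧ c = f * 𝗋 := by
  obtain ⟨d, e, f, h1, h2, h3⟩ := exists_of_stu hm (a := a) (b := 0) (c := c) (by simpa using h)
  obtain ⟨f', g', h4, h5, h6⟩ := exists_of_pqr hm (a := d) (b := -e) (c := 0)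
    (by rw [zero_mul, add_zero, C_neg_mul, ← sub_eq_add_neg, ← h2])
  rw [add_mul, neg_eq_zero.1 h6.symm, add_zero] at h4
  have h7 : c = (f' * 𝗇 + f) * 𝗋 := by
    rw [h3, neg_injective h5, add_mul, mul_assoc, mul_assoc, nq, nr]
  have h8 : a = -((f' * 𝗇 + f) * 𝗋) := by
    rw [h1, h4, add_mul, mul_assoc, mul_assoc, nr]; abel
  exact ⟨_, h8, h7⟩

theorem exists_of_st (hm : 3 ≤ m) {a b : C k m} (h : a * 𝗌 + b * 𝗍 = 0) :
    ∃ f, a = -(f * 𝗉) ∧ b = f * 𝗉 := by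
  obtain ⟨d, e, f, h1, h2, h3⟩ := exists_of_stu hm (a := a) (b := b) (c := 0) (by simpa using h)
  obtain ⟨f', g', h4, h5, h6⟩ := exists_of_pqr hm (a := 0) (b := e) (c := f)
    (by rw [zero_mul, zero_add, ← h3])
  have h7 : f = f' * 𝗇 := by
    rw [h6, neg_eq_iff_add_eq_zero, add_comm, ← add_mul, ← h4]
  exact ⟨d + f' * 𝗇, by rw [h1, h7, add_mul, mul_assoc, mul_assoc, nr]; abel,
    by rw [h2, h5, add_mul, C_neg_mul, mul_assoc, mul_assoc, nq]; abel⟩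

theorem exists_of_tu (hm : 3 ≤ m) {b c : C k m} (h : b * 𝗍 + c * 𝗎 = 0) :
    ∃ f, b = -(f * 𝗊) ∧ c = f * 𝗊 := by
  obtain ⟨d, e, f, h1, h2, h3⟩ := exists_of_stu hm (a := 0) (b := b) (c := c) (by simpa using h)
  obtain ⟨f', g', h4, h5, h6⟩ := exists_of_pqr hm (a := d) (b := 0) (c := f)
    (by rw [← neg_eq_zero, zero_mul, add_zero, neg_add', ← h1])
  rw [add_mul, neg_eq_zero.1 h5.symm, zero_add] at h4
  exact ⟨e - g' * 𝗇, by rw [h2, h4, sub_mul, mul_assoc, mul_assoc, nq]; abel,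
    by rw [h3, h6, sub_mul, C_neg_mul, mul_assoc, mul_assoc, nq, nr]; abel⟩

end Syzygies

end QuadExt

namespace QuadExt

/-! ### Kernels of the blocks -/

section Blocks

variable {k : Type*} [Field k] {m : ℕ}

local notation "𝗇" => gen k m Gen.n
local notation "𝗉" => gen k m Gen.p
local notation "𝗊" => gen k m Gen.q
local notation "𝗋" => gen k m Gen.r
local notation "𝗌" => gen k m Gen.s
local notation "𝗍" => gen k m Gen.t
local notation "𝗎" => gen k m Gen.u

/-- Two of the three columns suffice: they say `B_0 p + B_2 r = 0` and `B_0 p = B_1 q`, and the only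
common solutions are multiples of `(n, n, -n)`. -/
theorem exists_eta_of_delta (hm : 3 ≤ m) (B : Fin 3 → C k m)
    (h : ∀ d, ∑ c, B c * delta k m c d = 0) : ∃ f, ∀ d, B d = f * eta k m d := by
  have h0 := h 0
  have h1 := h 1
  simp [Fin.sum_univ_three, delta, C_mul_neg] at h0 h1
  obtain ⟨f, g, e0, e1, e2⟩ := exists_of_pqr hm (a := B 0) (b := 0) (c := B 2)
    (by rw [zero_mul, add_zero, ← neg_eq_zero, neg_add, h0])
  obtain ⟨f', g', e3, e4, e5⟩ := exists_of_pqr hm (a := B 0) (b := -B 1) (c := 0)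
    (by rw [zero_mul, add_zero, C_neg_mul, h1])
  rw [add_mul, neg_eq_zero.1 e1.symm, zero_add] at e0
  rw [add_mul, neg_eq_zero.1 e5.symm, add_zero] at e3
  refine ⟨g, fun d => ?_⟩
  fin_cases d
  · exact e0
  · change B 1 = g * 𝗇
    rw [← e0, e3, neg_injective e4]
  · change B 2 = g * -𝗇
    rw [C_mul_neg, e2]

/-- Each of the columns `v`, `w`, `x_1` involves just two of the letters `s, t, u`, so each
contributes one parameter: `r`, `p` and `q` in turn. -/
theorem exists_alpha_of_beta (hm : 3 ≤ m) (B : Fin 6 → C k m)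
    (h : ∀ d, ∑ c, B c * beta k m c d = 0) :
    ∃ A : Fin 3 → C k m, ∀ d, B d = ∑ c, A c * alpha k m c d := by
  have h0 := h 0
  have h1 := h 1
  have h2 := h 2
  simp [Fin.sum_univ_succ, beta, C_mul_neg] at h0 h1 h2
  obtain ⟨r, e0, e1⟩ := exists_of_su hm (a := B 0 + B 3) (c := B 2)
    (by rw [← h0, add_mul]; abel)
  obtain ⟨p, e2, e3⟩ := exists_of_st hm (a := -B 0) (b := B 1 + B 4)
    (by rw [← h1, add_mul, C_neg_mul])
  obtain ⟨q, e4, e5⟩ := exists_of_tu hm (b := -B 1) (c := B 5 - B 2)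
    (by rw [← h2, sub_mul, C_neg_mul]; abel)
  have f0 := neg_injective e2
  have f1 := neg_injective e4
  refine ⟨![p, q, r], fun d => ?_⟩
  fin_cases d <;> simp [Fin.sum_univ_succ, alpha, C_mul_neg]
  · exact f0
  · exact f1
  · exact e1
  · rw [eq_sub_of_add_eq' e0, f0]; abel
  · rw [eq_sub_of_add_eq' e3, f1]; abel
  · rw [eq_add_of_sub_eq e5, e1]

/-- With the last three rows missing, the columns `v` and `w` give `B_0 = p' p` and also `B_0 = -(r'
r)`. Then `p' p + r' r = 0` makes `p'` and `r'` multiples of `n`. This second step produces the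
entries `np` of degree two. -/
theorem exists_topRow_of_beta (hm : 3 ≤ m) (B : Fin 6 → C k m) (h3 : ∀ c : Fin 6, 3 ≤ c → B c = 0)
    (h0 : ∑ c, B c * beta k m c 0 = 0) (h1 : ∑ c, B c * beta k m c 1 = 0) : ∃ f, ∀ d, B d = f * topRow k m d := by
  have h3' := h3 3 le_rfl
  have h4' := h3 4 (by decide)
  have h5' := h3 5 (by decide)
  simp [Fin.sum_univ_succ, beta, C_mul_neg, h3', h4'] at h0 h1
  obtain ⟨r, e0, e1⟩ := exists_of_su hm (a := B 0) (c := B 2) h0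
  obtain ⟨p, e2, e3⟩ := exists_of_st hm (a := -B 0) (b := B 1) (by rw [← h1, C_neg_mul])
  obtain ⟨f, g, e4, e5, e6⟩ := exists_of_pqr hm (a := p) (b := 0) (c := r)
    (by rw [zero_mul, add_zero, ← neg_injective e2, e0, neg_add_cancel])
  rw [add_mul, neg_eq_zero.1 e5.symm, zero_add] at e4
  refine ⟨g, fun d => ?_⟩
  fin_cases d <;> simp [topRow, h3', h4', h5', C_mul_neg]
  · rw [← mul_assoc, ← e4, neg_injective e2]
  · rw [← mul_assoc, ← e4, e3]
  · rw [e1, e6, C_neg_mul, mul_assoc, nr]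

/-- The full system may use rows that involve `y_1`. As the coefficient of `y_1` is zero, their
coefficients form a syzygy of `s, t, u`, and a combination of the rows of `α` removes them. -/
theorem exists_of_vwx (hm : 4 ≤ m) {a b c : C k m}
    (h : a * gen k m .v + b * gen k m .w + c * genX k m 1 = 0) :
    ∃ B : Fin 6 → C k m, (∀ c : Fin 6, 3 ≤ c → B c = 0) ∧ a = ∑ i, B i * beta k m i 0 ∧
      b = ∑ i, B i * beta k m i 1 ∧ c = ∑ i, B i * beta k m i 2 := by
  obtain ⟨B, h0, h1, h2, h3⟩ := exists_of_vwxy hm (a := a) (b := b) (c := c) (d := 0)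
    (by rw [zero_mul, add_zero, h])
  simp [Fin.sum_univ_succ, beta, C_mul_neg] at h0 h1 h2 h3
  obtain ⟨d, e, f, e0, e1, e2⟩ := exists_of_stu (by omega) (a := B 3) (b := B 4) (c := B 5)
    (by rw [← neg_eq_zero, h3]; abel)
  refine ⟨![B 0 - d * 𝗉, B 1 - e * 𝗊, B 2 - f * 𝗋, 0, 0, 0], ?_, ?_, ?_, ?_⟩
  · intro c hc
    fin_cases c
    all_goals first | rfl | exact absurd hc (by decide)
  · simp [Fin.sum_univ_succ, beta]
    rw [h0, e0]
    simp only [sub_mul, C_neg_mul, mul_assoc, ru]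
    abel
  · simp [Fin.sum_univ_succ, beta, C_mul_neg]
    rw [h1, e1]
    simp only [sub_mul, mul_assoc, pt]
    abel
  · simp [Fin.sum_univ_succ, beta, C_mul_neg]
    rw [h2, e2]
    simp only [sub_mul, add_mul, mul_assoc, qu]
    abel

/-- The equation `d z_i = 0` makes `d` a multiple of `z_{i-1}`, and `z_{i-1} y_i = -y_{i-1} x_i`
absorbs `d y_i` into the coefficient of `x_i`. For `i = 1` it makes `d` a combination of `s, t, u`,
and `s y_1 = s v`, `t y_1 = t w`, `u y_1 = u v` absorb it into the coefficients of `v` and `w`. -/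
theorem exists_of_x (i : ℕ) (hi : 1 ≤ i) (hm : i + 4 ≤ m) {a : C k m}
    (h : a * genX k m (i + 1) = 0) :
    ∃ c e f, (i ≠ 1 → e = 0 ∧ f = 0) ∧
      a = e * gen k m .v + f * gen k m .w + c * genX k m i := by
  obtain ⟨c, d, e, f, h1, h2, h3⟩ := exists_of_xy i hi hm (a := a) (b := 0)
    (by rw [h, zero_mul, add_zero])
  by_cases hi1 : i = 1
  · subst hi1
    obtain ⟨E, hE⟩ := exists_of_z_one (by omega) h3.symm
    refine ⟨c, e + E 0 * 𝗌 + E 2 * 𝗎, f + E 1 * 𝗍, by simp, ?_⟩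
    rw [h2, hE]
    simp only [Fin.sum_univ_three, epsilon, Matrix.cons_val, add_mul, mul_assoc, sy k (by omega : 4 ≤ m),
      ty k (by omega : 4 ≤ m), uy k (by omega : 4 ≤ m)]
    abel
  · obtain ⟨i, rfl⟩ : ∃ i', i = i' + 1 := ⟨i - 1, by omega⟩
    obtain ⟨c', hc'⟩ := exists_of_z i (by omega) (by omega) h3.symm
    refine ⟨c - c' * genY k m i, e, f, h1, ?_⟩
    rw [h2, hc', mul_assoc, zy k (by omega), sub_mul, C_mul_neg, mul_assoc]
    abel

end Blocks

/-! ### Consecutive matrices multiply to zero -/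

section Square

variable (k : Type*) [Field k] {m : ℕ}

/-- The uniform formula for the entries never reaches a column outside `P^j`, so sums may run over
all labels. In the critical cases the first three rows of `β` have no `y_1` entry, and the top row
is zero on the last three columns. -/
theorem lamEntry_eq_zero_of_not_mem (hm : 3 ≤ m) {j : ℕ} (hj : 1 ≤ j) {ρ σ : Lab m} (hρ : ρ.Mem m (j + 1))
    (hσ : ¬ σ.Mem m j) : lamEntry k m (j + 1) ρ σ = 0 := by
  cases ρ <;> cases σ <;> try rfl
  all_goals simp only [Lab.Mem] at hρ hσ
  all_goals simp only [lamEntry]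
  case b.y c i =>
    refine ite_eq_right_iff.2 fun h => ?_
    by_cases hc : (c : ℕ) < 3
    · fin_cases c <;> first | rfl | simp at hc
    · rw [if_neg hc] at hρ
      omega
  case top.b c =>
    by_cases hc : (c : ℕ) < 3
    · rw [if_pos hc] at hσ
      omega
    · fin_cases c <;> first | rfl | simp at hc
  all_goals try split_ifs
  all_goals try rfl
  all_goals
    exfalso
    first
    | omega
    | split_ifs at hρ <;> omega
    | split_ifs at hσ <;> omega

theorem colSum_lamEntry {j : ℕ} (hj : 2 ≤ j) {ρ : Lab m} (hρ : ρ.Mem m (j + 1)) {τ : Lab m}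
    (hτ : τ.Mem m (j - 1)) : colSum k j (lamEntry k m (j + 1) ρ) τ = 0 := by
  cases τ with
  | unit => exact colSum_unit _ _
  | N c => exact colSum_N _ _ _
  | a c => exact colSum_a _ _ _
  | top => exact colSum_top _ _
  | P d =>
    by_cases h2 : j = 2
    · subst h2
      rw [colSum_P_two]
      cases ρ <;> simp [lamEntry]
    · rw [colSum_P _ _ h2]
      cases ρ <;> simp [lamEntry]
  | S d =>
    rw [colSum_S]
    cases ρ <;> simp [lamEntry]
    rw [if_neg (by omega)]
    fin_cases d <;>
      simp [Fin.sum_univ_three, eta, delta, C_mul_neg, C_neg_mul, nq, nr]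
  | b d =>
    rw [colSum_b]
    cases ρ <;> simp [lamEntry]
  | v =>
    rw [colSum_v]
    cases ρ <;> simp [lamEntry, Fin.sum_univ_succ, beta, topRow, C_neg_mul, npu]
    case a c => fin_cases c <;> simp [alpha, C_neg_mul, ru]
  | w =>
    rw [colSum_w]
    cases ρ <;> simp [lamEntry, Fin.sum_univ_succ, beta, topRow, C_mul_neg, npt]
    case a c => fin_cases c <;> simp [alpha, C_neg_mul, pt]
  | z i =>
    rw [colSum_z _ _ _ hτ.2.1]
    obtain ⟨i, hi, rfl⟩ : ∃ (i' : ℕ) (h : i' + 1 < m), i = ⟨i' + 1, h⟩ :=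
      ⟨i - 1, by have := hτ.2.1; omega, Fin.ext (Nat.sub_add_cancel hτ.2.1).symm⟩
    cases ρ <;> simp [lamEntry, atIdx, Nat.lt_of_succ_lt hi]
    case P c =>
      intro _
      fin_cases c <;>
        simp [Fin.sum_univ_three, delta, epsilon, C_neg_mul, pt, qu, ru]
    case S c =>
      rintro rfl
      fin_cases c
      exacts [sz k, tz k, uz k]
    case z i' =>
      rintro rfl
      exact zz k _
  | y i =>
    rw [colSum_y _ _ _ hτ.2.1]
    obtain ⟨i, hi, rfl⟩ : ∃ (i' : ℕ) (h : i' + 1 < m), i = ⟨i' + 1, h⟩ :=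
      ⟨i - 1, by have := hτ.2.1; omega, Fin.ext (Nat.sub_add_cancel hτ.2.1).symm⟩
    cases ρ <;> simp [lamEntry, atIdx, Nat.lt_of_succ_lt hi]
    case y i' =>
      rintro rfl
      exact zz k _
    case a c =>
      intro _
      fin_cases c <;>
        simp [Fin.sum_univ_succ, alpha, beta, C_neg_mul, C_mul_neg, pt, qu, ru]
    case b c =>
      rintro rfl
      fin_cases c <;> simp [beta, C_neg_mul, sz, tz, uz]
    case top =>
      intro _
      simp [Fin.sum_univ_succ, topRow, beta]
  | x i =>
    rw [colSum_x _ _ _ hτ.2.1]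
    obtain ⟨i, hi, rfl⟩ : ∃ (i' : ℕ) (h : i' + 1 < m), i = ⟨i' + 1, h⟩ :=
      ⟨i - 1, by have := hτ.2.1; omega, Fin.ext (Nat.sub_add_cancel hτ.2.1).symm⟩
    cases ρ <;> simp [lamEntry, atIdx, Nat.lt_of_succ_lt hi]
    case v =>
      rintro rfl
      exact vx k
    case w =>
      rintro rfl
      exact wx k
    case x i' =>
      rintro rfl
      exact xx k _
    case y i' =>
      by_cases h : i = i' + 1
      · subst h
        have := hρ.2.2
        rw [if_pos rfl, if_pos rfl, zy k (by omega), add_neg_cancel]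
      · rw [if_neg h, if_neg h, add_zero]
    case a c =>
      intro _
      fin_cases c <;>
        simp [Fin.sum_univ_succ, alpha, beta, C_mul_neg, qu, ru]
    case b c =>
      by_cases h : i = 1
      · subst h
        simp only [if_true]
        have h4 : ¬ (c : ℕ) < 3 → 4 ≤ m := by
          intro hc
          have := hρ.2
          rw [if_neg hc] at this
          omega
        fin_cases c <;>
          simp [beta, C_neg_mul, sw, tx k (show 3 ≤ m by omega), ux k (show 3 ≤ m by omega)]
        · rw [sy k (h4 (by simp)), add_neg_cancel]
        · rw [ty k (h4 (by simp)), add_neg_cancel]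
        · rw [uy k (h4 (by simp)), add_neg_cancel]
      · simp [h]
    case top =>
      intro _
      simp [Fin.sum_univ_succ, topRow, beta, C_neg_mul, C_mul_neg, npt, npu]

theorem sum_lamEntry_two_mul_lamOne (hm : 3 ≤ m) {ρ : Lab m} (hρ : ρ.Mem m 2) :
    ∑ l, lamEntry k m 2 ρ l * lamOne k m l = 0 := by
  have h1 : (1 : ℕ) < m := by omega
  change rowSum k 2 (lamOne k m) ρ = 0
  cases ρ with
  | unit => simp [Lab.Mem] at hρ
  | N c =>
    rw [rowSum_N_two]
    fin_cases c <;>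
      simp [Fin.sum_univ_three, etaTwo, lamOne, C_neg_mul, nq, nr]
  | P c =>
    rw [rowSum_P]
    fin_cases c <;>
      simp [Fin.sum_univ_three, delta, lamOne, C_neg_mul, pt, qu, ru]
  | S c =>
    rw [rowSum_S _ _ _ h1]
    fin_cases c
    exacts [sz k, tz k, uz k]
  | v =>
    rw [rowSum_v _ _ (by omega)]
    exact vx k
  | w =>
    rw [rowSum_w _ _ (by omega)]
    exact wx k
  | x i =>
    have := hρ.2.2
    rw [rowSum_x _ _ _ (by omega)]
    exact xx k i
  | y i =>
    have := hρ.2.2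
    rw [rowSum_y _ _ _ (by omega)]
    change genY k m i * genX k m (i + 1) + genZ k m i * genY k m (i + 1) = 0
    rw [zy k (by omega), add_neg_cancel]
  | z i =>
    have := hρ.2.2
    rw [rowSum_z _ _ _ (by omega)]
    exact zz k i
  | a c => simp [Lab.Mem] at hρ
  | top =>
    simp [Lab.Mem] at hρ
    omega
  | b c =>
    have h4 : ¬ (c : ℕ) < 3 → 4 ≤ m := by
      intro hc
      have := hρ.2
      rw [if_neg hc] at this
      omega
    rw [rowSum_b _ _ _ h1]
    fin_cases c <;> simp [beta, lamOne, C_neg_mul, sw, tx k hm, ux k hm]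
    · rw [sy k (h4 (by simp)), add_neg_cancel]
    · rw [ty k (h4 (by simp)), add_neg_cancel]
    · rw [uy k (h4 (by simp)), add_neg_cancel]

theorem lam_mul_lam (hm : 3 ≤ m) (i : ℕ) : lam k m (i + 1) * lam k m i = 0 := by
  ext ρ τ
  rw [Matrix.mul_apply, Matrix.zero_apply]
  match i, ρ, τ with
  | 0, ρ, τ =>
    exact (sum_idx_mul_lamOne k hm (lamEntry k m 2 ρ.1)
      (by rcases ρ with ⟨_ | _, _⟩ <;> rfl)).trans (sum_lamEntry_two_mul_lamOne k hm ρ.2)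
  | i + 1, ρ, τ =>
    refine (sum_idx_mul (fun σ : Idx m (i + 2) => lamEntry k m (i + 3) ρ.1 σ.1)
      fun l => lamEntry k m (i + 2) l τ.1).trans ?_
    refine Eq.trans ?_ (colSum_lamEntry k (j := i + 2) (by omega) ρ.2 τ.2)
    refine Finset.sum_congr rfl fun l _ => ?_
    by_cases h : l.Mem m (i + 2)
    · rw [extLab_of_mem _ h]
    · rw [extLab_of_not_mem _ h, lamEntry_eq_zero_of_not_mem k hm (by omega) ρ.2 h]

end Square

end QuadExt

namespace QuadExt

/-! ### Exactness from `P^2` on, block by block -/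

section Core

variable {k : Type*} [Field k] {m : ℕ} {j : ℕ} {V : Lab m → C k m}

theorem cycle_N (hm : 3 ≤ m) (hj : 2 ≤ j) (hV0 : ∀ l : Lab m, ¬ l.Mem m j → V l = 0)
    (hV : ∀ τ : Lab m, τ.Mem m (j - 1) → colSum k j V τ = 0) (c : Fin 2) : V (.N c) = 0 := by
  -- The columns `p, q, r` occur in `P^{j-1}` exactly when `.N 0` occurs in `P^j`, for `j ≥ 2`.
  by_cases hP : j - 1 + 2 ≤ m ∨ j - 1 ≤ 2
  · have h := fun d => hV (.P d) ⟨by omega, hP⟩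
    by_cases h2 : j = 2
    · subst h2
      have h1 := h 1
      have h2 := h 2
      simp [colSum_P_two, etaTwo, C_mul_neg] at h1 h2
      fin_cases c
      exacts [eq_zero_of_mul_n hm h1, eq_zero_of_mul_n hm h2]
    · have h1 : V (.N 1) = 0 := hV0 _ (by simp [Lab.Mem]; omega)
      have h0 := h 0
      simp [colSum_P _ _ h2, h1, eta] at h0
      fin_cases c
      exacts [eq_zero_of_mul_n hm h0, h1]
  · refine hV0 _ ?_
    simp only [Lab.Mem]
    split_ifs <;> omega

theorem cycle_a_top (hm : 3 ≤ m) (hj : 2 ≤ j) (hV0 : ∀ l : Lab m, ¬ l.Mem m j → V l = 0)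
    (hV : ∀ τ : Lab m, τ.Mem m (j - 1) → colSum k j V τ = 0) :
    (∀ c, V (.a c) = 0) ∧ V .top = 0 := by
  by_cases h3 : 3 ≤ j
  swap
  · exact ⟨fun c => hV0 _ (by simp [Lab.Mem]; omega), hV0 _ (by simp [Lab.Mem]; omega)⟩
  by_cases hjm : j ≤ m
  swap
  · exact ⟨fun c => hV0 _ (by simp [Lab.Mem]; omega), hV0 _ (by simp [Lab.Mem]; omega)⟩
  have h0 := hV (.b 0) ⟨by omega, by simp; omega⟩
  have h1 := hV (.b 1) ⟨by omega, by simp; omega⟩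
  have h2 := hV (.b 2) ⟨by omega, by simp; omega⟩
  simp [colSum_b, Fin.sum_univ_three, alpha, topRow, C_mul_neg] at h0 h1 h2
  -- The labels `.a` and `.top` compete for the columns `.b`, but never occur in the same degree.
  by_cases hj' : j = m
  · have ha : ∀ c, V (.a c) = 0 := fun c => hV0 _ (by simp [Lab.Mem]; omega)
    refine ⟨ha, ?_⟩
    rw [ha, zero_mul, zero_add, ← mul_assoc] at h0
    exact eq_zero_of_mul_n hm (eq_zero_of_mul_p hm h0)
  · have ht : V .top = 0 := hV0 _ hj'
    simp [ht] at h0 h1 h2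
    refine ⟨fun c => ?_, ht⟩
    fin_cases c
    exacts [eq_zero_of_mul_p hm h0, eq_zero_of_mul_q hm h1, eq_zero_of_mul_r hm h2]

/-- As in the lemmas that follow, the vanishing clause on the coefficient records that it belongs to
a basis vector of `P^{j+1}` only when that vector exists. -/
theorem cycle_P (hm : 3 ≤ m) (hj : 2 ≤ j) (hV0 : ∀ l : Lab m, ¬ l.Mem m j → V l = 0)
    (hV : ∀ τ : Lab m, τ.Mem m (j - 1) → colSum k j V τ = 0) :
    ∃ f, (¬ (j + 2 ≤ m ∨ j ≤ 2) → f = 0) ∧ ∀ d, V (.P d) = f * eta k m d := by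
  by_cases h : j + 2 ≤ m ∨ j ≤ 2
  · obtain ⟨f, hf⟩ := exists_eta_of_delta hm (fun d => V (.P d)) fun d => by
      rw [← colSum_S j]
      exact hV _ ⟨by omega, by omega⟩
    exact ⟨f, fun h' => absurd h h', hf⟩
  · exact ⟨0, fun _ => rfl, fun d => by rw [zero_mul]; exact hV0 _ (by simp [Lab.Mem]; omega)⟩

theorem cycle_S (hm : 3 ≤ m) (hj : 2 ≤ j) (hV0 : ∀ l : Lab m, ¬ l.Mem m j → V l = 0)
    (hV : ∀ τ : Lab m, τ.Mem m (j - 1) → colSum k j V τ = 0) :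
    ∃ D : Fin 3 → C k m, (¬ j + 3 ≤ m → D = 0) ∧ ∀ d, V (.S d) = ∑ c, D c * delta k m c d := by
  by_cases h : j + 3 ≤ m
  · have h1 := hV (.z ⟨1, by omega⟩) ⟨by omega, le_rfl, by simp; omega⟩
    rw [colSum_z _ _ _ (by simp)] at h1
    simp [Fin.sum_univ_three, epsilon] at h1
    obtain ⟨d, e, f, h2, h3, h4⟩ := exists_of_stu hm h1
    refine ⟨![d, e, f], fun h' => absurd h h', fun i => ?_⟩
    fin_cases i <;> simp [Fin.sum_univ_three, delta, C_mul_neg]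
    · rw [h2, sub_eq_add_neg]
    · rw [h3, sub_eq_add_neg]
    · rw [h4]
  · exact ⟨0, fun _ => rfl, fun d => by
      simpa using hV0 (.S d) (by simp [Lab.Mem]; omega)⟩

theorem cycle_z_one (hj : 2 ≤ j) (hV0 : ∀ l : Lab m, ¬ l.Mem m j → V l = 0)
    (hV : ∀ τ : Lab m, τ.Mem m (j - 1) → colSum k j V τ = 0) :
    ∃ E : Fin 3 → C k m, (¬ j + 4 ≤ m → E = 0) ∧
      ∀ h, V (.z ⟨1, h⟩) = ∑ c, E c * epsilon k m c := by
  by_cases h : j + 4 ≤ m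
  · have h1 := hV (.z ⟨2, by omega⟩) ⟨by omega, by simp, by simp; omega⟩
    rw [colSum_z _ _ _ (by simp)] at h1
    simp [atIdx, show 1 < m by omega] at h1
    obtain ⟨E, hE⟩ := exists_of_z_one (by omega) h1
    exact ⟨E, fun h' => absurd h h', fun _ => hE⟩
  · exact ⟨0, fun _ => rfl, fun h' => by
      simpa using hV0 (.z ⟨1, h'⟩) (by simp [Lab.Mem]; omega)⟩

theorem cycle_z (hj : 2 ≤ j) (hV0 : ∀ l : Lab m, ¬ l.Mem m j → V l = 0)
    (hV : ∀ τ : Lab m, τ.Mem m (j - 1) → colSum k j V τ = 0) (i : Fin m) :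
    ∃ c, (¬ (1 ≤ (i : ℕ) ∧ i + j + 4 ≤ m) → c = 0) ∧
      ∀ h, 1 ≤ (i : ℕ) → V (.z ⟨i + 1, h⟩) = c * genZ k m i := by
  by_cases h : 1 ≤ (i : ℕ) ∧ i + j + 4 ≤ m
  · have h1 := hV (.z ⟨i + 2, by omega⟩) ⟨by omega, by simp, by simp; omega⟩
    rw [colSum_z _ _ _ (by simp)] at h1
    simp [atIdx, show (i : ℕ) + 1 < m by omega] at h1
    obtain ⟨E, hE⟩ := exists_of_z i h.1 (by omega) h1
    exact ⟨E, fun h' => absurd h h', fun _ _ => hE⟩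
  · exact ⟨0, fun _ => rfl, fun h' h1 => by
      simpa using hV0 (.z ⟨i + 1, h'⟩) (by simp [Lab.Mem]; omega)⟩

/-- If `y_{i+1}` is still present in `P^j`, this is the syzygy of the pair `x_{i+2}, y_{i+2}`. At
the end of the range `y_{i+1}` has disappeared and `exists_of_x` shows that `y_i` is no longer
needed. -/
theorem cycle_xy (hj : 2 ≤ j) (hV0 : ∀ l : Lab m, ¬ l.Mem m j → V l = 0)
    (hV : ∀ τ : Lab m, τ.Mem m (j - 1) → colSum k j V τ = 0) (i : Fin m) :
    ∃ c d e f, (¬ (1 ≤ (i : ℕ) ∧ i + j + 2 ≤ m) → c = 0) ∧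
      (¬ (1 ≤ (i : ℕ) ∧ i + j + 3 ≤ m) → d = 0) ∧
      (¬ ((i : ℕ) = 1 ∧ j + 3 ≤ m) → e = 0 ∧ f = 0) ∧
      ∀ h, 1 ≤ (i : ℕ) →
        V (.x ⟨i + 1, h⟩) = e * gen k m .v + f * gen k m .w + c * genX k m i + d * genY k m i ∧
        V (.y ⟨i + 1, h⟩) = d * genZ k m i := by
  by_cases h : 1 ≤ (i : ℕ) ∧ i + j + 2 ≤ m
  · have h1 := hV (.x ⟨i + 2, by omega⟩) ⟨by omega, by simp, by simp; omega⟩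
    rw [colSum_x _ _ _ (by simp)] at h1
    simp [atIdx, show (i : ℕ) + 1 < m by omega, show (i : ℕ) ≠ 0 by omega] at h1
    by_cases hy : (i : ℕ) + j + 3 ≤ m
    · obtain ⟨c, d, e, f, e1, e2, e3⟩ := exists_of_xy i h.1 (by omega) h1
      exact ⟨c, d, e, f, fun h' => absurd h h', fun h' => absurd ⟨h.1, hy⟩ h',
        fun h' => e1 (by omega), fun _ _ => ⟨e2, e3⟩⟩
    · have h0 : V (.y ⟨i + 1, by omega⟩) = 0 := hV0 _ (by simp [Lab.Mem]; omega)
      rw [h0, zero_mul, add_zero] at h1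
      obtain ⟨c, e, f, e1, e2⟩ := exists_of_x i h.1 (by omega) h1
      exact ⟨c, 0, e, f, fun h' => absurd h h', fun _ => rfl, fun h' => e1 (by omega),
        fun _ _ => ⟨by rw [zero_mul, add_zero]; exact e2, by rw [zero_mul]; exact h0⟩⟩
  · refine ⟨0, 0, 0, 0, fun _ => rfl, fun _ => rfl, fun _ => ⟨rfl, rfl⟩, fun h' h1 => ⟨?_, ?_⟩⟩
    · simpa using hV0 (.x ⟨i + 1, h'⟩) (by simp [Lab.Mem]; omega)
    · simpa using hV0 (.y ⟨i + 1, h'⟩) (by simp [Lab.Mem]; omega)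

/-- For `j + 2 ≤ m` all six rows of `β` and the column `y_1` are present, and the kernel comes from
`α`. For `j + 1 = m` only `β'` is left and the kernel comes from the row of degree `m + 1`. -/
theorem cycle_b (hm : 3 ≤ m) (hj : 2 ≤ j) (hV0 : ∀ l : Lab m, ¬ l.Mem m j → V l = 0)
    (hV : ∀ τ : Lab m, τ.Mem m (j - 1) → colSum k j V τ = 0) :
    ∃ (A : Fin 3 → C k m) (g : C k m), (¬ j + 2 ≤ m → A = 0) ∧ (j + 1 ≠ m → g = 0) ∧
      ∀ d, V (.b d) = ∑ c, A c * alpha k m c d + g * topRow k m d := by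
  by_cases hjm : j + 1 ≤ m
  · have h0 := hV .v ⟨by omega, by omega⟩
    have h1 := hV .w ⟨by omega, by omega⟩
    rw [colSum_v] at h0
    rw [colSum_w] at h1
    by_cases h : j + 2 ≤ m
    · have h2 := hV (.x ⟨1, by omega⟩) ⟨by omega, le_rfl, by simp; omega⟩
      have h3 := hV (.y ⟨1, by omega⟩) ⟨by omega, le_rfl, by simp; omega⟩
      rw [colSum_x _ _ _ (by simp)] at h2
      rw [colSum_y _ _ _ (by simp)] at h3
      simp only [if_true, Nat.sub_self, genX_zero, genY_zero, genZ_zero, mul_zero, add_zero,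
        show (1 : ℕ) ≠ 2 by decide, if_false] at h2 h3
      obtain ⟨A, hA⟩ := exists_alpha_of_beta hm (fun d => V (.b d)) fun d => by
        fin_cases d
        exacts [h0, h1, h2, h3]
      exact ⟨A, 0, fun h' => absurd h h', fun _ => rfl, fun d => by
        rw [zero_mul, add_zero]; exact hA d⟩
    · obtain ⟨g, hg⟩ := exists_topRow_of_beta hm (fun d => V (.b d))
        (fun c hc => hV0 _ fun h' => h (by
          have := h'.2
          rwa [if_neg (by simpa [Fin.le_def] using hc)] at this)) h0 h1
      refine ⟨0, g, fun _ => rfl, fun h' => absurd h' (by omega), fun d => ?_⟩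
      simpa using hg d
  · refine ⟨0, 0, fun _ => rfl, fun _ => rfl, fun d => ?_⟩
    simpa using hV0 (.b d) fun h' => by
      have := h'.2
      split_ifs at this <;> omega

/-- The alternative `¬ j + 3 ≤ m` covers the degrees in which `y_1` is not a basis vector of `P^j`;
there the last three rows of `β` are not available in `P^{j+1}`, and `exists_of_vwx` does without
them. -/
theorem cycle_v (hj : 2 ≤ j) (hV0 : ∀ l : Lab m, ¬ l.Mem m j → V l = 0)
    (hV : ∀ τ : Lab m, τ.Mem m (j - 1) → colSum k j V τ = 0) :
    ∃ B : Fin 6 → C k m, (∀ c : Fin 6, ¬ (if (c : ℕ) < 3 then j + 2 ≤ m else j + 3 ≤ m) → B c = 0) ∧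
      V .v = ∑ i, B i * beta k m i 0 ∧ V .w = ∑ i, B i * beta k m i 1 ∧
      ∀ h, V (.x ⟨1, h⟩) = ∑ i, B i * beta k m i 2 ∧
        (V (.y ⟨1, h⟩) = ∑ i, B i * beta k m i 3 ∨ ¬ j + 3 ≤ m) := by
  by_cases h : j + 2 ≤ m
  · have h1 := hV (.x ⟨2, by omega⟩) ⟨by omega, by simp, by simp; omega⟩
    rw [colSum_x _ _ _ (by simp)] at h1
    simp [atIdx, show 1 < m by omega] at h1
    by_cases hy : j + 3 ≤ m
    · obtain ⟨B, h0, h2, h3, h4⟩ := exists_of_vwxy (by omega) h1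
      refine ⟨B, fun c hc => absurd ?_ hc, h0, h2, fun _ => ⟨h3, .inl h4⟩⟩
      split_ifs <;> assumption
    · have h0 : V (.y ⟨1, by omega⟩) = 0 := hV0 _ (by simp [Lab.Mem]; omega)
      rw [h0, zero_mul, add_zero] at h1
      obtain ⟨B, hB, h0, h2, h3⟩ := exists_of_vwx (by omega) h1
      refine ⟨B, fun c hc => ?_, h0, h2, fun _ => ⟨h3, .inr hy⟩⟩
      split_ifs at hc with h'
      · exact absurd h hc
      · exact hB c (by simpa [Fin.le_def] using h')
  · refine ⟨0, fun _ _ => rfl, ?_, ?_, fun h' => ⟨?_, .inr (by omega)⟩⟩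
    · simpa using hV0 .v (by simp [Lab.Mem]; omega)
    · simpa using hV0 .w (by simp [Lab.Mem]; omega)
    · simpa using hV0 (.x ⟨1, h'⟩) (by simp [Lab.Mem]; omega)

theorem exists_colSum_eq (hm : 3 ≤ m) (hj : 2 ≤ j) (hV0 : ∀ l : Lab m, ¬ l.Mem m j → V l = 0)
    (hV : ∀ τ : Lab m, τ.Mem m (j - 1) → colSum k j V τ = 0) :
    ∃ W : Lab m → C k m, (∀ l : Lab m, ¬ l.Mem m (j + 1) → W l = 0) ∧
      ∀ σ : Lab m, σ.Mem m j → V σ = colSum k (j + 1) W σ := by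
  have hN := cycle_N hm hj hV0 hV
  obtain ⟨ha, ht⟩ := cycle_a_top hm hj hV0 hV
  obtain ⟨f, hf, hP⟩ := cycle_P hm hj hV0 hV
  obtain ⟨D, hD, hS⟩ := cycle_S hm hj hV0 hV
  obtain ⟨E, hE, hz1⟩ := cycle_z_one hj hV0 hV
  choose Z hZ hz using cycle_z hj hV0 hV
  choose X Y cv cw hX hY hc hxy using cycle_xy hj hV0 hV
  obtain ⟨A, g, hA, hg, hb⟩ := cycle_b hm hj hV0 hV
  obtain ⟨B, hB, hv, hw, hxy1⟩ := cycle_v hj hV0 hV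
  have h1 : 1 < m := by omega
  let W : Lab m → C k m := fun
    | .unit => 0
    | .N c => if c = 0 then f else 0
    | .P c => D c
    | .S c => E c
    | .v => cv ⟨1, h1⟩
    | .w => cw ⟨1, h1⟩
    | .x i => X i
    | .y i => Y i
    | .z i => Z i
    | .a c => A c
    | .b c => B c
    | .top => g
  refine ⟨W, fun l hl => ?_, fun σ hσ => ?_⟩
  · cases l with
    | unit => rfl
    | N c =>
      by_cases hc0 : c = 0
      · simp only [Lab.Mem, if_pos hc0] at hl
        exact (if_pos hc0).trans (hf (by omega))
      · exact if_neg hc0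
    | P c => exact congrFun (hD fun h => hl (by simp [Lab.Mem]; omega)) c
    | S c => exact congrFun (hE fun h => hl (by simp [Lab.Mem]; omega)) c
    | v => exact (hc _ fun h => hl (by simp [Lab.Mem]; omega)).1
    | w => exact (hc _ fun h => hl (by simp [Lab.Mem]; omega)).2
    | x i => exact hX i fun h => hl (by simp [Lab.Mem]; omega)
    | y i => exact hY i fun h => hl (by simp [Lab.Mem]; omega)
    | z i => exact hZ i fun h => hl (by simp [Lab.Mem]; omega)
    | a c => exact congrFun (hA fun h => hl (by simp [Lab.Mem]; omega)) c
    | b c =>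
      refine hB c fun h => hl ⟨by omega, ?_⟩
      split_ifs at h ⊢ <;> omega
    | top => exact hg hl
  · cases σ with
    | unit => exact absurd hσ (by simp [Lab.Mem]; omega)
    | N c => rw [colSum_N, hN]
    | a c => rw [colSum_a, ha]
    | top => rw [colSum_top, ht]
    | P d =>
      rw [colSum_P _ _ (by omega), hP]
      simp [W]
    | S d => rw [colSum_S, hS]
    | b d => rw [colSum_b, hb]
    | v => rw [colSum_v, hv]
    | w => rw [colSum_w, hw]
    | z i =>
      rw [colSum_z _ _ _ hσ.2.1]
      obtain ⟨i, hi, rfl⟩ : ∃ (i' : ℕ) (h : i' + 1 < m), i = ⟨i' + 1, h⟩ :=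
        ⟨i - 1, by have := hσ.2.1; omega, Fin.ext (Nat.sub_add_cancel hσ.2.1).symm⟩
      rcases Nat.eq_zero_or_pos i with rfl | hi0
      · simp [hz1, W]
      · simp [atIdx, W, Nat.lt_of_succ_lt hi, hi0.ne', hz ⟨i, Nat.lt_of_succ_lt hi⟩ hi hi0]
    | y i =>
      rw [colSum_y _ _ _ hσ.2.1]
      obtain ⟨i, hi, rfl⟩ : ∃ (i' : ℕ) (h : i' + 1 < m), i = ⟨i' + 1, h⟩ :=
        ⟨i - 1, by have := hσ.2.1; omega, Fin.ext (Nat.sub_add_cancel hσ.2.1).symm⟩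
      rcases Nat.eq_zero_or_pos i with rfl | hi0
      · have := ((hxy1 hi).2).resolve_right (by have := hσ.2.2; simp at this; omega)
        simp [this, W]
      · simp [atIdx, W, Nat.lt_of_succ_lt hi, hi0.ne',
          (hxy ⟨i, Nat.lt_of_succ_lt hi⟩ hi hi0).2]
    | x i =>
      rw [colSum_x _ _ _ hσ.2.1]
      obtain ⟨i, hi, rfl⟩ : ∃ (i' : ℕ) (h : i' + 1 < m), i = ⟨i' + 1, h⟩ :=
        ⟨i - 1, by have := hσ.2.1; omega, Fin.ext (Nat.sub_add_cancel hσ.2.1).symm⟩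
      rcases Nat.eq_zero_or_pos i with rfl | hi0
      · simp [(hxy1 hi).1, W]
      · have h2 := (hxy ⟨i, Nat.lt_of_succ_lt hi⟩ hi hi0).1
        by_cases hi1 : i = 1
        · subst hi1
          simp [atIdx, W, h1, h2]
        · have h3 := hc ⟨i, Nat.lt_of_succ_lt hi⟩ (by simp [hi1])
          simp [atIdx, W, Nat.lt_of_succ_lt hi, hi0.ne', hi1, h2, h3.1, h3.2]

end Core

/-! ### `P` is a minimal graded resolution -/

section Resolution

variable (k : Type*) [Field k] {m : ℕ}

theorem lam_exact_succ (hm : 3 ≤ m) (i : ℕ) :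
    Function.Exact (Matrix.vecMulLinear (lam k m (i + 1))) (Matrix.vecMulLinear (lam k m i)) := by
  intro v
  constructor
  · intro hv
    match i, v, hv with
    | 0, v, hv => exact mem_range_lam_one k hm v (congrFun hv (idxUnit m))
    | i + 1, v, hv =>
      obtain ⟨W, hW0, hW⟩ := exists_colSum_eq (j := i + 2) (V := extLab v) hm (by omega)
        (fun l hl => extLab_of_not_mem _ hl) fun τ hτ => by
          rw [← vecMulLinear_lam_succ k v ⟨τ, hτ⟩, hv]
          rfl
      refine ⟨fun ρ => W ρ.1, ?_⟩
      funext σ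
      have h : extLab (fun ρ : Idx m (i + 3) => W ρ.1) = W := by
        funext l
        by_cases hl : l.Mem m (i + 3)
        · rw [extLab_of_mem _ hl]
        · rw [extLab_of_not_mem _ hl, hW0 l hl]
      rw [vecMulLinear_lam_succ, h, ← hW σ.1 σ.2, extLab_of_mem _ σ.2]
  · rintro ⟨w, rfl⟩
    rw [Matrix.vecMulLinear_apply, Matrix.vecMulLinear_apply, Matrix.vecMul_vecMul,
      lam_mul_lam k hm, Matrix.vecMul_zero]

theorem isEmpty_idx {j : ℕ} (hm : 3 ≤ m) (hj : m < j) : IsEmpty (Idx m j) := by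
  refine ⟨fun ⟨l, hl⟩ => ?_⟩
  cases l <;> simp only [Lab.Mem] at hl <;> try omega
  all_goals split_ifs at hl <;> omega

theorem idx_zero_eq (hm : 3 ≤ m) (e : Idx m 0) : e = idxUnit m := by
  obtain ⟨l, hl⟩ := e
  refine Subtype.ext ?_
  cases l <;> simp only [Lab.Mem] at hl <;> try omega
  · rfl
  all_goals
    split_ifs at hl
    omega

theorem isMinimalGradedResolution (hm : 3 ≤ m) :
    IsMinimalGradedResolution (gradeC k m) (augC k m) (Idx m) (fun j l => l.1.deg m j) (idxUnit m)
      (lam k m) where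
  unique := idx_zero_eq hm
  deg_zero := rfl
  homogeneous i ρ σ := (lam_homogeneous k hm i ρ σ).imp_right fun ⟨d, _, h⟩ => ⟨d, h⟩
  minimal i ρ σ := by
    rcases lam_homogeneous k hm i ρ σ with h | ⟨d, hd, _, h⟩
    · rw [h]
      exact zero_mem _
    · exact mem_Aplus_of_mem _ hd h
  exact_zero := lam_exact_zero k hm
  exact_succ := lam_exact_succ k hm

end Resolution

end QuadExt

namespace QuadExt

open CategoryTheory

/-! ### Projective dimension in short exact sequences -/

section ProjectiveDimension

universe v

variable {A : Type v} [Ring A] {X Y Z : Type v} [AddCommGroup X] [AddCommGroup Y] [AddCommGroup Z]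
variable [Module A X] [Module A Y] [Module A Z]

/-- The module `X` has projective dimension less than `n`. -/
abbrev PdLT (A X : Type v) [Ring A] [AddCommGroup X] [Module A X] (n : ℕ) : Prop :=
  HasProjectiveDimensionLT (ModuleCat.of A X) n

theorem exists_shortExact {f : X →ₗ[A] Y} {g : Y →ₗ[A] Z} (hf : Function.Injective f)
    (hg : Function.Surjective g) (h : Function.Exact f g) :
    ∃ S : ShortComplex (ModuleCat.{v} A), S.ShortExact ∧ S.X₁ = ModuleCat.of A X ∧
      S.X₂ = ModuleCat.of A Y ∧ S.X₃ = ModuleCat.of A Z := by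
  let S : ShortComplex (ModuleCat.{v} A) :=
    ShortComplex.mk (ModuleCat.ofHom f) (ModuleCat.ofHom g) (by
      ext x
      exact h.apply_apply_eq_zero x)
  exact ⟨S, ModuleCat.shortComplex_shortExact S h hf hg, rfl, rfl, rfl⟩

theorem PdLT.mid {f : X →ₗ[A] Y} {g : Y →ₗ[A] Z} (hf : Function.Injective f)
    (hg : Function.Surjective g) (h : Function.Exact f g) {n : ℕ} (h1 : PdLT A X n)
    (h3 : PdLT A Z n) : PdLT A Y n := by
  obtain ⟨S, hS, e1, e2, e3⟩ := exists_shortExact hf hg h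
  unfold PdLT at *
  rw [← e2]
  rw [← e1] at h1
  rw [← e3] at h3
  exact hS.hasProjectiveDimensionLT_X₂ n h1 h3

theorem PdLT.right {f : X →ₗ[A] Y} {g : Y →ₗ[A] Z} (hf : Function.Injective f)
    (hg : Function.Surjective g) (h : Function.Exact f g) [Module.Projective A Y] {n : ℕ}
    (h1 : PdLT A X n) : PdLT A Z (n + 1) := by
  have h2 : Projective (ModuleCat.of A Y) := (IsProjective.iff_projective Y).1 inferInstance
  obtain ⟨S, hS, e1, e2, e3⟩ := exists_shortExact hf hg h
  unfold PdLT at *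
  rw [← e3]
  rw [← e1] at h1
  rw [← e2] at h2
  have h2' : HasProjectiveDimensionLT S.X₂ 1 := inferInstance
  exact hS.hasProjectiveDimensionLT_X₃ n h1 (hasProjectiveDimensionLT_of_ge _ 1 _ (by omega))

theorem PdLT.left {f : X →ₗ[A] Y} {g : Y →ₗ[A] Z} (hf : Function.Injective f)
    (hg : Function.Surjective g) (h : Function.Exact f g) [Module.Projective A Y] {n : ℕ}
    (h3 : PdLT A Z (n + 2)) : PdLT A X (n + 1) := by
  have h2 : Projective (ModuleCat.of A Y) := (IsProjective.iff_projective Y).1 inferInstance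
  obtain ⟨S, hS, e1, e2, e3⟩ := exists_shortExact hf hg h
  unfold PdLT at *
  rw [← e1]
  rw [← e3] at h3
  rw [← e2] at h2
  exact (hS.hasProjectiveDimensionLT_X₃_iff n h2).1 h3

theorem pdLT_of_retract (i : X →ₗ[A] Y) (r : Y →ₗ[A] X) (h : ∀ x, r (i x) = x) {n : ℕ}
    (hY : PdLT A Y n) : PdLT A X n := by
  let e : Retract (ModuleCat.of A X) (ModuleCat.of A Y) :=
    { i := ModuleCat.ofHom i
      r := ModuleCat.ofHom r
      retract := by
        ext x
        exact h x }
  exact e.hasProjectiveDimensionLT n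

theorem pdLT_of_subsingleton [Subsingleton X] (n : ℕ) : PdLT A X n := by
  have h : Limits.IsZero (ModuleCat.of A X) := ModuleCat.isZero_of_subsingleton _
  have := h.hasProjectiveDimensionLT_zero
  exact hasProjectiveDimensionLT_of_ge _ 0 _ (Nat.zero_le _)

theorem pdLT_one_iff : PdLT A X 1 ↔ Module.Projective A X :=
  projective_iff_hasProjectiveDimensionLT_one.symm.trans (IsProjective.iff_projective X).symm

/-- If `0 → ker g → Y → range g → 0` is given with `Y` projective and `ker g = range f`. -/
theorem pdLT_range_iff (f : X →ₗ[A] Y) (g : Y →ₗ[A] Z) (h : Function.Exact f g)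
    [Module.Projective A Y] {n : ℕ} :
    (PdLT A (LinearMap.range f) n → PdLT A (LinearMap.range g) (n + 1)) ∧
      (PdLT A (LinearMap.range g) (n + 2) → PdLT A (LinearMap.range f) (n + 1)) := by
  have h1 : Function.Injective (LinearMap.range f).subtype := Subtype.val_injective
  have h2 : Function.Surjective g.rangeRestrict := LinearMap.surjective_rangeRestrict g
  have h3 : Function.Exact (LinearMap.range f).subtype g.rangeRestrict := by
    intro y
    rw [← Subtype.coe_inj]
    refine (h y).trans ⟨fun hy => ⟨⟨y, hy⟩, rfl⟩, ?_⟩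
    rintro ⟨⟨_, hx⟩, rfl⟩
    exact hx
  exact ⟨PdLT.right h1 h2 h3, PdLT.left h1 h2 h3⟩

end ProjectiveDimension

theorem exists_linearMap_comp_eq {A X Y Z : Type*} [Ring A] [AddCommGroup X] [AddCommGroup Y]
    [AddCommGroup Z] [Module A X] [Module A Y] [Module A Z] (f : X →ₗ[A] Y) (hf : Function.Surjective f) (h : X →ₗ[A] Z)
    (hk : ∀ x, f x = 0 → h x = 0) : ∃ θ : Y →ₗ[A] Z, ∀ x, θ (f x) = h x := by
  refine ⟨(LinearMap.ker f).liftQ h (fun x hx => hk x hx) ∘ₗ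
    (f.quotKerEquivOfSurjective hf).symm.toLinearMap, fun x => ?_⟩
  have : (f.quotKerEquivOfSurjective hf).symm (f x) = (LinearMap.ker f).mkQ x := by
    rw [LinearEquiv.symm_apply_eq]
    rfl
  rw [LinearMap.comp_apply, LinearEquiv.coe_coe, this]
  exact Submodule.liftQ_apply _ _ _

/-! ### Tensoring a complex of free modules with a vector space -/

section Tensor

open TensorProduct

variable {k A M : Type*} [Field k] [Ring A] [Algebra k A] [AddCommGroup M] [Module k M]

variable (k M) in
/-- Right multiplication by `x` on the left module `A ⊗ M`. -/
noncomputable def tensorRight (x : A) : A ⊗[k] M →ₗ[A] A ⊗[k] M :=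
  AlgebraTensorModule.map (LinearMap.toSpanSingleton A A x) LinearMap.id

@[simp] theorem tensorRight_tmul (x a : A) (μ : M) :
    tensorRight k M x (a ⊗ₜ μ) = (a * x) ⊗ₜ μ := rfl

theorem tensorRight_zero (t : A ⊗[k] M) : tensorRight k M (0 : A) t = 0 := by
  induction t with
  | zero => rw [map_zero]
  | tmul a μ => simp
  | add t t' h h' => rw [map_add, h, h', add_zero]

theorem tensorRight_add (x y : A) (t : A ⊗[k] M) :
    tensorRight k M (x + y) t = tensorRight k M x t + tensorRight k M y t := by
  induction t with
  | zero => simp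
  | tmul a μ => simp [mul_add, add_tmul]
  | add t t' h h' => rw [map_add, h, h', map_add, map_add]; abel

theorem tensorRight_sum {ι : Type*} (s : Finset ι) (x : ι → A) (t : A ⊗[k] M) :
    tensorRight k M (∑ i ∈ s, x i) t = ∑ i ∈ s, tensorRight k M (x i) t := by
  classical
  induction s using Finset.induction_on with
  | empty => simp [tensorRight_zero]
  | insert i s hi h => rw [Finset.sum_insert hi, Finset.sum_insert hi, tensorRight_add, h]

theorem tensorRight_smul (c : k) (x : A) (t : A ⊗[k] M) :
    tensorRight k M (c • x) t = c • tensorRight k M x t := by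
  induction t with
  | zero => simp
  | tmul a μ => simp [smul_tmul']
  | add t t' h h' => rw [map_add, h, h', map_add, smul_add]

theorem tensorRight_tensorRight (x y : A) (t : A ⊗[k] M) :
    tensorRight k M y (tensorRight k M x t) = tensorRight k M (x * y) t := by
  induction t with
  | zero => simp
  | tmul a μ => simp [mul_assoc]
  | add t t' h h' => rw [map_add, map_add, h, h', map_add]

variable {I J K : Type} [Fintype I] [Fintype J] [Fintype K]

variable (k M) in
/-- The map that a matrix defines after tensoring the map of free modules with `M`. -/
noncomputable def tensorMatrix (Λ : Matrix I J A) : (I → A ⊗[k] M) →ₗ[A] (J → A ⊗[k] M) :=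
  LinearMap.pi fun σ => ∑ ρ, tensorRight k M (Λ ρ σ) ∘ₗ LinearMap.proj ρ

theorem tensorMatrix_apply (Λ : Matrix I J A) (w : I → A ⊗[k] M) (σ : J) :
    tensorMatrix k M Λ w σ = ∑ ρ, tensorRight k M (Λ ρ σ) (w ρ) := by
  simp [tensorMatrix]

/-- An exact sequence of `k`-spaces is contractible at each place, and the contraction survives
tensoring with `M`. It is written out in matrix entries because the modules are finite families of
copies of `A ⊗ M`. -/
theorem tensorMatrix_exact {Λ : Matrix I J A} {Λ' : Matrix J K A}
    (h : Function.Exact (Matrix.vecMulLinear Λ) (Matrix.vecMulLinear Λ')) :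
    Function.Exact (tensorMatrix k M Λ) (tensorMatrix k M Λ') := by
  classical
  intro v
  constructor
  · intro hv
    obtain ⟨s, hs⟩ := exists_generalizedInverse ((Matrix.vecMulLinear Λ).restrictScalars k)
    obtain ⟨q, hq⟩ := exists_generalizedInverse ((Matrix.vecMulLinear Λ').restrictScalars k)
    let d' : (J → A) →ₗ[k] (K → A) := (Matrix.vecMulLinear Λ').restrictScalars k
    let s' : (J → A) →ₗ[k] (I → A) := s ∘ₗ (LinearMap.id - q ∘ₗ d')
    -- This is the contraction at the middle term. It is only `k`-linear, so its entries act on `A ⊗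
    -- M` through `rTensor`.
    have key : ∀ y : J → A, y = Matrix.vecMulLinear Λ (s' y) + q (d' y) := by
      intro y
      have h1 : Matrix.vecMulLinear Λ' (y - q (d' y)) = 0 := by
        rw [map_sub, sub_eq_zero]
        exact (hq y).symm
      obtain ⟨u, hu⟩ := (h _).1 h1
      have h2 : Matrix.vecMulLinear Λ (s' y) = y - q (d' y) := by
        change Matrix.vecMulLinear Λ (s (y - q (d' y))) = _
        rw [← hu]
        exact hs u
      rw [h2, sub_add_cancel]
    let S : I → J → A →ₗ[k] A := fun ρ σ =>
      LinearMap.proj ρ ∘ₗ s' ∘ₗ LinearMap.single k (fun _ : J => A) σ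
    let Q : K → J → A →ₗ[k] A := fun κ σ =>
      LinearMap.proj σ ∘ₗ q ∘ₗ LinearMap.single k (fun _ : K => A) κ
    have key2 : ∀ (σ σ' : J) (a : A), (if σ' = σ then a else 0) =
        ∑ ρ, S ρ σ' a * Λ ρ σ + ∑ κ, Q κ σ (a * Λ' σ' κ) := by
      intro σ σ' a
      have h1 := congrFun (key (Pi.single σ' a)) σ
      have h2 : q (d' (Pi.single σ' a)) = ∑ κ, q (Pi.single κ (a * Λ' σ' κ)) := by
        rw [← map_sum]
        congr 1
        funext κ
        simp [d', Matrix.vecMulLinear, Pi.single_apply]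
      rw [Pi.add_apply, h2, Finset.sum_apply, Pi.single_apply] at h1
      rw [← if_congr eq_comm rfl rfl, h1]
      rfl
    have key3 : ∀ (σ σ' : J) (t : A ⊗[k] M), (if σ' = σ then t else 0) =
        ∑ ρ, tensorRight k M (Λ ρ σ) ((S ρ σ').rTensor M t) +
          ∑ κ, (Q κ σ).rTensor M (tensorRight k M (Λ' σ' κ) t) := by
      intro σ σ' t
      induction t with
      | zero => simp
      | tmul a μ =>
        simp only [LinearMap.rTensor_tmul, tensorRight_tmul, ← sum_tmul, ← add_tmul]
        rw [← key2, ite_tmul]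
      | add t t' h h' =>
        simp only [map_add, Finset.sum_add_distrib]
        rw [add_add_add_comm, ← h, ← h']
        split_ifs <;> simp
    refine ⟨fun ρ => ∑ σ', (S ρ σ').rTensor M (v σ'), ?_⟩
    funext σ
    have h1 : v σ = ∑ σ', (if σ' = σ then v σ' else 0) := by simp
    rw [tensorMatrix_apply, h1, Finset.sum_congr rfl fun σ' _ => key3 σ σ' (v σ'),
      Finset.sum_add_distrib]
    have h2 : ∑ σ', ∑ κ, (Q κ σ).rTensor M (tensorRight k M (Λ' σ' κ) (v σ')) = 0 := by
      rw [Finset.sum_comm]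
      refine Finset.sum_eq_zero fun κ _ => ?_
      rw [← map_sum, ← tensorMatrix_apply, hv, Pi.zero_apply, map_zero]
    rw [h2, add_zero, Finset.sum_comm]
    exact Finset.sum_congr rfl fun ρ _ => map_sum _ _ _
  · rintro ⟨w, rfl⟩
    funext κ
    have h1 : ∀ ρ, ∑ σ, Λ ρ σ * Λ' σ κ = 0 := by
      intro ρ
      have := congrFun (h.apply_apply_eq_zero (unitVec A ρ)) κ
      rw [vecMulLinear_unitVec] at this
      exact this
    rw [tensorMatrix_apply]
    simp only [tensorMatrix_apply, map_sum, tensorRight_tensorRight]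
    rw [Finset.sum_comm]
    simp only [← tensorRight_sum, h1, tensorRight_zero, Finset.sum_const_zero, Pi.zero_apply]

end Tensor

end QuadExt

namespace QuadExt

open TensorProduct

/-! ### The grading of `A ⊗ M` with `M` in degree zero -/

section Components

variable {k A M : Type*} [Field k] [Ring A] [Algebra k A] [AddCommGroup M] [Module k M]
variable (𝒜 : ℕ → Submodule k A) [GradedAlgebra 𝒜]

variable (A) in
/-- The action of an endomorphism of `M` on the left module `A ⊗ M`. -/
noncomputable def tensorEnd (f : Module.End k M) : A ⊗[k] M →ₗ[A] A ⊗[k] M :=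
  AlgebraTensorModule.map LinearMap.id f

@[simp] theorem tensorEnd_tmul (f : Module.End k M) (a : A) (μ : M) :
    tensorEnd A f (a ⊗ₜ μ) = a ⊗ₜ f μ := rfl

theorem tensorEnd_tensorRight (f : Module.End k M) (x : A) (t : A ⊗[k] M) :
    tensorEnd A f (tensorRight k M x t) = tensorRight k M x (tensorEnd A f t) := by
  induction t with
  | zero => simp
  | tmul a μ => simp
  | add t t' h h' => simp only [map_add, h, h']

theorem tensorEnd_tensorEnd (f g : Module.End k M) (t : A ⊗[k] M) :
    tensorEnd A f (tensorEnd A g t) = tensorEnd A (f * g) t := by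
  induction t with
  | zero => simp
  | tmul a μ => simp
  | add t t' h h' => simp only [map_add, h, h']

theorem tensorEnd_sum {ι : Type*} (s : Finset ι) (f : ι → Module.End k M) (t : A ⊗[k] M) :
    tensorEnd A (∑ i ∈ s, f i) t = ∑ i ∈ s, tensorEnd A (f i) t := by
  induction t with
  | zero => simp
  | tmul a μ => simp [tmul_sum]
  | add t t' h h' => simp only [map_add, h, h', Finset.sum_add_distrib]

theorem tensorEnd_smul (c : k) (f : Module.End k M) (t : A ⊗[k] M) :
    tensorEnd A (c • f) t = c • tensorEnd A f t := by
  induction t with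
  | zero => simp
  | tmul a μ => simp
  | add t t' h h' => simp only [map_add, h, h', smul_add]

theorem tensorEnd_smul_apply (f : Module.End k M) (c : k) (t : A ⊗[k] M) :
    tensorEnd A f (c • t) = c • tensorEnd A f t :=
  ((tensorEnd A f).restrictScalars k).map_smul c t

theorem tensorRight_smul_apply (x : A) (c : k) (t : A ⊗[k] M) :
    tensorRight k M x (c • t) = c • tensorRight k M x t :=
  ((tensorRight k M x).restrictScalars k).map_smul c t

theorem tensorEnd_zero (t : A ⊗[k] M) : tensorEnd A (0 : Module.End k M) t = 0 := by
  induction t with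
  | zero => simp
  | tmul a μ => simp
  | add t t' h h' => simp only [map_add, h, h', add_zero]

variable (M) in
/-- The component of degree `n` in `A ⊗ M`, where `M` has degree zero. -/
noncomputable def tensorComp (n : ℕ) : A ⊗[k] M →ₗ[k] A ⊗[k] M :=
  (GradedAlgebra.proj 𝒜 n).rTensor M

theorem tensorComp_tmul (n : ℕ) (a : A) (μ : M) :
    tensorComp M 𝒜 n (a ⊗ₜ μ) = GradedAlgebra.proj 𝒜 n a ⊗ₜ μ := rfl

theorem tensorComp_tensorEnd (n : ℕ) (f : Module.End k M) (t : A ⊗[k] M) :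
    tensorComp M 𝒜 n (tensorEnd A f t) = tensorEnd A f (tensorComp M 𝒜 n t) := by
  induction t with
  | zero => simp
  | tmul a μ => simp [tensorComp_tmul]
  | add t t' h h' => simp only [map_add, h, h']

theorem tensorComp_succ_tensorRight (n : ℕ) {x : A} (hx : x ∈ 𝒜 1) (t : A ⊗[k] M) :
    tensorComp M 𝒜 (n + 1) (tensorRight k M x t) =
      tensorRight k M x (tensorComp M 𝒜 n t) := by
  induction t with
  | zero => simp
  | tmul a μ =>
    rw [tensorRight_tmul, tensorComp_tmul, tensorComp_tmul, tensorRight_tmul,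
      GradedAlgebra.proj_apply, GradedAlgebra.proj_apply,
      DirectSum.coe_decompose_mul_add_of_right_mem 𝒜 hx]
  | add t t' h h' => simp only [map_add, h, h']

theorem tensorComp_zero_tensorRight {x : A} (hx : x ∈ 𝒜 1) (t : A ⊗[k] M) :
    tensorComp M 𝒜 0 (tensorRight k M x t) = 0 := by
  induction t with
  | zero => simp
  | tmul a μ =>
    rw [tensorRight_tmul, tensorComp_tmul, GradedAlgebra.proj_apply,
      DirectSum.coe_decompose_mul_of_right_mem_of_not_le 𝒜 hx (by omega), zero_tmul]
  | add t t' h h' => simp only [map_add, h, h', add_zero]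

theorem tensorComp_tensorComp (n n' : ℕ) (t : A ⊗[k] M) :
    tensorComp M 𝒜 n (tensorComp M 𝒜 n' t) = if n' = n then tensorComp M 𝒜 n t else 0 := by
  induction t with
  | zero => simp
  | tmul a μ =>
    simp only [tensorComp_tmul, GradedAlgebra.proj_apply]
    rw [DirectSum.decompose_coe, DirectSum.coe_of_apply]
    split_ifs with h
    · rw [h]
    · simp
  | add t t' h h' =>
    simp only [map_add, h, h']
    split_ifs <;> simp

theorem exists_eq_sum_tensorComp (t : A ⊗[k] M) :
    ∃ N, ∀ n, N ≤ n → t = ∑ i ∈ Finset.range n, tensorComp M 𝒜 i t := by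
  classical
  induction t with
  | zero => exact ⟨0, fun n _ => by simp⟩
  | tmul a μ =>
    refine ⟨(DirectSum.decompose 𝒜 a).support.sup id + 1, fun n hn => ?_⟩
    simp only [tensorComp_tmul, ← sum_tmul, GradedAlgebra.proj_apply]
    congr 1
    conv_lhs => rw [← DirectSum.sum_support_decompose 𝒜 a]
    refine Finset.sum_subset (fun i hi => ?_) fun i _ hi => ?_
    · have := Finset.le_sup (f := id) hi
      simp only [id] at this
      exact Finset.mem_range.2 (by omega)
    · simpa using hi
  | add t t' h h' =>
    obtain ⟨N, h⟩ := h
    obtain ⟨N', h'⟩ := h'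
    refine ⟨max N N', fun n hn => ?_⟩
    simp only [map_add, Finset.sum_add_distrib]
    rw [← h n (le_trans (le_max_left _ _) hn), ← h' n (le_trans (le_max_right _ _) hn)]

theorem exists_tensorComp_eq_zero (t : A ⊗[k] M) :
    ∃ N, ∀ n, N ≤ n → tensorComp M 𝒜 n t = 0 := by
  obtain ⟨N, h⟩ := exists_eq_sum_tensorComp 𝒜 t
  refine ⟨N, fun n hn => ?_⟩
  have h1 := h (n + 1) (by omega)
  rw [Finset.sum_range_succ, ← h n hn] at h1
  exact left_eq_add.1 h1

theorem eq_zero_of_tensorComp {t : A ⊗[k] M} (ht : ∀ n, tensorComp M 𝒜 n t = 0) : t = 0 := by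
  obtain ⟨N, h⟩ := exists_eq_sum_tensorComp 𝒜 t
  rw [h N le_rfl]
  exact Finset.sum_eq_zero fun n _ => ht n

end Components

/-! ### Layered presentations and the kernel of `A ⊗ M → M` -/

section Layers

variable {k A : Type*} [Field k] [Ring A] [Algebra k A]
variable (𝒜 : ℕ → Submodule k A) [GradedAlgebra 𝒜]
variable {J R : Type} [Fintype J] [Fintype R]

/-- A quadratic presentation of `A` whose generators `g` are distributed into layers `lay`. The
relations are `∑ Λ ρ σ * g σ = 0`, with `Λ ρ σ = ∑ κ ρ σ τ • g τ`; in the relation `ρ`, only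
generators of the layer `relLay ρ` occur on the right, and only generators of the preceding layer
occur on the left. -/
structure LayeredPresentation (g : J → A) (Λ : Matrix R J A) (κ : R → J → J → k) (lay : J → ℕ)
    (relLay : R → ℕ) : Prop where
  mem : ∀ σ, g σ ∈ 𝒜 1
  adjoin : Algebra.adjoin k (Set.range g) = ⊤
  rel : ∀ ρ, ∑ σ, Λ ρ σ * g σ = 0
  exact : ∀ v : J → A, ∑ σ, v σ * g σ = 0 → v ∈ LinearMap.range (Matrix.vecMulLinear Λ)
  coeff : ∀ ρ σ, Λ ρ σ = ∑ τ, κ ρ σ τ • g τ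
  lay_right : ∀ ρ σ τ, κ ρ σ τ ≠ 0 → lay σ = relLay ρ
  lay_left : ∀ ρ σ τ, κ ρ σ τ ≠ 0 → lay τ + 1 = relLay ρ

variable {𝒜} {g : J → A} {Λ : Matrix R J A} {κ : R → J → J → k} {lay : J → ℕ} {relLay : R → ℕ}
variable {M : Type*} [AddCommGroup M] [Module k M] [Module A M] [IsScalarTower k A M]

namespace LayeredPresentation

theorem tensor_exact (h : LayeredPresentation 𝒜 g Λ κ lay relLay) (v : J → A ⊗[k] M)
    (hv : ∑ σ, tensorRight k M (g σ) (v σ) = 0) : ∃ c, v = tensorMatrix k M Λ c := by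
  have h1 : Function.Exact (Matrix.vecMulLinear Λ)
      (Matrix.vecMulLinear (Matrix.of fun σ (_ : Unit) => g σ)) := by
    intro w
    constructor
    · intro hw
      exact h.exact w (congrFun hw ())
    · rintro ⟨u, rfl⟩
      rw [Matrix.vecMulLinear_apply, Matrix.vecMulLinear_apply, Matrix.vecMul_vecMul]
      have : Λ * (Matrix.of fun σ (_ : Unit) => g σ) = 0 := by
        ext ρ _
        exact h.rel ρ
      rw [this, Matrix.vecMul_zero]
  obtain ⟨c, hc⟩ := (tensorMatrix_exact h1 v).1 (funext fun _ => by
    rw [tensorMatrix_apply]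
    exact hv)
  exact ⟨c, hc.symm⟩

theorem mem_one (h : LayeredPresentation 𝒜 g Λ κ lay relLay) (ρ : R) (σ : J) : Λ ρ σ ∈ 𝒜 1 := by
  rw [h.coeff]
  exact sum_mem fun τ _ => Submodule.smul_mem _ _ (h.mem τ)

theorem eq_zero (h : LayeredPresentation 𝒜 g Λ κ lay relLay) {ρ : R} {σ : J}
    (hl : lay σ ≠ relLay ρ) : Λ ρ σ = 0 := by
  rw [h.coeff]
  refine Finset.sum_eq_zero fun τ _ => ?_
  by_cases h0 : κ ρ σ τ = 0
  · rw [h0, zero_smul]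
  · exact absurd (h.lay_right ρ σ τ h0) hl

variable (k M) in
/-- The map `(a_σ)_σ ↦ ∑ (a_σ g_σ ⊗ - - a_σ ⊗ g_σ -)` onto the kernel of `A ⊗ M → M`. -/
noncomputable def diffMap (g : J → A) : (J → A ⊗[k] M) →ₗ[A] A ⊗[k] M :=
  ∑ σ, (tensorRight k M (g σ) - tensorEnd A (Algebra.lsmul k k M (g σ))) ∘ₗ LinearMap.proj σ

theorem diffMap_apply (a : J → A ⊗[k] M) : diffMap k M g a =
    ∑ σ, (tensorRight k M (g σ) (a σ) - tensorEnd A (Algebra.lsmul k k M (g σ)) (a σ)) := by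
  simp [diffMap]

variable (k M) in
open scoped Classical in
/-- The map `(a_σ)_σ ↦ ∑ a_σ g_σ`, where the sum is over the generators of layer `j`. -/
noncomputable def layerMap (g : J → A) (lay : J → ℕ) (j : ℕ) : (J → A ⊗[k] M) →ₗ[A] A ⊗[k] M :=
  ∑ σ, if lay σ = j then tensorRight k M (g σ) ∘ₗ LinearMap.proj σ else 0

theorem layerMap_apply (j : ℕ) (a : J → A ⊗[k] M) : layerMap k M g lay j a =
    ∑ σ, if lay σ = j then tensorRight k M (g σ) (a σ) else 0 := by
  rw [layerMap, LinearMap.sum_apply]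
  refine Finset.sum_congr rfl fun σ _ => ?_
  split_ifs <;> rfl

theorem layerMap_eq_zero {j : ℕ} {a : J → A ⊗[k] M} (ha : ∀ σ, lay σ = j → a σ = 0) :
    layerMap k M g lay j a = 0 := by
  rw [layerMap_apply]
  refine Finset.sum_eq_zero fun σ _ => ?_
  split_ifs with h
  · rw [ha σ h, map_zero]
  · rfl

/-- All generators on the right of a relation lie in one layer. Restricting the relation to a layer
therefore gives either the whole relation or nothing. -/
theorem layerMap_tensorMatrix (h : LayeredPresentation 𝒜 g Λ κ lay relLay) (j : ℕ)
    (c : R → A ⊗[k] M) : layerMap k M g lay j (tensorMatrix k M Λ c) = 0 := by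
  have h1 : ∀ ρ, ∑ σ, (if lay σ = j then Λ ρ σ * g σ else 0) = 0 := by
    intro ρ
    by_cases hρ : relLay ρ = j
    · refine (Finset.sum_congr rfl fun σ _ => ?_).trans (h.rel ρ)
      split_ifs with hσ
      · rfl
      · rw [h.eq_zero (by rw [hρ]; exact hσ), zero_mul]
    · refine Finset.sum_eq_zero fun σ _ => ?_
      split_ifs with hσ
      · rw [h.eq_zero (by rw [hσ]; exact Ne.symm hρ), zero_mul]
      · rfl
  have h2 : layerMap k M g lay j (tensorMatrix k M Λ c) =
      ∑ ρ, tensorRight k M (∑ σ, (if lay σ = j then Λ ρ σ * g σ else 0)) (c ρ) := by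
    rw [layerMap_apply]
    simp only [tensorRight_sum]
    rw [Finset.sum_comm]
    refine Finset.sum_congr rfl fun σ _ => ?_
    split_ifs with hσ
    · simp only [tensorMatrix_apply, map_sum, tensorRight_tensorRight]
    · simp [tensorRight_zero]
  rw [h2]
  simp [h1, tensorRight_zero]

variable (k M) in
/-- The family that replaces `tensorMatrix k M Λ c` under `diffMap`. -/
noncomputable def shift (g : J → A) (κ : R → J → J → k) (c : R → A ⊗[k] M) (τ : J) : A ⊗[k] M :=
  -∑ ρ, ∑ σ, κ ρ σ τ • tensorEnd A (Algebra.lsmul k k M (g σ)) (c ρ)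

/-- On the left the part `∑ a_σ g_σ` vanishes because `Λ` consists of relations; on the right the
part acting on `M` vanishes because `M` satisfies the same relations. The two remaining parts agree:
both are `-∑ κ ρ σ τ (c_ρ g_τ)` with `g_σ` acting on `M`. -/
theorem diffMap_tensorMatrix (h : LayeredPresentation 𝒜 g Λ κ lay relLay) (c : R → A ⊗[k] M) :
    diffMap k M g (tensorMatrix k M Λ c) = diffMap k M g (shift k M g κ c) := by
  have h1 : ∑ σ, tensorRight k M (g σ) (tensorMatrix k M Λ c σ) = 0 := by
    simp only [tensorMatrix_apply, map_sum, tensorRight_tensorRight]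
    rw [Finset.sum_comm]
    simp [← tensorRight_sum, h.rel, tensorRight_zero]
  have h2 : ∑ τ, tensorEnd A (Algebra.lsmul k k M (g τ)) (shift k M g κ c τ) = 0 := by
    simp only [shift, map_neg, map_sum, Finset.sum_neg_distrib, neg_eq_zero]
    rw [Finset.sum_comm]
    refine Finset.sum_eq_zero fun ρ _ => ?_
    rw [Finset.sum_comm]
    have h3 : ∀ σ, ∑ τ, tensorEnd A (Algebra.lsmul k k M (g τ))
        (κ ρ σ τ • tensorEnd A (Algebra.lsmul k k M (g σ)) (c ρ)) =
        tensorEnd A (Algebra.lsmul k k M (Λ ρ σ * g σ)) (c ρ) := by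
      intro σ
      rw [map_mul, ← tensorEnd_tensorEnd, h.coeff, map_sum, tensorEnd_sum]
      refine Finset.sum_congr rfl fun τ _ => ?_
      rw [tensorEnd_smul_apply, map_smul (Algebra.lsmul k k M), tensorEnd_smul]
    simp only [h3]
    rw [← tensorEnd_sum, ← map_sum, h.rel, map_zero, tensorEnd_zero]
  rw [diffMap_apply, diffMap_apply, Finset.sum_sub_distrib, Finset.sum_sub_distrib, h1, h2, zero_sub,
    sub_zero]
  simp only [shift, map_neg, map_sum, tensorMatrix_apply, Finset.sum_neg_distrib]
  congr 1
  have h3 : ∀ F : J → R → J → A ⊗[k] M,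
      ∑ τ, ∑ ρ, ∑ σ, F τ ρ σ = ∑ ρ, ∑ σ, ∑ τ, F τ ρ σ := by
    intro F
    rw [Finset.sum_comm]
    exact Finset.sum_congr rfl fun ρ _ => Finset.sum_comm
  rw [Finset.sum_comm, h3]
  refine Finset.sum_congr rfl fun ρ _ => Finset.sum_congr rfl fun σ _ => ?_
  rw [tensorEnd_tensorRight, h.coeff, tensorRight_sum]
  refine Finset.sum_congr rfl fun τ _ => ?_
  rw [tensorRight_smul, tensorRight_smul_apply]

/-- The left factors of a relation lie one layer below its right factors, so `shift` lowers the
layer by at least one. -/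
theorem shift_eq_zero (h : LayeredPresentation 𝒜 g Λ κ lay relLay) {j : ℕ} {c : R → A ⊗[k] M}
    (hc : ∀ ρ, j < relLay ρ → c ρ = 0) {τ : J} (hτ : j ≤ lay τ) : shift k M g κ c τ = 0 := by
  rw [shift, neg_eq_zero]
  refine Finset.sum_eq_zero fun ρ _ => Finset.sum_eq_zero fun σ _ => ?_
  by_cases h0 : κ ρ σ τ = 0
  · rw [h0, zero_smul]
  · have := h.lay_left ρ σ τ h0
    rw [hc ρ (by omega), map_zero, smul_zero]

/-- A family of layers up to `j` that comes from `c` comes from the relations of layers up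
to `j`. -/
theorem tensorMatrix_restrict (h : LayeredPresentation 𝒜 g Λ κ lay relLay) {j : ℕ}
    {c : R → A ⊗[k] M} (hc : ∀ σ, j < lay σ → tensorMatrix k M Λ c σ = 0) :
    tensorMatrix k M Λ c = tensorMatrix k M Λ (fun ρ => if relLay ρ ≤ j then c ρ else 0) := by
  funext σ
  by_cases hσ : j < lay σ
  · rw [hc σ hσ, tensorMatrix_apply, eq_comm]
    refine Finset.sum_eq_zero fun ρ _ => ?_
    split_ifs with hρ
    · rw [h.eq_zero (by omega), tensorRight_zero]
    · rw [map_zero]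
  · rw [tensorMatrix_apply, tensorMatrix_apply]
    refine Finset.sum_congr rfl fun ρ _ => ?_
    split_ifs with hρ
    · rfl
    · rw [h.eq_zero (by omega), tensorRight_zero, map_zero]

theorem tensorComp_tensorMatrix_succ (h : LayeredPresentation 𝒜 g Λ κ lay relLay) (n : ℕ)
    (c : R → A ⊗[k] M) (σ : J) : tensorComp M 𝒜 (n + 1) (tensorMatrix k M Λ c σ) =
      tensorMatrix k M Λ (fun ρ => tensorComp M 𝒜 n (c ρ)) σ := by
  rw [tensorMatrix_apply, tensorMatrix_apply, map_sum]
  exact Finset.sum_congr rfl fun ρ _ => tensorComp_succ_tensorRight 𝒜 n (h.mem_one ρ σ) _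

theorem tensorComp_tensorMatrix_zero (h : LayeredPresentation 𝒜 g Λ κ lay relLay)
    (c : R → A ⊗[k] M) (σ : J) : tensorComp M 𝒜 0 (tensorMatrix k M Λ c σ) = 0 := by
  rw [tensorMatrix_apply, map_sum]
  exact Finset.sum_eq_zero fun ρ _ => tensorComp_zero_tensorRight 𝒜 (h.mem_one ρ σ) _

theorem tensorComp_shift (n : ℕ) (c : R → A ⊗[k] M) (τ : J) :
    tensorComp M 𝒜 n (shift k M g κ c τ) =
      shift k M g κ (fun ρ => tensorComp M 𝒜 n (c ρ)) τ := by
  simp only [shift, map_neg, map_sum, map_smul, tensorComp_tensorEnd]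

theorem shift_zero (τ : J) : shift k M g κ (fun _ => (0 : A ⊗[k] M)) τ = 0 := by
  simp [shift]

/-- Induction on the bound for the degrees. With `M` in degree zero, `diffMap` is a part that raises
the degree by one minus a part that preserves it. The leading component of `a` is therefore a
combination of relations and can be traded, through `shift`, for a family of lower degree and lower
layer. The value of `layerMap` in layer `j` is unchanged. -/
theorem layerMap_eq_zero_of_bounded (h : LayeredPresentation 𝒜 g Λ κ lay relLay) (j : ℕ) :
    ∀ (N : ℕ) (a : J → A ⊗[k] M), (∀ σ, j < lay σ → a σ = 0) →
      (∀ n, N ≤ n → ∀ σ, tensorComp M 𝒜 n (a σ) = 0) → diffMap k M g a = 0 →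
      layerMap k M g lay j a = 0 := by
  intro N
  induction N with
  | zero =>
    intro a _ h0 _
    have : a = 0 := funext fun σ => eq_zero_of_tensorComp 𝒜 fun n => h0 n (Nat.zero_le n) σ
    rw [this, map_zero]
  | succ N ih =>
    intro a hj hN ha
    let b : J → A ⊗[k] M := fun σ => tensorComp M 𝒜 N (a σ)
    have hb : ∑ σ, tensorRight k M (g σ) (b σ) = 0 := by
      have h1 := congrArg (tensorComp M 𝒜 (N + 1)) ha
      rw [diffMap_apply, map_sum, map_zero] at h1
      rw [← h1]
      refine Finset.sum_congr rfl fun σ _ => ?_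
      rw [map_sub, tensorComp_succ_tensorRight 𝒜 N (h.mem σ), tensorComp_tensorEnd,
        hN (N + 1) le_rfl, map_zero, sub_zero]
    have hb2 : ∀ σ, tensorComp M 𝒜 N (b σ) = b σ := fun σ => by
      rw [tensorComp_tensorComp, if_pos rfl]
    obtain ⟨c, hc⟩ := h.tensor_exact b hb
    -- Entries of `Λ` have degree one, so `b`, of degree `N`, needs only the component of `c` of
    -- degree `N - 1`; for `N = 0` it is zero.
    have hex : ∃ c' : R → A ⊗[k] M, b = tensorMatrix k M Λ c' ∧
        ∀ n, N ≤ n → ∀ ρ, tensorComp M 𝒜 n (c' ρ) = 0 := by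
      cases N with
      | zero =>
        refine ⟨fun _ => 0, ?_, fun _ _ _ => map_zero _⟩
        funext σ
        rw [← hb2 σ, hc, h.tensorComp_tensorMatrix_zero, tensorMatrix_apply]
        simp
      | succ N =>
        refine ⟨fun ρ => tensorComp M 𝒜 N (c ρ), ?_, fun n hn ρ => ?_⟩
        · funext σ
          rw [← hb2 σ, hc, h.tensorComp_tensorMatrix_succ]
        · rw [tensorComp_tensorComp, if_neg (by omega)]
    obtain ⟨c', hc', hN'⟩ := hex
    -- Relations above layer `j` are discarded, which is harmless because `b` vanishes there. This
    -- keeps the shifted family strictly below layer `j`.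
    let c'' : R → A ⊗[k] M := fun ρ => if relLay ρ ≤ j then c' ρ else 0
    have hc'' : b = tensorMatrix k M Λ c'' := by
      rw [hc']
      refine h.tensorMatrix_restrict fun σ hσ => ?_
      rw [← hc']
      change tensorComp M 𝒜 N (a σ) = 0
      rw [hj σ hσ, map_zero]
    have hs : ∀ τ, j ≤ lay τ → shift k M g κ c'' τ = 0 := fun τ hτ =>
      h.shift_eq_zero (fun ρ hρ => if_neg (by omega)) hτ
    have hcomp : ∀ n, N ≤ n → ∀ ρ, tensorComp M 𝒜 n (c'' ρ) = 0 := by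
      intro n hn ρ
      simp only [c'']
      split_ifs
      · exact hN' n hn ρ
      · exact map_zero _
    have h1 := ih (a - b + shift k M g κ c'') (fun σ hσ => by
        rw [Pi.add_apply, Pi.sub_apply, hs σ hσ.le, hj σ hσ, add_zero, zero_sub, neg_eq_zero]
        change tensorComp M 𝒜 N (a σ) = 0
        rw [hj σ hσ, map_zero]) (fun n hn σ => by
        rw [Pi.add_apply, Pi.sub_apply, map_add, map_sub, tensorComp_shift]
        simp only [hcomp n hn, shift_zero, add_zero, b]
        rw [tensorComp_tensorComp]
        split_ifs with hnn
        · exact sub_self _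
        · rw [hN n (by omega), sub_zero]) (by
        rw [map_add, map_sub, ha, ← h.diffMap_tensorMatrix, ← hc'', zero_sub, neg_add_cancel])
    rw [map_add, map_sub, layerMap_eq_zero (a := shift k M g κ c'') fun σ hσ => hs σ hσ.ge, add_zero,
      hc'', h.layerMap_tensorMatrix, sub_zero] at h1
    exact h1

theorem layerMap_eq_zero_of_diffMap (h : LayeredPresentation 𝒜 g Λ κ lay relLay) {j : ℕ}
    {a : J → A ⊗[k] M} (hj : ∀ σ, j < lay σ → a σ = 0) (ha : diffMap k M g a = 0) :
    layerMap k M g lay j a = 0 := by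
  choose N hN using fun σ => exists_tensorComp_eq_zero 𝒜 (a σ)
  refine h.layerMap_eq_zero_of_bounded j (Finset.univ.sup N) a hj (fun n hn σ => ?_) ha
  exact hN σ n (le_trans (Finset.le_sup (Finset.mem_univ σ)) hn)

/-- The families in layers below `j`. -/
def belowLayer (A : Type*) [Ring A] [Algebra k A] (M : Type*) [AddCommGroup M] [Module k M]
    (lay : J → ℕ) (j : ℕ) : Submodule A (J → A ⊗[k] M) where
  carrier := {a | ∀ σ, j ≤ lay σ → a σ = 0}
  zero_mem' _ _ := rfl
  add_mem' ha hb σ hσ := by rw [Pi.add_apply, ha σ hσ, hb σ hσ, add_zero]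
  smul_mem' c a ha σ hσ := by rw [Pi.smul_apply, ha σ hσ, smul_zero]

/-- The part of `a` in layer `j` is a combination of relations of layer at most `j`; replacing it by
its shift moves it into lower layers without changing `diffMap`. -/
theorem exists_below_of_layerMap (h : LayeredPresentation 𝒜 g Λ κ lay relLay) {j : ℕ}
    {a : J → A ⊗[k] M} (hj : a ∈ belowLayer (k := k) A M lay (j + 1))
    (ha : layerMap k M g lay j a = 0) :
    ∃ a' ∈ belowLayer (k := k) A M lay j, diffMap k M g a = diffMap k M g a' := by
  classical
  let b : J → A ⊗[k] M := fun σ => if lay σ = j then a σ else 0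
  have hb : ∑ σ, tensorRight k M (g σ) (b σ) = 0 := by
    rw [← ha, layerMap_apply]
    refine Finset.sum_congr rfl fun σ _ => ?_
    simp only [b]
    split_ifs <;> simp
  obtain ⟨c, hc⟩ := h.tensor_exact b hb
  have hc' := hc.trans (h.tensorMatrix_restrict (j := j) fun σ hσ => by
    rw [← hc]
    exact if_neg (by omega))
  refine ⟨a - b + shift k M g κ (fun ρ => if relLay ρ ≤ j then c ρ else 0), fun σ hσ => ?_, ?_⟩
  · rw [Pi.add_apply, Pi.sub_apply, h.shift_eq_zero (fun ρ hρ => if_neg (by omega)) hσ, add_zero]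
    simp only [b]
    split_ifs with hσj
    · exact sub_self _
    · rw [hj σ (by omega), sub_zero]
  · rw [map_add, map_sub, ← h.diffMap_tensorMatrix, ← hc', sub_add_cancel]

end LayeredPresentation

end Layers

end QuadExt

namespace QuadExt

open TensorProduct

namespace LayeredPresentation

universe v

/-! ### Generators of the kernel of the action map -/

section Kernel

variable {k A : Type*} [Field k] [Ring A] [Algebra k A]
variable {𝒜 : ℕ → Submodule k A} [GradedAlgebra 𝒜] {J R : Type} [Fintype J] [Fintype R]
variable {g : J → A} {Λ : Matrix R J A} {κ : R → J → J → k} {lay : J → ℕ} {relLay : R → ℕ}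
variable {M : Type*} [AddCommGroup M] [Module k M] [Module A M] [IsScalarTower k A M]

/-- The multiplication map `A ⊗ M → M`. -/
noncomputable def actionMap (k A M : Type*) [Field k] [Ring A] [Algebra k A] [AddCommGroup M]
    [Module k M] [Module A M] [IsScalarTower k A M] : A ⊗[k] M →ₗ[A] M :=
  AlgebraTensorModule.lift (LinearMap.toSpanSingleton A (M →ₗ[k] M) LinearMap.id)

theorem actionMap_tmul (a : A) (μ : M) : actionMap k A M (a ⊗ₜ μ) = a • μ := rfl

theorem actionMap_diffMap (a : J → A ⊗[k] M) : actionMap k A M (diffMap k M g a) = 0 := by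
  rw [diffMap_apply, map_sum]
  refine Finset.sum_eq_zero fun σ _ => ?_
  rw [map_sub, sub_eq_zero]
  induction a σ with
  | zero => simp
  | tmul x μ =>
    rw [tensorRight_tmul, tensorEnd_tmul, actionMap_tmul, actionMap_tmul, mul_smul]
    rfl
  | add t t' h h' => simp only [map_add, h, h']

theorem sub_mem_range_diffMap (hg : Algebra.adjoin k (Set.range g) = ⊤) (a : A) (μ : M) :
    a ⊗ₜ[k] μ - 1 ⊗ₜ[k] (a • μ) ∈ LinearMap.range (diffMap k M g) := by
  classical
  have ha : a ∈ Algebra.adjoin k (Set.range g) := hg ▸ Algebra.mem_top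
  induction ha using Algebra.adjoin_induction generalizing μ with
  | mem x hx =>
    obtain ⟨σ, rfl⟩ := hx
    refine ⟨Pi.single σ (1 ⊗ₜ μ), ?_⟩
    rw [diffMap_apply, Finset.sum_eq_single σ]
    · simp
    · intro τ _ hτ
      rw [Pi.single_eq_of_ne hτ, map_zero, map_zero, sub_zero]
    · simp
  | algebraMap c =>
    rw [Algebra.algebraMap_eq_smul_one, smul_tmul, smul_assoc, one_smul, sub_self]
    exact zero_mem _
  | add x y _ _ hx hy =>
    rw [add_tmul, add_smul, tmul_add, add_sub_add_comm]
    exact add_mem (hx μ) (hy μ)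
  | mul x y _ _ hx hy =>
    have : (x * y) ⊗ₜ[k] μ - 1 ⊗ₜ[k] ((x * y) • μ) =
        x • (y ⊗ₜ[k] μ - 1 ⊗ₜ[k] (y • μ)) + (x ⊗ₜ[k] (y • μ) - 1 ⊗ₜ[k] (x • y • μ)) := by
      rw [smul_sub, smul_tmul', smul_tmul', smul_eq_mul, smul_eq_mul, mul_one, mul_smul]
      abel
    rw [this]
    exact add_mem (Submodule.smul_mem _ _ (hy μ)) (hx _)

theorem range_diffMap (hg : Algebra.adjoin k (Set.range g) = ⊤) :
    LinearMap.range (diffMap k M g) = LinearMap.ker (actionMap k A M) := by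
  apply le_antisymm
  · rintro _ ⟨a, rfl⟩
    exact actionMap_diffMap a
  · intro t ht
    have key : ∀ t : A ⊗[k] M, t - 1 ⊗ₜ[k] (actionMap k A M t) ∈
        LinearMap.range (diffMap k M g) := by
      intro t
      induction t with
      | zero => simp
      | tmul a μ => exact sub_mem_range_diffMap hg a μ
      | add t t' h h' =>
        rw [map_add, tmul_add, add_sub_add_comm]
        exact add_mem h h'
    have h := key t
    rw [LinearMap.mem_ker.1 ht, tmul_zero, sub_zero] at h
    exact h

end Kernel

/-! ### Projective dimension from the layer filtration -/

section Dimension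

variable {k A : Type v} [Field k] [Ring A] [Algebra k A]
variable {𝒜 : ℕ → Submodule k A} [GradedAlgebra 𝒜] {J R : Type} [Fintype J] [Fintype R]
variable {g : J → A} {Λ : Matrix R J A} {κ : R → J → J → k} {lay : J → ℕ} {relLay : R → ℕ}
variable {M : Type v} [AddCommGroup M] [Module k M] [Module A M] [IsScalarTower k A M]

variable (k M) in
/-- The map `(a_σ)_σ ↦ ∑ a_σ g_σ`, whose image is `A₊ ⊗ M`. -/
noncomputable def sumMap (g : J → A) : (J → A ⊗[k] M) →ₗ[A] A ⊗[k] M :=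
  ∑ σ, tensorRight k M (g σ) ∘ₗ LinearMap.proj σ

theorem sumMap_apply (a : J → A ⊗[k] M) :
    sumMap k M g a = ∑ σ, tensorRight k M (g σ) (a σ) := by
  simp [sumMap]

/-- The contribution of one layer to `A₊ ⊗ M` is a direct summand: the projection onto it is well
defined, since relations can be split by layers. -/
theorem pdLT_range_layerMap (h : LayeredPresentation 𝒜 g Λ κ lay relLay) {n : ℕ}
    (hn : PdLT A (LinearMap.range (sumMap k M g)) n) (j : ℕ) :
    PdLT A (LinearMap.range (layerMap k M g lay j)) n := by
  classical
  have hk : ∀ a : J → A ⊗[k] M, (sumMap k M g).rangeRestrict a = 0 →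
      (layerMap k M g lay j).rangeRestrict a = 0 := by
    intro a ha
    have h1 : ∑ σ, tensorRight k M (g σ) (a σ) = 0 := by
      rw [← sumMap_apply]
      exact congrArg Subtype.val ha
    obtain ⟨c, rfl⟩ := h.tensor_exact a h1
    exact Subtype.ext (h.layerMap_tensorMatrix j c)
  obtain ⟨θ, hθ⟩ := exists_linearMap_comp_eq (Y := LinearMap.range (sumMap k M g))
    (Z := LinearMap.range (layerMap k M g lay j)) _ (LinearMap.surjective_rangeRestrict _) _ hk
  have hres : ∀ a : J → A ⊗[k] M, layerMap k M g lay j a =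
      sumMap k M g (fun σ => if lay σ = j then a σ else 0) := by
    intro a
    rw [layerMap_apply, sumMap_apply]
    refine Finset.sum_congr rfl fun σ _ => ?_
    split_ifs <;> simp
  have hres' : ∀ a : J → A ⊗[k] M, layerMap k M g lay j a =
      layerMap k M g lay j (fun σ => if lay σ = j then a σ else 0) := by
    intro a
    rw [layerMap_apply, layerMap_apply]
    refine Finset.sum_congr rfl fun σ _ => ?_
    split_ifs <;> simp
  have hle : LinearMap.range (layerMap k M g lay j) ≤ LinearMap.range (sumMap k M g) := by
    rintro _ ⟨a, rfl⟩
    exact ⟨_, (hres a).symm⟩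
  refine pdLT_of_retract (Submodule.inclusion hle) θ ?_ hn
  rintro ⟨_, a, rfl⟩
  have h1 : Submodule.inclusion hle ⟨_, a, rfl⟩ = (sumMap k M g).rangeRestrict
      (fun σ => if lay σ = j then a σ else 0) := Subtype.ext (hres a)
  rw [h1, hθ]
  exact Subtype.ext (hres' a).symm

/-- By `layerMap_eq_zero_of_diffMap` the layer map descends to the image of `diffMap`, and its
kernel there is the preceding step of the filtration. Each step is thus an extension by a summand of
`A₊ ⊗ M`. -/
theorem pdLT_map_belowLayer (h : LayeredPresentation 𝒜 g Λ κ lay relLay) {n : ℕ}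
    (hn : PdLT A (LinearMap.range (sumMap k M g)) n) (j : ℕ) :
    PdLT A ((belowLayer (k := k) A M lay j).map (diffMap k M g)) n := by
  induction j with
  | zero =>
    have : Subsingleton ((belowLayer (k := k) A M lay 0).map (diffMap k M g)) := by
      refine ⟨?_⟩
      rintro ⟨_, a, ha, rfl⟩ ⟨_, b, hb, rfl⟩
      have ha0 : a = 0 := funext fun σ => ha σ (Nat.zero_le _)
      have hb0 : b = 0 := funext fun σ => hb σ (Nat.zero_le _)
      exact Subtype.ext (congrArg (diffMap k M g) (ha0.trans hb0.symm))
    exact pdLT_of_subsingleton n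
  | succ j ih =>
    let D := belowLayer (k := k) A M lay j
    let D' := belowLayer (k := k) A M lay (j + 1)
    have hDD : D ≤ D' := fun a ha σ hσ => ha σ (by omega)
    let f : D' →ₗ[A] D'.map (diffMap k M g) := (diffMap k M g).submoduleMap D'
    have hf : Function.Surjective f := (diffMap k M g).submoduleMap_surjective D'
    have hk : ∀ a : D', f a = 0 →
        ((layerMap k M g lay j).rangeRestrict ∘ₗ D'.subtype) a = 0 := fun a ha =>
      Subtype.ext (h.layerMap_eq_zero_of_diffMap (fun σ hσ => a.2 σ hσ)
        (congrArg Subtype.val ha))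
    obtain ⟨θ, hθ⟩ := exists_linearMap_comp_eq (X := D') (Y := D'.map (diffMap k M g))
      (Z := LinearMap.range (layerMap k M g lay j)) f hf _ hk
    have hle : D.map (diffMap k M g) ≤ D'.map (diffMap k M g) := Submodule.map_mono hDD
    refine PdLT.mid (f := Submodule.inclusion hle) (g := θ) (Submodule.inclusion_injective hle)
      ?_ ?_ ih (h.pdLT_range_layerMap hn j)
    · classical
      rintro ⟨_, a, rfl⟩
      let b : J → A ⊗[k] M := fun σ => if lay σ = j then a σ else 0
      have hb : b ∈ D' := fun σ hσ => if_neg (by omega)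
      refine ⟨f ⟨b, hb⟩, ?_⟩
      rw [hθ]
      refine Subtype.ext ?_
      change layerMap k M g lay j b = layerMap k M g lay j a
      rw [layerMap_apply, layerMap_apply]
      refine Finset.sum_congr rfl fun σ _ => ?_
      simp only [b]
      split_ifs <;> rfl
    · intro y
      obtain ⟨a, rfl⟩ := hf y
      rw [hθ]
      constructor
      · intro ha
        obtain ⟨a', ha', e⟩ := h.exists_below_of_layerMap a.2 (congrArg Subtype.val ha)
        exact ⟨⟨_, a', ha', rfl⟩, Subtype.ext e.symm⟩
      · rintro ⟨⟨_, a', ha', rfl⟩, e⟩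
        have e' : f ⟨a', hDD ha'⟩ = f a := by
          rw [← e]
          rfl
        have h1 := hθ ⟨a', hDD ha'⟩
        rw [e', hθ] at h1
        rw [h1]
        exact Subtype.ext (layerMap_eq_zero fun σ hσ => ha' σ hσ.ge)

/-- If `A₊ ⊗ M` has projective dimension less than `n`, then `M` has projective dimension at
most `n`. -/
theorem pdLT_succ (h : LayeredPresentation 𝒜 g Λ κ lay relLay) {n : ℕ}
    (hn : PdLT A (LinearMap.range (sumMap k M g)) n) : PdLT A M (n + 1) := by
  have h1 := h.pdLT_map_belowLayer hn (Finset.univ.sup lay + 1)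
  have h2 : belowLayer (k := k) A M lay (Finset.univ.sup lay + 1) = ⊤ := by
    refine eq_top_iff.2 fun a _ σ hσ => ?_
    have := Finset.le_sup (f := lay) (Finset.mem_univ σ)
    omega
  rw [h2, Submodule.map_top, range_diffMap h.adjoin] at h1
  refine PdLT.right (f := (LinearMap.ker (actionMap k A M)).subtype) (g := actionMap k A M)
    Subtype.val_injective (fun μ => ⟨1 ⊗ₜ μ, by rw [actionMap_tmul, one_smul]⟩) ?_ h1
  exact LinearMap.exact_subtype_ker_map _

end Dimension

end LayeredPresentation

end QuadExt

namespace QuadExt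

open TensorProduct CategoryTheory

/-! ### The layers of `C` -/

section Layers

variable (k : Type*) [Field k] {m : ℕ}

theorem C_neg_one_smul (a : C k m) : (-1 : k) • a = -a := neg_one_smul k a

theorem etaTwo_eq_smul (c : Fin 2) (d : Fin 3) : ∃ a : k, etaTwo k m c d = a • gen k m .n :=
  ⟨!![1, -1, 0; 1, 0, -1] c d, by fin_cases c <;> fin_cases d <;> simp [etaTwo, C_neg_one_smul]⟩

theorem delta_eq_smul (c d : Fin 3) :
    ∃ a : k, delta k m c d = a • gen k m (![.p, .q, .r] c) :=
  ⟨!![-1, 1, 0; 0, -1, 1; -1, 0, 1] c d, by fin_cases c <;> fin_cases d <;> simp [delta, C_neg_one_smul]⟩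

theorem beta_eq_smul (c : Fin 6) (d : Fin 4) :
    ∃ a : k, beta k m c d = a • gen k m (![.s, .t, .u, .s, .t, .u] c) :=
  ⟨!![1, -1, 0, 0; 0, 1, -1, 0; 1, 0, -1, 0; 1, 0, 0, -1; 0, 1, 0, -1; 0, 0, 1, -1] c d, by
    fin_cases c <;> fin_cases d <;> simp [beta, C_neg_one_smul]⟩

/-- The layer of a generator. -/
def Lab.layer : Lab m → ℕ
  | .N _ => 1
  | .P _ => 2
  | .S _ => 3
  | .v => 4
  | .w => 4
  | .x i => i + 3
  | .y i => i + 3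
  | .z i => i + 3
  | _ => 0

/-- The layer of the generators on the right in a relation. -/
def Lab.relLayer : Lab m → ℕ
  | .b _ => 4
  | l => l.layer + 1

theorem lamEntry_two_eq_smul (ρ : Lab m) {σ : Lab m} (hσ : σ.Mem m 1) :
    lamEntry k m 2 ρ σ = 0 ∨ ∃ (a : k) (τ : Gen m), lamEntry k m 2 ρ σ = a • gen k m τ ∧
      σ.layer = ρ.relLayer ∧ τ.lab.layer + 1 = ρ.relLayer := by
  cases ρ <;> cases σ <;> try exact .inl rfl
  case N.P c d =>
    obtain ⟨a, h⟩ := etaTwo_eq_smul k (m := m) c d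
    exact .inr ⟨a, _, h, rfl, rfl⟩
  case P.S c d =>
    obtain ⟨a, h⟩ := delta_eq_smul k (m := m) c d
    exact .inr ⟨a, _, h, rfl, by fin_cases c <;> rfl⟩
  case a.b => simp [Lab.Mem] at hσ
  case top.b => simp [Lab.Mem] at hσ
  case b.v c =>
    obtain ⟨a, h⟩ := beta_eq_smul k (m := m) c 0
    exact .inr ⟨a, _, h, rfl, by fin_cases c <;> rfl⟩
  case b.w c =>
    obtain ⟨a, h⟩ := beta_eq_smul k (m := m) c 1
    exact .inr ⟨a, _, h, rfl, by fin_cases c <;> rfl⟩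
  case S.z c i =>
    by_cases hi : (i : ℕ) = 1
    · refine .inr ⟨1, ![.s, .t, .u] c, (if_pos hi).trans ?_,
        by simp [Lab.layer, Lab.relLayer, hi], ?_⟩
      · rw [one_smul]
        fin_cases c <;> rfl
      · fin_cases c <;> rfl
    · exact .inl (if_neg hi)
  case b.x c i =>
    by_cases hi : (i : ℕ) = 1
    · obtain ⟨a, h⟩ := beta_eq_smul k (m := m) c 2
      exact .inr ⟨a, _, (if_pos hi).trans h, by simp [Lab.layer, Lab.relLayer, hi],
        by fin_cases c <;> rfl⟩
    · exact .inl (if_neg hi)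
  case b.y c i =>
    by_cases hi : (i : ℕ) = 1
    · obtain ⟨a, h⟩ := beta_eq_smul k (m := m) c 3
      exact .inr ⟨a, _, (if_pos hi).trans h, by simp [Lab.layer, Lab.relLayer, hi],
        by fin_cases c <;> rfl⟩
    · exact .inl (if_neg hi)
  case v.x i =>
    by_cases hi : (i : ℕ) = 2
    · exact .inr ⟨1, .v, (if_pos hi).trans (one_smul _ _).symm,
        by simp [Lab.layer, Lab.relLayer, hi], rfl⟩
    · exact .inl (if_neg hi)
  case w.x i =>
    by_cases hi : (i : ℕ) = 2
    · exact .inr ⟨1, .w, (if_pos hi).trans (one_smul _ _).symm,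
        by simp [Lab.layer, Lab.relLayer, hi], rfl⟩
    · exact .inl (if_neg hi)
  case x.x i i' =>
    by_cases hi : (i' : ℕ) = i + 1
    · by_cases h : 1 ≤ (i : ℕ) ∧ i + 2 ≤ m
      · exact .inr ⟨1, .x i h, (if_pos hi).trans (by rw [one_smul, genX_eq k h]),
          by simp [Lab.layer, Lab.relLayer, hi]; try omega, rfl⟩
      · exact .inl ((if_pos hi).trans (dif_neg h))
    · exact .inl (if_neg hi)
  case y.x i i' =>
    by_cases hi : (i' : ℕ) = i + 1
    · by_cases h : 1 ≤ (i : ℕ) ∧ i + 3 ≤ m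
      · exact .inr ⟨1, .y i h, (if_pos hi).trans (by rw [one_smul, genY_eq k h]),
          by simp [Lab.layer, Lab.relLayer, hi]; try omega, rfl⟩
      · exact .inl ((if_pos hi).trans (dif_neg h))
    · exact .inl (if_neg hi)
  case y.y i i' =>
    by_cases hi : (i' : ℕ) = i + 1
    · by_cases h : 1 ≤ (i : ℕ) ∧ i + 4 ≤ m
      · exact .inr ⟨1, .z i h, (if_pos hi).trans (by rw [one_smul, genZ_eq k h]),
          by simp [Lab.layer, Lab.relLayer, hi]; try omega, rfl⟩
      · exact .inl ((if_pos hi).trans (dif_neg h))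
    · exact .inl (if_neg hi)
  case z.z i i' =>
    by_cases hi : (i' : ℕ) = i + 1
    · by_cases h : 1 ≤ (i : ℕ) ∧ i + 4 ≤ m
      · exact .inr ⟨1, .z i h, (if_pos hi).trans (by rw [one_smul, genZ_eq k h]),
          by simp [Lab.layer, Lab.relLayer, hi]; try omega, rfl⟩
      · exact .inl ((if_pos hi).trans (dif_neg h))
    · exact .inl (if_neg hi)

theorem exists_layeredPresentation (hm : 3 ≤ m) : ∃ κ : Idx m 2 → Idx m 1 → Idx m 1 → k,
    LayeredPresentation (gradeC k m) (fun ρ : Idx m 1 => lamOne k m ρ.1) (lam k m 1) κ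
      (fun ρ => ρ.1.layer) (fun ρ => ρ.1.relLayer) := by
  classical
  have h1 : ∀ (ρ : Idx m 2) (σ : Idx m 1), ∃ κ : Idx m 1 → k,
      lam k m 1 ρ σ = ∑ τ, κ τ • lamOne k m τ.1 ∧
      ∀ τ, κ τ ≠ 0 → σ.1.layer = ρ.1.relLayer ∧ τ.1.layer + 1 = ρ.1.relLayer := by
    intro ρ σ
    rcases lamEntry_two_eq_smul k ρ.1 σ.2 with h | ⟨a, τ, h, h2, h3⟩
    · exact ⟨0, by simpa using! h, fun τ h => absurd rfl h⟩
    · refine ⟨Pi.single (τ.idx hm) a, ?_, fun τ' hτ' => ⟨h2, ?_⟩⟩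
      · rw [Finset.sum_eq_single (τ.idx hm)]
        · rw [Pi.single_eq_same]
          change lamEntry k m 2 ρ.1 σ.1 = a • lamOne k m τ.lab
          rw [h, lamOne_lab]
        · intro τ' _ hτ'
          rw [Pi.single_eq_of_ne hτ', zero_smul]
        · simp
      · by_cases h4 : τ' = τ.idx hm
        · rw [h4]
          exact h3
        · exact (hτ' (by rw [Pi.single_eq_of_ne h4])).elim
  choose κ hκ hlay using h1
  refine ⟨κ, fun σ => lamOne_mem k σ.1, ?_, ?_, fun v hv => mem_range_lam_one k hm v hv, hκ,
    fun ρ σ τ h => (hlay ρ σ τ h).1, fun ρ σ τ h => (hlay ρ σ τ h).2⟩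
  · refine eq_top_iff.2 fun a _ => ?_
    induction a using C_induction with
    | h0 c => exact Subalgebra.algebraMap_mem _ c
    | h1 g =>
      refine Algebra.subset_adjoin ⟨g.idx hm, ?_⟩
      exact lamOne_lab k g
    | hadd a b ha hb => exact add_mem (ha trivial) (hb trivial)
    | hmul a b ha hb => exact mul_mem (ha trivial) (hb trivial)
  · intro ρ
    have := congrFun (congrFun (lam_mul_lam k hm 0) ρ) (idxUnit m)
    rwa [Matrix.mul_apply] at this

end Layers

/-! ### The global dimension of `C` -/

section GlobalDimension

universe v

variable (k : Type v) [Field k] {m : ℕ}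

/-- The modules `A ⊗ M` are projective over `A`, so dimension shifting along the tensored complex
applies from its last nonzero term. -/
theorem pdLT_range_tensorMatrix {A : Type v} [Ring A] [Algebra k A] {I : ℕ → Type}
    [∀ i, Fintype (I i)] {Λ : ∀ i, Matrix (I (i + 1)) (I i) A}
    (h : ∀ i, Function.Exact (Matrix.vecMulLinear (Λ (i + 1))) (Matrix.vecMulLinear (Λ i)))
    (M : Type v) [AddCommGroup M] [Module k M] (n : ℕ) :
    ∀ i [IsEmpty (I (i + n + 1))], PdLT A (LinearMap.range (tensorMatrix k M (Λ i))) n := by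
  induction n with
  | zero =>
    intro i _
    have : IsEmpty (I (i + 1)) := ‹_›
    have : Subsingleton (LinearMap.range (tensorMatrix k M (Λ i))) := by
      refine ⟨?_⟩
      rintro ⟨_, a, rfl⟩ ⟨_, b, rfl⟩
      exact Subtype.ext (congrArg (tensorMatrix k M (Λ i)) (Subsingleton.elim a b))
    exact pdLT_of_subsingleton 0
  | succ n ih =>
    intro i _
    have : IsEmpty (I (i + 1 + n + 1)) := by
      rw [show i + 1 + n + 1 = i + (n + 1) + 1 by omega]
      infer_instance
    exact (pdLT_range_iff _ _ (tensorMatrix_exact (h i))).1 (ih (i + 1))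

theorem pdLT_range_sumMap {A : Type v} [Ring A] [Algebra k A] {I J : Type} [Fintype I] [Fintype J]
    {Λ : Matrix I J A} (e : J) {M : Type v} [AddCommGroup M] [Module k M] [Module A M]
    [IsScalarTower k A M] {g : I → A} (hg : ∀ ρ σ, Λ ρ σ = g ρ) {n : ℕ}
    (hn : PdLT A (LinearMap.range (tensorMatrix k M Λ)) n) :
    PdLT A (LinearMap.range (LayeredPresentation.sumMap k M g)) n := by
  let f := LayeredPresentation.sumMap k M g
  let f' := tensorMatrix k M Λ
  have hf : ∀ a σ, f' a σ = f a := fun a σ => by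
    rw [LayeredPresentation.sumMap_apply, tensorMatrix_apply]
    simp only [hg]
  let i : LinearMap.range f →ₗ[A] LinearMap.range f' :=
    LinearMap.codRestrict _ ((LinearMap.pi fun _ => LinearMap.id) ∘ₗ (LinearMap.range f).subtype) (by
      rintro ⟨_, a, rfl⟩
      exact ⟨a, funext fun σ => hf a σ⟩)
  let r : LinearMap.range f' →ₗ[A] LinearMap.range f :=
    LinearMap.codRestrict _ (LinearMap.proj e ∘ₗ (LinearMap.range f').subtype) (by
      rintro ⟨_, a, rfl⟩
      exact ⟨a, (hf a _).symm⟩)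
  exact pdLT_of_retract i r (fun x => rfl) hn

/-- If the resolution `Λ` of the trivial module has length `m`, and if its start is layered, then
every module has projective dimension at most `m`. -/
theorem LayeredPresentation.pdLT_of_resolution {A : Type v} [Ring A] [Algebra k A]
    {𝒜 : ℕ → Submodule k A} [GradedAlgebra 𝒜] {I : ℕ → Type} [∀ i, Fintype (I i)]
    {Λ : ∀ i, Matrix (I (i + 1)) (I i) A} (e : I 0) (he : ∀ e', e' = e)
    {κ : I 2 → I 1 → I 1 → k} {lay : I 1 → ℕ} {relLay : I 2 → ℕ}
    (hL : LayeredPresentation 𝒜 (fun ρ => Λ 0 ρ e) (Λ 1) κ lay relLay)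
    (h : ∀ i, Function.Exact (Matrix.vecMulLinear (Λ (i + 1))) (Matrix.vecMulLinear (Λ i)))
    [IsEmpty (I (m + 1))] (M : Type v) [AddCommGroup M] [Module A M] : PdLT A M (m + 1) := by
  let _ : Module k M := Module.compHom M (algebraMap k A)
  have : IsScalarTower k A M := ⟨fun c a μ => by
    change (c • a) • μ = algebraMap k A c • a • μ
    rw [Algebra.smul_def, mul_smul]⟩
  have : IsEmpty (I (0 + m + 1)) := by
    rw [zero_add]
    infer_instance
  exact hL.pdLT_succ (pdLT_range_sumMap k e (fun ρ σ => by rw [he σ])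
    (pdLT_range_tensorMatrix k h M m 0))

theorem pdLT_succ_of_module (hm : 3 ≤ m) (M : Type v) [AddCommGroup M] [Module (C k m) M] :
    PdLT (C k m) M (m + 1) := by
  obtain ⟨κ, h⟩ := exists_layeredPresentation k hm
  have := isEmpty_idx (m := m) (j := m + 1) hm (by omega)
  exact LayeredPresentation.pdLT_of_resolution k (I := Idx m) (Λ := lam k m) (idxUnit m)
    (isMinimalGradedResolution k hm).unique h (lam_exact_succ k hm) M

/-- A projective image would split the last injection of the resolution. Its matrix has entries in
`A₊`, which is incompatible with a left inverse when the last module is not zero. -/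
theorem not_projective_range_lam (m : ℕ) :
    ¬ Module.Projective (C k (m + 3))
      (LinearMap.range (Matrix.vecMulLinear (lam k (m + 3) (m + 1)))) := by
  intro hP
  have hm : 3 ≤ m + 3 := by omega
  let d := Matrix.vecMulLinear (lam k (m + 3) (m + 1))
  let d' := Matrix.vecMulLinear (lam k (m + 3) (m + 2))
  have hexact : Function.Exact d' d := lam_exact_succ k hm (m + 1)
  have hinj : Function.Injective d' := by
    have := isEmpty_idx (m := m + 3) (j := m + 4) hm (by omega)
    refine (injective_iff_map_eq_zero d').2 fun v hv => ?_
    obtain ⟨w, rfl⟩ := (lam_exact_succ k hm (m + 2) v).1 hv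
    rw [Subsingleton.elim w 0, map_zero]
  obtain ⟨s, hs⟩ := Module.projective_lifting_property d.rangeRestrict LinearMap.id
    (LinearMap.surjective_rangeRestrict d)
  have h1 : ∀ σ : Idx (m + 3) (m + 2), ∃ u, d' u =
      unitVec _ σ - s (d.rangeRestrict (unitVec _ σ)) := by
    intro σ
    refine (hexact _).1 ?_
    have := congrArg Subtype.val (LinearMap.congr_fun hs (d.rangeRestrict (unitVec _ σ)))
    rw [map_sub, sub_eq_zero]
    exact this.symm
  choose u hu using h1
  let e : Idx (m + 3) (m + 3) := ⟨.top, rfl⟩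
  have h2 : d' (unitVec _ e) = ∑ σ, lam k (m + 3) (m + 2) e σ • unitVec _ σ := by
    rw [sum_smul_unitVec]
    exact vecMulLinear_unitVec _ _
  have h3 : ∑ σ, lam k (m + 3) (m + 2) e σ • s (d.rangeRestrict (unitVec _ σ)) = 0 := by
    simp only [← map_smul, ← map_sum, ← h2]
    have : d.rangeRestrict (d' (unitVec _ e)) = 0 :=
      Subtype.ext (hexact.apply_apply_eq_zero _)
    rw [this, map_zero]
  have h4 : unitVec _ e = ∑ σ, lam k (m + 3) (m + 2) e σ • u σ := by
    apply hinj
    rw [map_sum, h2, ← sub_zero (∑ σ, _), ← h3, ← Finset.sum_sub_distrib]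
    refine Finset.sum_congr rfl fun σ _ => ?_
    rw [map_smul, hu, smul_sub]
  -- The coordinate of the basis vector `e` is `1`, while every summand on the right has a
  -- coefficient in `A₊`.
  have h5 := congrArg (augC k (m + 3)) (congrFun h4 e)
  rw [Finset.sum_apply, map_sum, Finset.sum_eq_zero] at h5
  · simp [unitVec] at h5
  · intro σ _
    have : augC k (m + 3) (lam k (m + 3) (m + 2) e σ) = 0 :=
      (augC_eq_zero_iff k _).2 ((isMinimalGradedResolution k hm).minimal _ _ _)
    rw [Pi.smul_apply, smul_eq_mul, map_mul, this, zero_mul]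

theorem exists_not_pdLT (m : ℕ) : ∃ M : ModuleCat.{v} (C k (m + 3)),
    ¬ HasProjectiveDimensionLT M (m + 3) := by
  have hm : 3 ≤ m + 3 := by omega
  let _ : Module (C k (m + 3)) k := Module.compHom k (augC k (m + 3)).toRingHom
  refine ⟨ModuleCat.of (C k (m + 3)) k, fun hk => not_projective_range_lam k m ?_⟩
  let ε : (Idx (m + 3) 0 → C k (m + 3)) →ₗ[C k (m + 3)] k :=
    { toFun := fun v => augC k (m + 3) (v (idxUnit (m + 3)))
      map_add' := fun v w => map_add _ _ _
      map_smul' := fun a v => map_mul _ _ _ }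
  have hε : Function.Exact (Matrix.vecMulLinear (lam k (m + 3) 0)) ε := lam_exact_zero k hm
  have hsurj : Function.Surjective ε := fun c =>
    ⟨fun _ => algebraMap k _ c, AlgHom.commutes (augC k (m + 3)) c⟩
  have h0 : PdLT (C k (m + 3)) (LinearMap.range ε) (m + 3) := by
    refine pdLT_of_retract (LinearMap.range ε).subtype
      (LinearMap.codRestrict _ LinearMap.id fun c => hsurj c) (fun x => rfl) hk
  -- If `k` had projective dimension below `m + 3`, each syzygy would lower the bound by one; at `i
  -- = m + 1` the bound is `1`, that is, projectivity.
  have h1 : ∀ i, i ≤ m + 1 → PdLT (C k (m + 3))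
      (LinearMap.range (Matrix.vecMulLinear (lam k (m + 3) i))) (m + 2 - i) := by
    intro i
    induction i with
    | zero => exact fun _ => (pdLT_range_iff _ _ hε).2 h0
    | succ i ih =>
      intro hi
      have h2 := ih (by omega)
      obtain ⟨n, hn⟩ : ∃ n, m + 2 - i = n + 2 := ⟨m - i, by omega⟩
      rw [hn] at h2
      have h3 := (pdLT_range_iff _ _ (lam_exact_succ k hm i)).2 h2
      rwa [show m + 2 - (i + 1) = n + 1 by omega]
  have h2 := h1 (m + 1) le_rfl
  rw [show m + 2 - (m + 1) = 1 by omega] at h2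
  exact pdLT_one_iff.1 h2

theorem leftGlobalDimension_C (hm : 3 ≤ m) : leftGlobalDimension (C k m) = (m : WithBot ℕ∞) := by
  refine le_antisymm (sSup_le ?_) ?_
  · rintro _ ⟨M, rfl⟩
    exact (projectiveDimension_le_iff M m).2 (pdLT_succ_of_module k hm M)
  · obtain ⟨m, rfl⟩ : ∃ m', m = m' + 3 := ⟨m - 3, by omega⟩
    obtain ⟨M, hM⟩ := exists_not_pdLT k m
    exact ((projectiveDimension_ge_iff M (m + 3)).2 hM).trans (le_sSup ⟨M, rfl⟩)

end GlobalDimension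

end QuadExt

namespace QuadExt

/-! ### Quadratic presentations on numbered generators -/

section Presentation

variable {k : Type*} [Field k]

/-- The map of free algebras that a map of the generators induces. -/
noncomputable def freeMap (k : Type*) [Field k] {ι ι' : Type*} (e : ι → ι') :
    FreeAlgebra k ι →ₐ[k] FreeAlgebra k ι' :=
  FreeAlgebra.lift k fun i => FreeAlgebra.ι k (e i)

theorem freeMap_ι {ι ι' : Type*} (e : ι → ι') (i : ι) :
    freeMap k e (FreeAlgebra.ι k i) = FreeAlgebra.ι k (e i) := by
  simp [freeMap]

theorem freeMap_freeMap {ι ι' : Type*} (e : ι ≃ ι') (a : FreeAlgebra k ι) :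
    freeMap k e.symm (freeMap k e a) = a := by
  have h : (freeMap k e.symm).comp (freeMap k e) = AlgHom.id k _ := by
    apply FreeAlgebra.hom_ext
    funext i
    simp [freeMap_ι]
  exact DFunLike.congr_fun h a

theorem freeMap_mem {ι ι' : Type*} (e : ι → ι') {n : ℕ} {a : FreeAlgebra k ι}
    (ha : a ∈ freeGrade k ι n) : freeMap k e a ∈ freeGrade k ι' n := by
  have h : (freeGrade k ι n).map (freeMap k e).toLinearMap ≤ freeGrade k ι' n := by
    rw [freeGrade, freeGrade, Submodule.map_pow]
    refine pow_le_pow_left' ?_ n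
    rw [Submodule.map_span, Submodule.span_le]
    rintro _ ⟨_, ⟨i, rfl⟩, rfl⟩
    exact Submodule.subset_span ⟨e i, (freeMap_ι e i).symm⟩
  exact h ⟨a, ha, rfl⟩

theorem isQuadratic_quotGrade {ι : Type*} [Finite ι]
    {r : FreeAlgebra k ι → FreeAlgebra k ι → Prop} (hr : QuadraticRel r) :
    IsQuadratic (quotGrade r) := by
  obtain ⟨N, ⟨e⟩⟩ := Finite.exists_equiv_fin ι
  have hinv : ∀ a, freeMap k e (freeMap k e.symm a) = a := freeMap_freeMap e.symm
  let r' : FreeAlgebra k (Fin N) → FreeAlgebra k (Fin N) → Prop := fun a b =>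
    r (freeMap k e.symm a) (freeMap k e.symm b)
  let φ : RingQuot r' →ₐ[k] RingQuot r := RingQuot.liftAlgHom k
    ⟨(RingQuot.mkAlgHom k r).comp (freeMap k e.symm), fun a b h => RingQuot.mkAlgHom_rel k h⟩
  let ψ : RingQuot r →ₐ[k] RingQuot r' := RingQuot.liftAlgHom k
    ⟨(RingQuot.mkAlgHom k r').comp (freeMap k e), fun a b h => RingQuot.mkAlgHom_rel k (by
      change r (freeMap k e.symm (freeMap k e a)) (freeMap k e.symm (freeMap k e b))
      rwa [freeMap_freeMap, freeMap_freeMap])⟩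
  have hφ : ∀ i, φ (RingQuot.mkAlgHom k r' (FreeAlgebra.ι k i)) =
      RingQuot.mkAlgHom k r (FreeAlgebra.ι k (e.symm i)) := fun i => by
    refine (RingQuot.liftAlgHom_mkAlgHom_apply k _ _ _).trans ?_
    rw [AlgHom.comp_apply, freeMap_ι]
  have hψ : ∀ i, ψ (RingQuot.mkAlgHom k r (FreeAlgebra.ι k i)) =
      RingQuot.mkAlgHom k r' (FreeAlgebra.ι k (e i)) := fun i => by
    refine (RingQuot.liftAlgHom_mkAlgHom_apply k _ _ _).trans ?_
    rw [AlgHom.comp_apply, freeMap_ι]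
  refine ⟨N, r', AlgEquiv.ofAlgHom φ ψ ?_ ?_, ?_, fun n => ?_⟩
  · apply RingQuot.ringQuot_ext'
    apply FreeAlgebra.hom_ext
    funext i
    simp [hφ, hψ]
  · apply RingQuot.ringQuot_ext'
    apply FreeAlgebra.hom_ext
    funext i
    simp [hφ, hψ]
  · intro a b h
    rw [← hinv a, ← hinv b]
    exact ⟨freeMap_mem e (hr _ _ h).1, freeMap_mem e (hr _ _ h).2⟩
  · change _ = (quotGrade r' n).map φ.toLinearMap
    rw [quotGrade, quotGrade, Submodule.map_pow, Submodule.map_span, ← Set.range_comp]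
    congr 2
    ext a
    constructor
    · rintro ⟨i, rfl⟩
      exact ⟨e i, (hφ (e i)).trans (by rw [e.symm_apply_apply])⟩
    · rintro ⟨i, rfl⟩
      exact ⟨e.symm i, (hφ i).symm⟩

instance {ι : Type*} [Finite ι] (r : FreeAlgebra k ι → FreeAlgebra k ι → Prop) :
    Module.Finite k (quotGrade r 1) := by
  rw [quotGrade, pow_one]
  exact Module.Finite.span_of_finite k (Set.finite_range _)

end Presentation

/-! ### The assertions about the Yoneda algebra -/

section Main

variable (k : Type*) [Field k] {m : ℕ}

theorem isQuadratic_gradeC (m : ℕ) : IsQuadratic (gradeC k m) :=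
  isQuadratic_quotGrade (quadraticRel_Rel k m)

/-- The index of the basis vector of degree `m + 1`. -/
def idxTop (m : ℕ) : Idx m m := ⟨.top, rfl⟩

theorem deg_eq_or (n : ℕ) (ρ : Idx m n) :
    ρ.1.deg m n = n ∨ n = m ∧ ρ.1.deg m n = m + 1 := by
  by_cases h : ρ.1 = .top
  · refine .inr ⟨?_, by rw [h]; rfl⟩
    have := ρ.2
    rwa [h] at this
  · exact .inl (deg_of_ne_top h)

theorem cocycles_le_coboundaries (hm : 3 ≤ m) {n j : ℕ} (hj : j ≠ n)
    (h : (n, j) ≠ (m, m + 1)) : cocycles (gradeC k m) n j ≤ coboundaries (gradeC k m) n j := by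
  intro f hf
  refine coboundary_of_deg_ne (augC_eq_zero_iff k) (isMinimalGradedResolution k hm)
    (fun ρ hρ => ?_) hf
  rcases deg_eq_or n ρ with h' | ⟨rfl, h'⟩
  · exact hj (hρ.symm.trans h')
  · exact h (by rw [← hρ, h'])

theorem isBackelinKoszul (hm : 3 ≤ m) : IsBackelinKoszul (gradeC k m) m := by
  intro i j hij hj
  refine ext_subsingleton_of_deg_ne (augC_eq_zero_iff k) (isMinimalGradedResolution k hm)
    fun ρ hρ => ?_
  rcases deg_eq_or i ρ with h | ⟨_, h⟩ <;> omega

theorem nontrivial_ext_top (hm : 3 ≤ m) : Nontrivial (Ext (gradeC k m) m (m + 1)) :=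
  ext_nontrivial (augC_eq_zero_iff k) (isMinimalGradedResolution k hm) (idxTop m)

/-- Away from the diagonal and from `(m, m + 1)` all cocycles are coboundaries, so such a `T`
generates diagonal classes only and misses the nonzero class of bidegree `(m, m + 1)`. -/
theorem not_extGeneratedIn (hm : 3 ≤ m) {T : Set (ℕ × ℕ)}
    (hT : ∀ t ∈ T, t.2 ≠ t.1 → t ≠ (m, m + 1)) : ¬ ExtGeneratedIn (gradeC k m) T := by
  intro h
  obtain ⟨f, hf, hf'⟩ := exists_not_coboundary (augC_eq_zero_iff k)
    (isMinimalGradedResolution k hm) (idxTop m)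
  exact hf' (coboundary_of_extGeneratedIn (augC_eq_zero_iff k)
    (fun n j hnj hj => cocycles_le_coboundaries k hm hj (hT _ hnj hj)) h (Nat.succ_ne_self m) hf)

theorem not_isKoszul (hm : 3 ≤ m) : ¬ IsKoszul (gradeC k m) :=
  not_extGeneratedIn k hm fun t ht h => absurd (by rw [Set.mem_singleton_iff.1 ht]) h

theorem exists_finite_generators_gradeC (hm : 3 ≤ m) : ∃ G : ∀ n : ℕ, Set (BarFun (gradeC k m) n),
    {q : (n : ℕ) × BarFun (gradeC k m) n | q.2 ∈ G q.1}.Finite ∧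
    (∀ n, G n ⊆ classesIn (gradeC k m) {(1, 1), (m, m + 1)} n) ∧
    GeneratesExt (gradeC k m) G := by
  obtain ⟨f₀, hf₀, h₀⟩ := exists_generator (augC_eq_zero_iff k)
    (isMinimalGradedResolution k hm) (idxTop m) fun σ hσ => by
      by_contra h
      have h1 : σ.1.deg m m = m := deg_of_ne_top fun h' => h (Subtype.ext h')
      have h2 : σ.1.deg m m = m + 1 := hσ
      omega
  exact exists_finite_generators (gradeC k m) (augC_eq_zero_iff k) hf₀ h₀ fun n j hj h =>
    cocycles_le_coboundaries k hm hj h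

theorem extGeneratedIn (hm : 3 ≤ m) : ExtGeneratedIn (gradeC k m) {(1, 1), (m, m + 1)} := by
  obtain ⟨G, -, hG, h⟩ := exists_finite_generators_gradeC k hm
  exact fun n j f hf => (h n j f hf).mono hG

theorem eq_idxTop (hm : 4 ≤ m) (ρ : Idx m m) : ρ = idxTop m := by
  obtain ⟨l, hl⟩ := ρ
  refine Subtype.ext ?_
  change l = .top
  cases l <;> simp only [Lab.Mem] at hl <;> first | rfl | (exfalso; split_ifs at hl <;> omega) |
    (exfalso; omega)

theorem isDeltaKoszul (hm : 4 ≤ m) :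
    IsDeltaKoszul (gradeC k m) (fun i => if i < m then i else i + 1) := by
  have hm' : 3 ≤ m := by omega
  refine ⟨fun i j hj => ?_, ?_⟩
  · refine ext_subsingleton_of_deg_ne (augC_eq_zero_iff k) (isMinimalGradedResolution k hm')
      fun ρ hρ => hj ?_
    rw [← hρ]
    beta_reduce
    rcases lt_trichotomy i m with h | rfl | h
    · rw [if_pos h]
      rcases deg_eq_or i ρ with h' | ⟨h', -⟩
      · exact h'
      · omega
    · rw [eq_idxTop hm ρ, if_neg (lt_irrefl i)]
      rfl
    · exact ((isEmpty_idx hm' h).false ρ).elim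
  · obtain ⟨G, hfin, hG, h⟩ := exists_finite_generators_gradeC k hm'
    refine ⟨G, hfin, fun n f hf => ?_, h⟩
    obtain ⟨j, -, hj⟩ := hG n hf
    exact ⟨j, hj⟩

end Main

end QuadExt

theorem theorem2p7 (k : Type u) [Field k] :
    (∀ m : ℕ, 3 ≤ m →
      -- the complex is a minimal graded projective resolution, of length `m`, of the trivial module
      (QuadExt.IsMinimalGradedResolution (QuadExt.gradeC k m) (QuadExt.augC k m)
          (QuadExt.Idx m) (fun j l => l.1.deg m j) (QuadExt.idxUnit m) (QuadExt.lam k m) ∧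
        ∀ j, m < j → IsEmpty (QuadExt.Idx m j)) ∧
      QuadExt.leftGlobalDimension (QuadExt.C k m) = (m : WithBot ℕ∞) ∧
      QuadExt.IsQuadratic (QuadExt.gradeC k m) ∧
      QuadExt.IsBackelinKoszul (QuadExt.gradeC k m) m ∧
      Nontrivial (QuadExt.Ext (QuadExt.gradeC k m) m (m + 1)) ∧
      ¬ QuadExt.IsKoszul (QuadExt.gradeC k m) ∧
      QuadExt.ExtGeneratedIn (QuadExt.gradeC k m) {(1, 1), (m, m + 1)} ∧
      (4 ≤ m → QuadExt.IsDeltaKoszul (QuadExt.gradeC k m)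
        (fun i => if i < m then i else i + 1))) ∧
    -- no bound on the cohomological degrees of generators of `E(A)` for `δ`-Koszul algebras `A`
    ¬ ∃ N : ℕ, ∀ (A : Type u) [Ring A] [Algebra k A] (𝒜 : ℕ → Submodule k A) [GradedAlgebra 𝒜],
      QuadExt.IsQuadratic 𝒜 → (∃ δ : ℕ → ℕ, QuadExt.IsDeltaKoszul 𝒜 δ) →
        QuadExt.ExtGeneratedIn 𝒜 {t | t.1 ≤ N} := by
  refine ⟨fun m hm => ⟨⟨QuadExt.isMinimalGradedResolution k hm, fun j hj => QuadExt.isEmpty_idx hm hj⟩,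
    QuadExt.leftGlobalDimension_C k hm, QuadExt.isQuadratic_gradeC k m, QuadExt.isBackelinKoszul k hm,
    QuadExt.nontrivial_ext_top k hm, QuadExt.not_isKoszul k hm, QuadExt.extGeneratedIn k hm, QuadExt.isDeltaKoszul k⟩, ?_⟩
  rintro ⟨N, h⟩
  -- The choice `m = N + 4` satisfies both `m ≥ 4`, needed for `δ`-Koszulity, and `m > N`.
  refine QuadExt.not_extGeneratedIn k (m := N + 4) (by omega) (fun t ht _ => ?_)
    (h (QuadExt.C k (N + 4)) (QuadExt.gradeC k (N + 4)) (QuadExt.isQuadratic_gradeC k _) ⟨_, QuadExt.isDeltaKoszul k (by omega)⟩)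
  rintro rfl
  have : N + 4 ≤ N := ht
  omega
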